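/- **Theorem.** For a small category $\mathcal A$, let $\Delta\wr\mathcal A$ be the category whose objects are the tuples $(A_1,\dots,A_m)$, $m\ge 0$, of objects of $\mathcal A$, and whose morphisms $(A_1,\dots,A_m)\to(B_1,\dots,B_l)$ consist of a morphism $\phi:[m]\to[l]$ of the simplex category $\Delta$ and of morphisms $\phi_i^k:A_i\to B_k$ in $\mathcal A$ for all $1\le i\le m$ and $\phi(i-1)<k\le\phi(i)$, composed componentwise (the composite of $(\phi;\phi_i^j)$ and $(\psi;\psi_j^k)$ has components $\psi_j^k\circ\phi_i^j$, where $j$ is the unique index with $\phi(i-1)<j\le\phi(i)$ and $\psi(j-1)<k\le\psi(j)$). Put $\Theta_1=\Delta$ and $\Theta_{n+1}=\Delta\wr\Theta_n$ for $n\ge 1$. An $n$-graph is a graded set $(X_k)_{0\le k\le n}$ with maps $s,t:X_{k+1}\rightrightarrows X_k$ such that $ss=st$ and $ts=tt$. Let $\mathbf{nCat}$ be the category of small strict $n$-categories (a strict $0$-category is a set, and a strict $(n+1)$-category is a category enriched in the cartesian category of strict $n$-categories), let $\mathbf{nGrph}$ be the category of $n$-graphs, and let $U_n:\mathbf{nCat}\to\mathbf{nGrph}$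 be the forgetful functor. A finite level-tree is a finite planar rooted tree; its height is the maximal distance of a vertex from the root. For a finite level-tree $T$ of height $\le n$, let $T_*$ be Batanin's $n$-graph: its $k$-cells are the sectors of $T$ of height $k$, a vertex of height $k$ with $m$ incoming edges having $m+1$ sectors (the gaps to the left of, between, and to the right of these edges), and the source (resp. target) of a sector at a vertex $v$ of height $k+1$ is the sector immediately to the left (resp. right) of the edge which joins $v$ to the vertex of height $k$ below it. Then, for every $n\ge 1$: 1. Sending $[m]\in\Theta_1$ to the corolla with $m$ edges and $(A_1,\dots,A_m)\in\Theta_n$ $(n\ge 2)$ to the tree obtained by grafting the trees of $A_1,\dots,A_m$ in this order onto the corolla with $m$ edges defines a bijection $A\mapsto T_A$ from the objects of $\Theta_n$ to the finite level-trees of height $\le n$. 2. $U_n$ has a left adjoint, and for every left adjoint $F_n$ of $U_n$ there is a full and faithful functor $E:\Theta_n\to\mathbf{nCat}$, injective on objects, with $E(A)=F_n((T_A)_*)$ for every object $A$ of $\Theta_n$. Hence $\Theta_n$ embeds in $\mathbf{nCat}$ as the full subcategory spanned by the free $n$-categories $F_n(T_*)$, where $T$ runs through the finite level-trees of height $\le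 n$. 3. This subcategory is dense: the nerve functor $\mathbf{nCat}\to\mathbf{Sets}^{\Theta_n^{\mathrm{op}}}$, $C\mapsto\mathbf{nCat}(E(-),C)$, is full and faithful. -/

import Mathlib

universe u

open CategoryTheory

/-! ## Wreath product with the simplex category -/

/-- Objects of the wreath product `Δ ≀ A`: the `m`-tuples `(A₁, …, A_m)` of objects of `A`, for
varying `m ≥ 0` (indexed here from `0` to `m - 1`). -/
structure Wreath (A : Type) where
  /-- the length `m` of the tuple -/
  len : ℕ
  /-- the entries of the tuple -/
  obj : Fin len → A

namespace Wreath

/-- For `φ : [m] → [n]`, an index `i` of an `m`-tuple and an index `k` of an `n`-tuple, the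
condition `φ(i-1) < k ≤ φ(i)` for indices starting from `1`, which is `φ(i) ≤ k < φ(i+1)` for
indices starting from `0`. -/
def InBlock {m n : ℕ} (φ : SimplexCategory.mk m ⟶ SimplexCategory.mk n)
    (i : Fin m) (k : Fin n) : Prop :=
  φ.toOrderHom i.castSucc ≤ k.castSucc ∧ k.castSucc < φ.toOrderHom i.succ

/-- An operator `(A₁, …, A_m) ⟶ (B₁, …, B_n)` of `Δ ≀ A`: a simplicial operator
`φ : [m] ⟶ [n]` and, for each `i`, a map from (the presheaf represented by) `A_i` to the product
of (the presheaves represented by) the `B_k` with `φ(i-1) < k ≤ φ(i)`, given by its components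
`A_i ⟶ B_k`. -/
@[ext]
structure Hom {A : Type} [Category.{0} A] (X Y : Wreath A) where
  /-- the underlying simplicial operator -/
  base : SimplexCategory.mk X.len ⟶ SimplexCategory.mk Y.len
  /-- the components `A_i ⟶ B_k` -/
  comp : ∀ (i : Fin X.len) (k : Fin Y.len), InBlock base i k → (X.obj i ⟶ Y.obj k)

theorem inBlock_id {m : ℕ} {i k : Fin m} (h : InBlock (𝟙 (SimplexCategory.mk m)) i k) :
    i = k := by
  obtain ⟨h1, h2⟩ := h
  simp only [SimplexCategory.id_toOrderHom, OrderHom.id_coe, id_eq] at h1 h2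
  rw [Fin.le_def] at h1
  rw [Fin.lt_def] at h2
  simp only [Fin.val_castSucc, Fin.val_succ] at h1 h2
  exact Fin.ext (by omega)

/-- Two blocks of the same operator that share an index coincide. -/
theorem InBlock.unique {m n : ℕ} {φ : SimplexCategory.mk m ⟶ SimplexCategory.mk n}
    {i j : Fin m} {k : Fin n} (hi : InBlock φ i k) (hj : InBlock φ j k) : i = j := by
  by_contra hne
  rcases lt_or_gt_of_ne hne with h | h
  · have h3 : φ.toOrderHom i.succ ≤ φ.toOrderHom j.castSucc :=
      φ.toOrderHom.monotone (by rw [Fin.le_def]; simpa using h)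
    exact absurd (lt_of_lt_of_le hi.2 (h3.trans hj.1)) (lt_irrefl _)
  · have h3 : φ.toOrderHom j.succ ≤ φ.toOrderHom i.castSucc :=
      φ.toOrderHom.monotone (by rw [Fin.le_def]; simpa using h)
    exact absurd (lt_of_lt_of_le hj.2 (h3.trans hi.1)) (lt_irrefl _)

theorem InBlock.comp {m n p : ℕ} {φ : SimplexCategory.mk m ⟶ SimplexCategory.mk n}
    {ψ : SimplexCategory.mk n ⟶ SimplexCategory.mk p} {i : Fin m} {j : Fin n} {l : Fin p}
    (h : InBlock φ i j) (h' : InBlock ψ j l) : InBlock (φ ≫ ψ) i l := by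
  constructor
  · exact le_trans (ψ.toOrderHom.monotone h.1) h'.1
  · exact lt_of_lt_of_le h'.2 (ψ.toOrderHom.monotone (by
      have := h.2
      rw [Fin.lt_def] at this
      rw [Fin.le_def]
      simpa [Nat.succ_le_iff] using this))

/-- The block of a composite operator is the union of blocks. -/
theorem InBlock.exists_mid {m n p : ℕ} {φ : SimplexCategory.mk m ⟶ SimplexCategory.mk n}
    {ψ : SimplexCategory.mk n ⟶ SimplexCategory.mk p} {i : Fin m} {l : Fin p}
    (h : InBlock (φ ≫ ψ) i l) : ∃ j : Fin n, InBlock φ i j ∧ InBlock ψ j l := by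
  have h1 : ψ.toOrderHom (φ.toOrderHom i.castSucc) ≤ l.castSucc := h.1
  have h2 : l.castSucc < ψ.toOrderHom (φ.toOrderHom i.succ) := h.2
  have key : ∀ b : Fin (n + 1), φ.toOrderHom i.castSucc ≤ b → l.castSucc < ψ.toOrderHom b →
      ∃ j : Fin n, φ.toOrderHom i.castSucc ≤ j.castSucc ∧ j.castSucc < b ∧ InBlock ψ j l := by
    intro b
    induction b using Fin.induction with
    | zero =>
      intro hb hl
      have : φ.toOrderHom i.castSucc = 0 := le_antisymm hb (Fin.zero_le _)
      rw [this] at h1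
      exact absurd (lt_of_lt_of_le hl h1) (lt_irrefl _)
    | succ j ih =>
      intro hb hl
      have hle : φ.toOrderHom i.castSucc ≤ j.castSucc := by
        rcases eq_or_lt_of_le hb with h | h
        · rw [h] at h1
          exact absurd (lt_of_lt_of_le hl h1) (lt_irrefl _)
        · rw [Fin.lt_def, Fin.val_succ] at h
          rw [Fin.le_def, Fin.val_castSucc]
          exact Nat.lt_succ_iff.mp h
      by_cases hc : l.castSucc < ψ.toOrderHom j.castSucc
      · obtain ⟨j', hj1, hj2, hj3⟩ := ih hle hc
        exact ⟨j', hj1, lt_trans hj2 (Fin.castSucc_lt_succ), hj3⟩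
      · exact ⟨j, hle, Fin.castSucc_lt_succ, not_lt.mp hc, hl⟩
  obtain ⟨j, hj1, hj2, hj3⟩ :=
    key (φ.toOrderHom i.succ) (φ.toOrderHom.monotone (Fin.castSucc_le_succ i)) h2
  exact ⟨j, ⟨hj1, hj2⟩, hj3⟩

variable {A : Type} [Category.{0} A]

/-- The identity operator. -/
def Hom.id (X : Wreath A) : Hom X X where
  base := 𝟙 _
  comp _ _ h := eqToHom (congrArg X.obj (inBlock_id h))

/-- Composition of operators: the component at `(i, l)` of the composite of `f` and `g` is
`f_i^j ≫ g_j^l`, where `j` is the unique intermediate index with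
`φ(i-1) < j ≤ φ(i)` and `ψ(j-1) < l ≤ ψ(j)`. -/
noncomputable def Hom.trans {X Y Z : Wreath A} (f : Hom X Y) (g : Hom Y Z) : Hom X Z where
  base := f.base ≫ g.base
  comp i l h :=
    f.comp i h.exists_mid.choose h.exists_mid.choose_spec.1 ≫
      g.comp h.exists_mid.choose l h.exists_mid.choose_spec.2

theorem Hom.trans_comp {X Y Z : Wreath A} (f : Hom X Y) (g : Hom Y Z)
    {i : Fin X.len} {j : Fin Y.len} {l : Fin Z.len} (h : InBlock (f.base ≫ g.base) i l)
    (h1 : InBlock f.base i j) (h2 : InBlock g.base j l) :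
    (Hom.trans f g).comp i l h = f.comp i j h1 ≫ g.comp j l h2 := by
  have e : h.exists_mid.choose = j := h.exists_mid.choose_spec.2.unique h2
  subst e
  rfl

theorem Hom.ext_of_base {X Y : Wreath A} {f g : Hom X Y} (hb : f.base = g.base)
    (hc : ∀ i k (h : InBlock f.base i k) (h' : InBlock g.base i k),
      f.comp i k h = g.comp i k h') : f = g := by
  obtain ⟨fb, fc⟩ := f
  obtain ⟨gb, gc⟩ := g
  obtain rfl : fb = gb := hb
  congr
  funext i k h
  exact hc i k h h

theorem inBlock_id_self {m : ℕ} (i : Fin m) : InBlock (𝟙 (SimplexCategory.mk m)) i i :=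
  ⟨le_refl _, Fin.castSucc_lt_succ⟩

/-- The wreath product `Δ ≀ A`. -/
noncomputable instance : Category.{0} (Wreath A) where
  Hom := Hom
  id := Hom.id
  comp := Hom.trans
  id_comp {X Y} f := by
    refine Hom.ext_of_base (Category.id_comp f.base) fun i k h h' => ?_
    exact (Hom.trans_comp (Hom.id X) f h (inBlock_id_self i) h').trans (Category.id_comp _)
  comp_id {X Y} f := by
    refine Hom.ext_of_base (Category.comp_id f.base) fun i k h h' => ?_
    exact (Hom.trans_comp f (Hom.id Y) h h' (inBlock_id_self k)).trans (Category.comp_id _)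
  assoc {W X Y Z} f g h := by
    refine Hom.ext_of_base (Category.assoc _ _ _) fun i k hl hr => ?_
    obtain ⟨j, hj1, hj2⟩ := InBlock.exists_mid (φ := f.base) (ψ := g.base ≫ h.base) hr
    obtain ⟨l, hl1, hl2⟩ := hj2.exists_mid
    rw [Hom.trans_comp (Hom.trans f g) h hl (hj1.comp hl1) hl2,
      Hom.trans_comp f g _ hj1 hl1, Hom.trans_comp f (Hom.trans g h) hr hj1 hj2,
      Hom.trans_comp g h _ hl1 hl2, Category.assoc]

end Wreath

/-- The iterated wreath product: `Θ₁ = Δ` and `Θ_{n+1} = Δ ≀ Θ_n` for `n ≥ 1`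
(and, by convention, `Θ₀` is the one-point category). -/
noncomputable def Theta : ℕ → Cat.{0, 0}
  | 0 => Cat.of (Discrete PUnit)
  | 1 => Cat.of SimplexCategory
  | n + 2 => Cat.of (Wreath (Theta (n + 1)))

/-! ## Level-trees and their star-construction -/

/-- Finite level-trees: finite planar rooted trees.  A tree is given by the valence `m` of its
root and the `m` trees, ordered from left to right, that are grafted onto the root edges. -/
inductive LevelTree : Type
  | node (m : ℕ) (child : Fin m → LevelTree) : LevelTree

namespace LevelTree

/-- The height of a level-tree: the maximal distance of a vertex from the root. -/
def height : LevelTree → ℕ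
  | node _ c => Finset.univ.sup fun i => (c i).height + 1

/-- The sectors of height `k` of a level-tree: a vertex `v` of height `k` with `m` incoming edges
has `m + 1` sectors, namely the `m + 1` gaps between (or next to) its consecutive incoming
edges.  -/
def Sector : LevelTree → ℕ → Type
  | node m _, 0 => Fin (m + 1)
  | node m c, k + 1 => Σ i : Fin m, (c i).Sector k

/-- The source of a sector at a vertex `v` of height `k + 1`: the sector at the vertex `w` below
`v` which lies immediately to the left of the edge from `v` to `w`. -/
def src : ∀ (T : LevelTree) (k : ℕ), T.Sector (k + 1) → T.Sector k
  | node _ _, 0, x => Fin.castSucc x.1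
  | node _ c, k + 1, x => ⟨x.1, (c x.1).src k x.2⟩

/-- The target of a sector at a vertex `v` of height `k + 1`: the sector at the vertex `w` below
`v` which lies immediately to the right of the edge from `v` to `w`. -/
def tgt : ∀ (T : LevelTree) (k : ℕ), T.Sector (k + 1) → T.Sector k
  | node _ _, 0, x => Fin.succ x.1
  | node _ c, k + 1, x => ⟨x.1, (c x.1).tgt k x.2⟩

theorem src_src : ∀ (T : LevelTree) (k : ℕ) (x : T.Sector (k + 2)),
    T.src k (T.src (k + 1) x) = T.src k (T.tgt (k + 1) x)
  | node _ _, 0, _ => rfl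
  | node _ c, k + 1, x => congrArg (Sigma.mk x.1) ((c x.1).src_src k x.2)

theorem tgt_src : ∀ (T : LevelTree) (k : ℕ) (x : T.Sector (k + 2)),
    T.tgt k (T.src (k + 1) x) = T.tgt k (T.tgt (k + 1) x)
  | node _ _, 0, _ => rfl
  | node _ c, k + 1, x => congrArg (Sigma.mk x.1) ((c x.1).tgt_src k x.2)

end LevelTree

/-- The level-tree corresponding to an object of `Θ_n`: the object `[m]` of `Θ₁ = Δ` corresponds
to the corolla with `m` edges, and the object `(A₁, …, A_m)` of `Θ_{n+1} = Δ ≀ Θ_n` to the tree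
obtained by grafting the trees of `A₁, …, A_m` onto the corolla with `m` edges. -/
def Theta.levelTree : ∀ n : ℕ, Theta n → LevelTree
  | 0, _ => .node 0 Fin.elim0
  | 1, X => .node (SimplexCategory.len X) fun _ => .node 0 Fin.elim0
  | n + 2, X => .node (Wreath.len X) fun i => Theta.levelTree (n + 1) (Wreath.obj X i)

/-! ## `n`-graphs -/

/-- An `n`-graph: a graded set `(X_k)_{0 ≤ k ≤ n}` with source and target maps
`s, t : X_{k+1} ⇉ X_k` such that `s s = s t` and `t s = t t`. -/
structure NGraph (n : ℕ) where
  /-- the set of `k`-cells -/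
  cell : ∀ k, k ≤ n → Type u
  /-- the source map -/
  src : ∀ k (h : k + 1 ≤ n), cell (k + 1) h → cell k (Nat.le_of_succ_le h)
  /-- the target map -/
  tgt : ∀ k (h : k + 1 ≤ n), cell (k + 1) h → cell k (Nat.le_of_succ_le h)
  src_src : ∀ k (h : k + 2 ≤ n) (x : cell (k + 2) h),
    src k (Nat.le_of_succ_le h) (src (k + 1) h x) = src k (Nat.le_of_succ_le h) (tgt (k + 1) h x)
  tgt_src : ∀ k (h : k + 2 ≤ n) (x : cell (k + 2) h),
    tgt k (Nat.le_of_succ_le h) (src (k + 1) h x) = tgt k (Nat.le_of_succ_le h) (tgt (k + 1) h x)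

namespace NGraph

/-- A map of `n`-graphs. -/
@[ext]
structure Hom {n : ℕ} (X Y : NGraph.{u} n) where
  /-- the map on `k`-cells -/
  app : ∀ k (h : k ≤ n), X.cell k h → Y.cell k h
  app_src : ∀ k (h : k + 1 ≤ n) (x : X.cell (k + 1) h),
    app k (Nat.le_of_succ_le h) (X.src k h x) = Y.src k h (app (k + 1) h x)
  app_tgt : ∀ k (h : k + 1 ≤ n) (x : X.cell (k + 1) h),
    app k (Nat.le_of_succ_le h) (X.tgt k h x) = Y.tgt k h (app (k + 1) h x)

/-- The category of `n`-graphs. -/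
instance (n : ℕ) : Category.{u} (NGraph.{u} n) where
  Hom := Hom
  id X := ⟨fun _ _ x => x, fun _ _ _ => rfl, fun _ _ _ => rfl⟩
  comp f g := ⟨fun k h x => g.app k h (f.app k h x),
    fun k h x => by rw [f.app_src, g.app_src], fun k h x => by rw [f.app_tgt, g.app_tgt]⟩

/-- Batanin's `n`-graph `T_*` of a level-tree `T`: its `k`-cells are the sectors of height `k`
of `T`. -/
def star (n : ℕ) (T : LevelTree) : NGraph.{u} n where
  cell k _ := ULift.{u} (T.Sector k)
  src k _ x := ⟨T.src k x.down⟩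
  tgt k _ x := ⟨T.tgt k x.down⟩
  src_src k _ x := congrArg ULift.up (T.src_src k x.down)
  tgt_src k _ x := congrArg ULift.up (T.tgt_src k x.down)

/-- The `0`-graph with a given set of `0`-cells. -/
def ofType (S : Type u) : NGraph.{u} 0 where
  cell _ _ := S
  src _ h _ := absurd h (Nat.not_succ_le_zero _)
  tgt _ h _ := absurd h (Nat.not_succ_le_zero _)
  src_src _ h _ := absurd h (Nat.not_succ_le_zero _)
  tgt_src _ h _ := absurd h (Nat.not_succ_le_zero _)

/-- The `k`-cells of the `(n+1)`-graph `ofHoms H` below. -/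
def HomsCell {n : ℕ} {O : Type u} (H : O → O → NGraph.{u} n) :
    ∀ k, k ≤ n + 1 → Type u
  | 0, _ => O
  | k + 1, h => Σ x y : O, (H x y).cell k (Nat.le_of_succ_le_succ h)

/-- The `(n+1)`-graph with set of `0`-cells `O` in which the `(k+1)`-cells are the `k`-cells of
the `n`-graphs `H x y`; the `1`-cells which are `0`-cells of `H x y` have source `x` and target
`y`. -/
def ofHoms {n : ℕ} {O : Type u} (H : O → O → NGraph.{u} n) : NGraph.{u} (n + 1) where
  cell := HomsCell H
  src
    | 0, _, c => c.1
    | k + 1, h, c => ⟨c.1, c.2.1, (H c.1 c.2.1).src k (Nat.le_of_succ_le_succ h) c.2.2⟩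
  tgt
    | 0, _, c => c.2.1
    | k + 1, h, c => ⟨c.1, c.2.1, (H c.1 c.2.1).tgt k (Nat.le_of_succ_le_succ h) c.2.2⟩
  src_src
    | 0, _, _ => rfl
    | k + 1, h, c => by
      dsimp only
      rw [(H c.1 c.2.1).src_src k (Nat.le_of_succ_le_succ h)]
  tgt_src
    | 0, _, _ => rfl
    | k + 1, h, c => by
      dsimp only
      rw [(H c.1 c.2.1).tgt_src k (Nat.le_of_succ_le_succ h)]

/-- Functoriality of `ofHoms`. -/
def ofHomsMap {n : ℕ} {O O' : Type u} {H : O → O → NGraph.{u} n} {H' : O' → O' → NGraph.{u} n}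
    (f : O → O') (g : ∀ x y, H x y ⟶ H' (f x) (f y)) : ofHoms H ⟶ ofHoms H' where
  app
    | 0, _, x => f x
    | k + 1, h, c => ⟨f c.1, f c.2.1, Hom.app (g c.1 c.2.1) k (Nat.le_of_succ_le_succ h) c.2.2⟩
  app_src
    | 0, _, _ => rfl
    | k + 1, h, c => by
      simp only [ofHoms]
      rw [Hom.app_src (g c.1 c.2.1) k (Nat.le_of_succ_le_succ h)]
  app_tgt
    | 0, _, _ => rfl
    | k + 1, h, c => by
      simp only [ofHoms]
      rw [Hom.app_tgt (g c.1 c.2.1) k (Nat.le_of_succ_le_succ h)]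

theorem ofHomsMap_id {n : ℕ} {O : Type u} (H : O → O → NGraph.{u} n) :
    ofHomsMap (H := H) (H' := H) (fun x => x) (fun x y => 𝟙 (H x y)) = 𝟙 (ofHoms H) := by
  apply Hom.ext
  funext k h c
  cases k <;> rfl

theorem ofHomsMap_comp {n : ℕ} {O O' O'' : Type u} {H : O → O → NGraph.{u} n}
    {H' : O' → O' → NGraph.{u} n} {H'' : O'' → O'' → NGraph.{u} n}
    (f : O → O') (g : ∀ x y, H x y ⟶ H' (f x) (f y))
    (f' : O' → O'') (g' : ∀ x y, H' x y ⟶ H'' (f' x) (f' y)) :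
    ofHomsMap (H := H) (H' := H'') (fun x => f' (f x)) (fun x y => g x y ≫ g' (f x) (f y)) =
      ofHomsMap f g ≫ ofHomsMap f' g' := by
  apply Hom.ext
  funext k h c
  cases k <;> rfl

end NGraph

/-! ## Strict `n`-categories -/

/-- Small categories enriched in `V`. -/
structure VCat (V : Type (u + 1)) [Category.{u} V] [MonoidalCategory V] where
  /-- the set of objects -/
  carrier : Type u
  /-- the enriched category structure -/
  [str : EnrichedCategory V carrier]

attribute [instance] VCat.str

namespace VCat

open MonoidalCategory CartesianMonoidalCategory

theorem functor_ext {V : Type (u + 1)} [Category.{u} V] [MonoidalCategory V]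
    {C D : Type u} [EnrichedCategory V C] [EnrichedCategory V D] {F G : EnrichedFunctor V C D}
    (h : F.obj = G.obj) (h' : ∀ x y, HEq (F.map x y) (G.map x y)) : F = G := by
  obtain ⟨Fo, Fm, _, _⟩ := F
  obtain ⟨Go, Gm, _, _⟩ := G
  obtain rfl : Fo = Go := h
  congr
  funext x y
  exact eq_of_heq (h' x y)

/-- The category of small `V`-categories and `V`-functors. -/
instance (V : Type (u + 1)) [Category.{u} V] [MonoidalCategory V] : Category.{u} (VCat V) where
  Hom C D := EnrichedFunctor V C.carrier D.carrier
  id C := EnrichedFunctor.id V C.carrier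
  comp F G := EnrichedFunctor.comp V F G
  id_comp _ := functor_ext rfl fun _ _ => heq_of_eq (Category.id_comp _)
  comp_id _ := functor_ext rfl fun _ _ => heq_of_eq (Category.comp_id _)
  assoc _ _ _ := functor_ext rfl fun _ _ => heq_of_eq (Category.assoc _ _ _)

variable {V : Type (u + 1)} [Category.{u} V] [CartesianMonoidalCategory V]

/-- The terminal `V`-category: one object, with terminal endomorphism object. -/
def unit : VCat V where
  carrier := PUnit.{u + 1}
  str :=
    { Hom := fun _ _ => 𝟙_ V
      id := fun _ => 𝟙 _
      comp := fun _ _ _ => toUnit _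
      id_comp := fun _ _ => toUnit_unique _ _
      comp_id := fun _ _ => toUnit_unique _ _
      assoc := fun _ _ _ _ => toUnit_unique _ _ }

/-- The product of two `V`-categories. -/
def prod (C D : VCat V) : VCat V where
  carrier := C.carrier × D.carrier
  str :=
    { Hom := fun p q => (p.1 ⟶[V] q.1) ⊗ (p.2 ⟶[V] q.2)
      id := fun p => lift (eId V p.1) (eId V p.2)
      comp := fun p q r => lift ((fst _ _ ⊗ₘ fst _ _) ≫ eComp V p.1 q.1 r.1)
        ((snd _ _ ⊗ₘ snd _ _) ≫ eComp V p.2 q.2 r.2)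
      id_comp := fun p q => by
        apply hom_ext
        · have e : (λ_ ((p.1 ⟶[V] q.1) ⊗ (p.2 ⟶[V] q.2))).inv ≫
              lift (eId V p.1) (eId V p.2) ▷ _ ≫ (fst _ _ ⊗ₘ fst _ _) =
              fst _ _ ≫ (λ_ _).inv ≫ eId V p.1 ▷ _ := by
            apply hom_ext <;> simp
          simp only [Category.assoc, lift_fst, Category.id_comp]
          rw [reassoc_of% e, e_id_comp, Category.comp_id]
        · have e : (λ_ ((p.1 ⟶[V] q.1) ⊗ (p.2 ⟶[V] q.2))).inv ≫
              lift (eId V p.1) (eId V p.2) ▷ _ ≫ (snd _ _ ⊗ₘ snd _ _) =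
              snd _ _ ≫ (λ_ _).inv ≫ eId V p.2 ▷ _ := by
            apply hom_ext <;> simp
          simp only [Category.assoc, lift_snd, Category.id_comp]
          rw [reassoc_of% e, e_id_comp, Category.comp_id]
      comp_id := fun p q => by
        apply hom_ext
        · have e : (ρ_ ((p.1 ⟶[V] q.1) ⊗ (p.2 ⟶[V] q.2))).inv ≫
              _ ◁ lift (eId V q.1) (eId V q.2) ≫ (fst _ _ ⊗ₘ fst _ _) =
              fst _ _ ≫ (ρ_ _).inv ≫ _ ◁ eId V q.1 := by
            apply hom_ext <;> simp
          simp only [Category.assoc, lift_fst, Category.id_comp]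
          rw [reassoc_of% e, e_comp_id, Category.comp_id]
        · have e : (ρ_ ((p.1 ⟶[V] q.1) ⊗ (p.2 ⟶[V] q.2))).inv ≫
              _ ◁ lift (eId V q.1) (eId V q.2) ≫ (snd _ _ ⊗ₘ snd _ _) =
              snd _ _ ≫ (ρ_ _).inv ≫ _ ◁ eId V q.2 := by
            apply hom_ext <;> simp
          simp only [Category.assoc, lift_snd, Category.id_comp]
          rw [reassoc_of% e, e_comp_id, Category.comp_id]
      assoc := fun p q r s => by
        apply hom_ext
        · simp only [Category.assoc, lift_fst]
          have e1 : (lift ((fst (p.1 ⟶[V] q.1) (p.2 ⟶[V] q.2) ⊗ₘ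
                fst (q.1 ⟶[V] r.1) (q.2 ⟶[V] r.2)) ≫ eComp V p.1 q.1 r.1)
              ((snd _ _ ⊗ₘ snd _ _) ≫ eComp V p.2 q.2 r.2)) ▷
                ((r.1 ⟶[V] s.1) ⊗ (r.2 ⟶[V] s.2)) ≫ (fst _ _ ⊗ₘ fst _ _) =
              ((fst _ _ ⊗ₘ fst _ _) ⊗ₘ fst _ _) ≫ eComp V p.1 q.1 r.1 ▷ _ := by
            apply hom_ext <;> simp only [Category.assoc, tensorHom_fst, tensorHom_snd,
              whiskerRight_fst, whiskerRight_snd, whiskerRight_fst_assoc, whiskerRight_snd_assoc,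
              tensorHom_fst_assoc, lift_fst]
          have e2 : ((p.1 ⟶[V] q.1) ⊗ (p.2 ⟶[V] q.2)) ◁
              (lift ((fst (q.1 ⟶[V] r.1) (q.2 ⟶[V] r.2) ⊗ₘ
                fst (r.1 ⟶[V] s.1) (r.2 ⟶[V] s.2)) ≫ eComp V q.1 r.1 s.1)
              ((snd _ _ ⊗ₘ snd _ _) ≫ eComp V q.2 r.2 s.2)) ≫ (fst _ _ ⊗ₘ fst _ _) =
              (fst _ _ ⊗ₘ (fst _ _ ⊗ₘ fst _ _)) ≫ _ ◁ eComp V q.1 r.1 s.1 := by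
            apply hom_ext <;> simp
          rw [reassoc_of% e1, reassoc_of% e2, ← e_assoc, associator_inv_naturality_assoc]
        · simp only [Category.assoc, lift_snd]
          have e1 : (lift ((fst (p.1 ⟶[V] q.1) (p.2 ⟶[V] q.2) ⊗ₘ
                fst (q.1 ⟶[V] r.1) (q.2 ⟶[V] r.2)) ≫ eComp V p.1 q.1 r.1)
              ((snd _ _ ⊗ₘ snd _ _) ≫ eComp V p.2 q.2 r.2)) ▷
                ((r.1 ⟶[V] s.1) ⊗ (r.2 ⟶[V] s.2)) ≫ (snd _ _ ⊗ₘ snd _ _) =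
              ((snd _ _ ⊗ₘ snd _ _) ⊗ₘ snd _ _) ≫ eComp V p.2 q.2 r.2 ▷ _ := by
            apply hom_ext <;> simp only [Category.assoc, tensorHom_fst, tensorHom_snd,
              whiskerRight_fst, whiskerRight_snd, whiskerRight_fst_assoc, whiskerRight_snd_assoc,
              tensorHom_fst_assoc, lift_snd]
          have e2 : ((p.1 ⟶[V] q.1) ⊗ (p.2 ⟶[V] q.2)) ◁
              (lift ((fst (q.1 ⟶[V] r.1) (q.2 ⟶[V] r.2) ⊗ₘ
                fst (r.1 ⟶[V] s.1) (r.2 ⟶[V] s.2)) ≫ eComp V q.1 r.1 s.1)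
              ((snd _ _ ⊗ₘ snd _ _) ≫ eComp V q.2 r.2 s.2)) ≫ (snd _ _ ⊗ₘ snd _ _) =
              (snd _ _ ⊗ₘ (snd _ _ ⊗ₘ snd _ _)) ≫ _ ◁ eComp V q.2 r.2 s.2 := by
            apply hom_ext <;> simp
          rw [reassoc_of% e1, reassoc_of% e2, ← e_assoc, associator_inv_naturality_assoc] }

/-- The first projection. -/
def prodFst (C D : VCat V) : prod C D ⟶ C where
  obj p := p.1
  map _ _ := fst _ _
  map_id _ := lift_fst _ _
  map_comp _ _ _ := lift_fst _ _

/-- The second projection. -/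
def prodSnd (C D : VCat V) : prod C D ⟶ D where
  obj p := p.2
  map _ _ := snd _ _
  map_id _ := lift_snd _ _
  map_comp _ _ _ := lift_snd _ _

theorem lift_tensorHom_comp {A B X Y X' Y' Z Z' : V} (a : A ⟶ X) (b : A ⟶ Y) (c : B ⟶ X')
    (d : B ⟶ Y') (m : X ⊗ X' ⟶ Z) (m' : Y ⊗ Y' ⟶ Z') :
    lift ((a ⊗ₘ c) ≫ m) ((b ⊗ₘ d) ≫ m') =
      (lift a b ⊗ₘ lift c d) ≫
        lift ((fst X Y ⊗ₘ fst X' Y') ≫ m) ((snd X Y ⊗ₘ snd X' Y') ≫ m') := by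
  simp only [comp_lift, tensorHom_comp_tensorHom_assoc, lift_fst, lift_snd]

/-- The `V`-functor into a product with given components. -/
def prodLift {B C D : VCat V} (F : B ⟶ C) (G : B ⟶ D) : B ⟶ prod C D where
  obj b := (EnrichedFunctor.obj F b, EnrichedFunctor.obj G b)
  map x y := lift (EnrichedFunctor.map F x y) (EnrichedFunctor.map G x y)
  map_id x := by
    refine (comp_lift _ _ _).trans ?_
    rw [EnrichedFunctor.map_id, EnrichedFunctor.map_id]
    rfl
  map_comp x y z := by
    refine (comp_lift _ _ _).trans ?_
    rw [EnrichedFunctor.map_comp, EnrichedFunctor.map_comp]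
    exact lift_tensorHom_comp _ _ _ _ _ _

/-- The terminal `V`-category is terminal and the product of `V`-categories is their categorical
product. -/
instance : CartesianMonoidalCategory (VCat V) :=
  .ofChosenFiniteProducts
    ⟨Limits.asEmptyCone unit, Limits.IsTerminal.ofUniqueHom
      (fun C =>
        { obj := fun _ => PUnit.unit
          map := fun _ _ => toUnit _
          map_id := fun _ => toUnit_unique _ _
          map_comp := fun _ _ _ => toUnit_unique _ _ })
      (fun _ _ => functor_ext rfl fun _ _ => heq_of_eq (toUnit_unique _ _))⟩
    (fun C D => ⟨Limits.BinaryFan.mk (prodFst C D) (prodSnd C D),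
      Limits.BinaryFan.IsLimit.mk _ (fun F G => prodLift F G)
        (fun _ _ => functor_ext rfl fun _ _ => heq_of_eq (lift_fst _ _))
        (fun _ _ => functor_ext rfl fun _ _ => heq_of_eq (lift_snd _ _))
        (fun F G m hF hG => by
          subst hF
          subst hG
          exact functor_ext rfl fun _ _ => heq_of_eq (lift_comp_fst_snd _).symm)⟩)

end VCat

/-- A category with chosen finite products (bundled, for the recursion on `n` below). -/
structure CartesianCat : Type (u + 2) where
  /-- the objects -/
  carrier : Type (u + 1)
  /-- the category structure -/
  [cat : Category.{u} carrier]
  /-- terminal object and binary products -/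
  [cart : CartesianMonoidalCategory carrier]

attribute [instance] CartesianCat.cat CartesianCat.cart

/-- A strict `0`-category is a set and a strict `(n+1)`-category is a category enriched in strict
`n`-categories with respect to the cartesian product; morphisms are enriched functors. -/
def strictCat : ℕ → CartesianCat.{u}
  | 0 => ⟨Type u⟩
  | n + 1 => ⟨VCat (strictCat n).carrier⟩

/-- The category of small strict `n`-categories. -/
abbrev NCat (n : ℕ) : Type (u + 1) := (strictCat.{u} n).carrier

namespace NCat

/-- The forgetful functor from strict `0`-categories, that is, sets, to `0`-graphs. -/
def forgetZero : Type u ⥤ NGraph.{u} 0 where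
  obj S := NGraph.ofType S
  map {S S'} f :=
    (⟨fun _ _ x => f x, fun _ h _ => absurd h (Nat.not_succ_le_zero _),
      fun _ h _ => absurd h (Nat.not_succ_le_zero _)⟩ :
      NGraph.Hom (NGraph.ofType S) (NGraph.ofType S'))
  map_id _ := rfl
  map_comp _ _ := rfl

/-- Given a functor `U` from `V` to `n`-graphs, the functor from `V`-categories to `(n+1)`-graphs
that sends `C` to the `(n+1)`-graph whose `0`-cells are the objects of `C` and whose
`(k+1)`-cells with `0`-dimensional source `x` and target `y` are the `k`-cells of
`U (C(x, y))`. -/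
def forgetSucc {V : Type (u + 1)} [Category.{u} V] [MonoidalCategory V] {n : ℕ}
    (U : V ⥤ NGraph.{u} n) : VCat V ⥤ NGraph.{u} (n + 1) where
  obj C := NGraph.ofHoms fun x y : C.carrier => U.obj (EnrichedCategory.Hom x y)
  map F := NGraph.ofHomsMap (EnrichedFunctor.obj F)
    fun x y => U.map (EnrichedFunctor.map F x y)
  map_id C :=
    (congrArg (NGraph.ofHomsMap fun x : C.carrier => x)
      (funext fun x => funext fun y => U.map_id (EnrichedCategory.Hom x y))).trans
      (NGraph.ofHomsMap_id _)
  map_comp {C _ _} F G :=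
    (congrArg (NGraph.ofHomsMap fun x : C.carrier =>
        EnrichedFunctor.obj G (EnrichedFunctor.obj F x))
      (funext fun x => funext fun y =>
        U.map_comp (EnrichedFunctor.map F x y) (EnrichedFunctor.map G _ _))).trans
      (NGraph.ofHomsMap_comp _ _ _ _)

/-- The forgetful functor `U_n` from strict `n`-categories to `n`-graphs. -/
def forget : ∀ n : ℕ, NCat.{u} n ⥤ NGraph.{u} n
  | 0 => forgetZero
  | n + 1 => forgetSucc (forget n)

end NCat

/-- The nerve functor `V ↦ 𝒱(E -, V)` of a functor `E : 𝒜 ⥤ 𝒱`, with values in presheaves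
on `𝒜`. -/
def nerveAlong {A : Type} [Category.{0} A] {V : Type (u + 1)} [Category.{u} V] (E : A ⥤ V) :
    V ⥤ Aᵒᵖ ⥤ Type u :=
  yoneda ⋙ (Functor.whiskeringLeft _ _ _).obj E.op

/-!
The category `Θ_n` is an iterated wreath product and strict `n`-categories are iterated enriched
categories, so everything is shown by induction, for an arbitrary cartesian category `V` in place
of the category of strict `n`-categories, a forgetful functor `U` from `V` to `n`-graphs and a
functor `E : A ⥤ V` in place of `Θ_n ⥤ nCat`.

The step sends an object `(A_1, …, A_m)` of the wreath product `Δ ≀ A` to the `V`-category `lin`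
with objects `0, …, m` whose hom-object from `i` to `j` is the product of the `E(A_k)` with
`i < k ≤ j` (and is empty if `j < i`). It is freely generated by the objects `E(A_k)` of morphisms
from `k - 1` to `k`; see `isFreeOn_linGen`. The induction step has four parts.

* `wreathFunctor` is full and faithful if `E` is: a `V`-functor out of `lin` is determined by its
  values on the generators, and a morphism from `E(A_i)` to a hom-object of `lin` is the same as a
  family of morphisms `E(A_i) ⟶ E(B_k)`, because every `E(A_i)` has a global point whereas the
  empty coproduct has none (`val_bijective`).
* `wreathFunctor E` is dense if `E` is (`isDense_wreathFunctor`): the tuples of length zero and one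
  detect objects and generalized morphisms of a `V`-category, and the operators from tuples of
  length one to those of length two and zero detect composition and identities.
* If each `E(A_k)` is free on an `n`-graph `G_k` with respect to `U`, then `lin` is free on the
  `(n+1)`-graph in which the `G_k` are suspended between consecutive vertices
  (`Suspension.isUniversalArrow`). Batanin's star-construction has exactly this recursive form
  (`starSuspension`).
* The same universal property, for a free `V`-category on an arbitrary `V`-graph, shows that the
  forgetful functors have left adjoints (`isRightAdjoint_forgetSucc`).

The hom-objects of `lin` and of free `V`-categories are coproducts which distribute over products.
The structure `FamCat` describes such `V`-categories by the formal summands and their generalized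
points, which reduces the axioms of `V`-categories and of `V`-functors to identities of points. The
category of `V`-categories inherits distributive coproducts from `V`, which keeps the induction
going.

For the theorem itself, the values of the resulting functor are replaced by the isomorphic values of
the given left adjoint. Injectivity on objects holds since `Θ_n` is skeletal (`skeletal_theta`).
-/

universe w

/-! ### Distributive coproducts and their generalized points -/

namespace Familial

open MonoidalCategory CartesianMonoidalCategory

/-- `V` has small coproducts which are preserved by `- ⊗ B`, and an empty coproduct has no global
point. The condition on empty coproducts excludes the degenerate case that `V` is trivial; it is
needed for the fullness of the embedding of a wreath product into `V`-categories. -/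
class DistribCoproducts (V : Type (u + 1)) [Category.{u} V] [CartesianMonoidalCategory V] :
    Prop where
  exists_coprod : ∀ {I : Type u} (A : I → V), ∃ (S : V) (ι : ∀ i, A i ⟶ S),
    (∀ (B W : V) (f : ∀ i, A i ⊗ B ⟶ W), ∃! g : S ⊗ B ⟶ W, ∀ i, ι i ▷ B ≫ g = f i) ∧
      (IsEmpty I → IsEmpty (𝟙_ V ⟶ S))

section Points

variable {V : Type (u + 1)} [Category.{u} V]

/-- The `Z`-points of the formal coproduct of a family `A`. -/
@[ext]
structure Pt {I : Type u} (A : I → V) (Z : V) : Type u where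
  /-- the summand containing the point -/
  idx : I
  /-- the point of that summand -/
  map : Z ⟶ A idx

/-- Restriction of points. -/
def Pt.res {I : Type u} {A : I → V} {Z Z' : V} (v : Z' ⟶ Z) (a : Pt A Z) : Pt A Z' :=
  ⟨a.idx, v ≫ a.map⟩

theorem Pt.res_comp {I : Type u} {A : I → V} {Z Z' Z'' : V} (w : Z'' ⟶ Z') (v : Z' ⟶ Z)
    (a : Pt A Z) : Pt.res (w ≫ v) a = Pt.res w (Pt.res v a) := by
  simp [Pt.res]

end Points

variable {V : Type (u + 1)} [Category.{u} V] [CartesianMonoidalCategory V]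

/-- `P` is a class of points of `S` such that the points of `S ⊗ B` whose first
component lies in `P` are jointly epimorphic. -/
def JointlyEpi (S : V) (P : ∀ Z : V, (Z ⟶ S) → Prop) : Prop :=
  ∀ (B W : V) (g g' : S ⊗ B ⟶ W),
    (∀ (Z : V) (a : Z ⟶ S) (b : Z ⟶ B), P Z a → lift a b ≫ g = lift a b ≫ g') → g = g'

theorem JointlyEpi.ext {S : V} {P : ∀ Z : V, (Z ⟶ S) → Prop} (h : JointlyEpi S P) {W : V}
    {g g' : S ⟶ W} (hg : ∀ (Z : V) (a : Z ⟶ S), P Z a → a ≫ g = a ≫ g') : g = g' := by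
  have := h (𝟙_ V) W (fst _ _ ≫ g) (fst _ _ ≫ g') (fun Z a b ha => by simpa using hg Z a ha)
  have h2 := congrArg (fun t => lift (𝟙 S) (toUnit S) ≫ t) this
  simpa using h2

/-- Jointly epimorphic classes of points of two objects give such a class of pairs of points of
their product, since testing in the first variable may leave the second one as a parameter. -/
theorem JointlyEpi.tensor {S S' : V} {P : ∀ Z : V, (Z ⟶ S) → Prop}
    {P' : ∀ Z : V, (Z ⟶ S') → Prop} (h : JointlyEpi S P) (h' : JointlyEpi S' P')
    (hres : ∀ (Z Z' : V) (v : Z' ⟶ Z) (a : Z ⟶ S), P Z a → P Z' (v ≫ a)) :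
    JointlyEpi (S ⊗ S') fun _ c => P _ (c ≫ fst _ _) ∧ P' _ (c ≫ snd _ _) := by
  intro B W g g' hg
  have key : lift (lift (fst S (S' ⊗ B)) (snd _ _ ≫ fst _ _)) (snd _ _ ≫ snd _ _) ≫ g =
      lift (lift (fst S (S' ⊗ B)) (snd _ _ ≫ fst _ _)) (snd _ _ ≫ snd _ _) ≫ g' := by
    refine h _ _ _ _ fun Z a b ha => ?_
    have k : lift (lift (snd S' (Z ⊗ B) ≫ fst _ _ ≫ a) (fst _ _)) (snd _ _ ≫ snd _ _) ≫ g =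
        lift (lift (snd S' (Z ⊗ B) ≫ fst _ _ ≫ a) (fst _ _)) (snd _ _ ≫ snd _ _) ≫ g' := by
      refine h' _ _ _ _ fun Z' c d hc => ?_
      have := hg Z' (lift (d ≫ fst _ _ ≫ a) c) (d ≫ snd _ _)
        ⟨by simpa using hres _ _ (d ≫ fst _ _) a ha, by simpa using hc⟩
      simpa [comp_lift_assoc, comp_lift] using this
    have := congrArg (fun t => lift (b ≫ fst _ _) (lift (𝟙 Z) (b ≫ snd _ _)) ≫ t) k
    simpa [comp_lift_assoc, comp_lift] using this
  have := congrArg (fun t => lift (fst _ _ ≫ fst _ _) (lift (fst _ _ ≫ snd _ _) (snd _ _)) ≫ t) key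
  have e : lift (lift (fst (S ⊗ S') B ≫ fst _ _) (fst _ _ ≫ snd _ _)) (snd _ _) = 𝟙 _ := by
    ext <;> simp
  simpa [comp_lift_assoc, comp_lift, e] using this

variable [DistribCoproducts V]

/-- A chosen coproduct of the family `A`. -/
noncomputable def coprod {I : Type u} (A : I → V) : V :=
  (DistribCoproducts.exists_coprod A).choose

/-- The coprojections. -/
noncomputable def coprodι {I : Type u} (A : I → V) (i : I) : A i ⟶ coprod A :=
  (DistribCoproducts.exists_coprod A).choose_spec.choose i

theorem coprod_existsUnique {I : Type u} (A : I → V) {B W : V} (f : ∀ i, A i ⊗ B ⟶ W) :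
    ∃! g : coprod A ⊗ B ⟶ W, ∀ i, coprodι A i ▷ B ≫ g = f i :=
  (DistribCoproducts.exists_coprod A).choose_spec.choose_spec.1 B W f

theorem coprod_no_point {I : Type u} (A : I → V) [hI : IsEmpty I] (x : 𝟙_ V ⟶ coprod A) : False :=
  ((DistribCoproducts.exists_coprod A).choose_spec.choose_spec.2 hI).false x

/-- A formal point of a family gives a point of its coproduct. -/
noncomputable def val {I : Type u} {A : I → V} {Z : V} (a : Pt A Z) : Z ⟶ coprod A :=
  a.map ≫ coprodι A a.idx

@[simp]
theorem comp_val {I : Type u} {A : I → V} {Z Z' : V} (v : Z' ⟶ Z) (a : Pt A Z) :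
    v ≫ val a = val (a.res v) := by
  simp [val, Pt.res]

/-- The formal points are jointly epimorphic, but need not be all points of a coproduct. -/
theorem jointlyEpi_val {I : Type u} (A : I → V) :
    JointlyEpi (coprod A) fun Z a => ∃ p : Pt A Z, a = val p := by
  intro B W g g' h
  refine (coprod_existsUnique A fun i => coprodι A i ▷ B ≫ g).unique (fun i => rfl) fun i => ?_
  have := h _ (val (A := A) ⟨i, fst (A i) B⟩) (snd _ _) ⟨_, rfl⟩
  have e : lift (val (A := A) ⟨i, fst (A i) B⟩) (snd _ _) = coprodι A i ▷ B := by
    ext <;> simp [val]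
  rw [e] at this
  exact this.symm

/-- A natural operation on formal points of a coproduct and arbitrary points of a second object is
induced by a morphism, since by distributivity it suffices to evaluate it at the coprojections. -/
theorem exists_desc {I : Type u} (A : I → V) {B W : V}
    (φ : ∀ Z, Pt A Z → (Z ⟶ B) → (Z ⟶ W))
    (hφ : ∀ Z Z' (v : Z' ⟶ Z) a b, v ≫ φ Z a b = φ Z' (a.res v) (v ≫ b)) :
    ∃ g : coprod A ⊗ B ⟶ W, ∀ Z (a : Pt A Z) (b : Z ⟶ B), lift (val a) b ≫ g = φ Z a b := by
  obtain ⟨g, hg, -⟩ := coprod_existsUnique A fun i => φ (A i ⊗ B) ⟨i, fst _ _⟩ (snd _ _)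
  refine ⟨g, fun Z a b => ?_⟩
  have e : lift (val a) b = lift a.map b ≫ coprodι A a.idx ▷ B := by ext <;> simp [val]
  rw [e, Category.assoc, hg, hφ]
  simp [Pt.res]

/-- A natural operation on formal points of two coproducts is induced by a morphism. -/
theorem exists_desc₂ {I I' : Type u} (A : I → V) (A' : I' → V) {W : V}
    (φ : ∀ Z, Pt A Z → Pt A' Z → (Z ⟶ W))
    (hφ : ∀ Z Z' (v : Z' ⟶ Z) a b, v ≫ φ Z a b = φ Z' (a.res v) (b.res v)) :
    ∃ g : coprod A ⊗ coprod A' ⟶ W, ∀ Z (a : Pt A Z) (b : Pt A' Z),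
      lift (val a) (val b) ≫ g = φ Z a b := by
  have h1 : ∀ Z (a : Pt A Z), ∃ g : coprod A' ⊗ Z ⟶ W, ∀ Z' (b : Pt A' Z') (v : Z' ⟶ Z),
      lift (val b) v ≫ g = φ Z' (a.res v) b := fun Z a =>
    exists_desc A' (fun Z' b v => φ Z' (a.res v) b) fun Z Z' v b w => by
      rw [hφ, ← Pt.res_comp]
  choose k hk using h1
  obtain ⟨g, hg⟩ := exists_desc A (B := coprod A') (W := W)
    (fun Z a b => lift b (𝟙 Z) ≫ k Z a) (fun Z Z' v a b => by
      have : v ▷ coprod A' ≫ lift (snd _ _) (fst _ _) ≫ k Z a =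
          lift (snd _ _) (fst _ _) ≫ k Z' (a.res v) := by
        have : coprod A' ◁ v ≫ k Z a = k Z' (a.res v) := by
          refine jointlyEpi_val A' _ _ _ _ ?_
          rintro Y _ b ⟨p, rfl⟩
          rw [hk, lift_whiskerLeft_assoc, hk, Pt.res_comp]
        rw [← this, comp_lift_assoc, ← Category.assoc]
        congr 1
        ext <;> simp
      have := congrArg (fun t => lift (𝟙 Z') (v ≫ b) ≫ t) this
      simpa [comp_lift_assoc, comp_lift] using this)
  refine ⟨g, fun Z a b => ?_⟩
  rw [hg, hk]
  simp [Pt.res]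

/-- When the index type is a subsingleton, an object with a global point sees the
coproduct as the formal coproduct. -/
theorem val_bijective {I : Type u} [Subsingleton I] (A : I → V) {Z : V} (z : 𝟙_ V ⟶ Z) :
    Function.Bijective (val : Pt A Z → (Z ⟶ coprod A)) := by
  rcases isEmpty_or_nonempty I with hI | ⟨⟨i⟩⟩
  · exact ⟨fun a => isEmptyElim a.idx, fun f => (coprod_no_point A (z ≫ f)).elim⟩
  · obtain ⟨r, hr⟩ := exists_desc A (B := 𝟙_ V) (W := A i)
      (fun Z a _ => a.map ≫ eqToHom (congrArg A (Subsingleton.elim a.idx i)))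
      (fun Z Z' v a b => by simp [Pt.res])
    have hr' : ∀ Z (a : Pt A Z), val a ≫ lift (𝟙 _) (toUnit _) ≫ r =
        a.map ≫ eqToHom (congrArg A (Subsingleton.elim a.idx i)) := fun Z a => by
      rw [comp_lift_assoc]
      simpa using hr Z a (toUnit Z)
    constructor
    · rintro ⟨j, a⟩ ⟨k, b⟩ h
      obtain rfl : j = i := Subsingleton.elim _ _
      obtain rfl : k = j := Subsingleton.elim _ _
      have := congrArg (fun t => t ≫ lift (𝟙 _) (toUnit _) ≫ r) h
      simp only [hr'] at this
      simpa using this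
    · intro f
      refine ⟨⟨i, f ≫ lift (𝟙 _) (toUnit _) ≫ r⟩, ?_⟩
      have : lift (𝟙 _) (toUnit _) ≫ r ≫ coprodι A i = 𝟙 _ := by
        refine (jointlyEpi_val A).ext ?_
        rintro Z _ ⟨⟨j, a⟩, rfl⟩
        obtain rfl : j = i := Subsingleton.elim _ _
        have := hr' Z ⟨j, a⟩
        simp only [eqToHom_refl, Category.comp_id] at this
        rw [← Category.assoc, ← Category.assoc, Category.assoc (val _), this]
        simp [val]
      simp [val, this]

end Familial

/-! ### Generalized points of enriched categories -/

namespace Familial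

open MonoidalCategory CartesianMonoidalCategory

variable {V : Type (u + 1)} [Category.{u} V] [CartesianMonoidalCategory V]

section Enriched

variable {C : Type u} [EnrichedCategory V C] {D : Type u} [EnrichedCategory V D]

/-- Composition of `Z`-points of the hom-objects of a `V`-category. -/
def emul {Z : V} {x y z : C} (f : Z ⟶ (x ⟶[V] y)) (g : Z ⟶ (y ⟶[V] z)) : Z ⟶ (x ⟶[V] z) :=
  lift f g ≫ eComp V x y z

/-- The identity `Z`-point. -/
def eone (Z : V) (x : C) : Z ⟶ (x ⟶[V] x) := toUnit Z ≫ eId V x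

theorem comp_emul {Z Z' : V} (v : Z' ⟶ Z) {x y z : C} (f : Z ⟶ (x ⟶[V] y))
    (g : Z ⟶ (y ⟶[V] z)) : v ≫ emul f g = emul (v ≫ f) (v ≫ g) := by
  simp [emul, comp_lift_assoc]

theorem comp_eone {Z Z' : V} (v : Z' ⟶ Z) (x : C) : v ≫ eone Z x = eone Z' x := by
  simp [eone]

theorem eone_emul {Z : V} {x y : C} (f : Z ⟶ (x ⟶[V] y)) : emul (eone Z x) f = f := by
  have e : lift (eone Z x) f = f ≫ (λ_ _).inv ≫ eId V x ▷ _ := by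
    apply CartesianMonoidalCategory.hom_ext <;> simp [eone]
  rw [emul, e]
  simp

theorem emul_eone {Z : V} {x y : C} (f : Z ⟶ (x ⟶[V] y)) : emul f (eone Z y) = f := by
  have e : lift f (eone Z y) = f ≫ (ρ_ _).inv ≫ _ ◁ eId V y := by
    apply CartesianMonoidalCategory.hom_ext <;> simp [eone]
  rw [emul, e]
  simp

theorem emul_assoc {Z : V} {w x y z : C} (f : Z ⟶ (w ⟶[V] x)) (g : Z ⟶ (x ⟶[V] y))
    (h : Z ⟶ (y ⟶[V] z)) : emul (emul f g) h = emul f (emul g h) := by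
  have e1 : lift (lift f g ≫ eComp V w x y) h =
      lift f (lift g h) ≫ (α_ _ _ _).inv ≫ eComp V w x y ▷ _ := by
    apply CartesianMonoidalCategory.hom_ext <;> simp
  have e2 : lift f (lift g h ≫ eComp V x y z) = lift f (lift g h) ≫ _ ◁ eComp V x y z := by
    apply CartesianMonoidalCategory.hom_ext <;> simp
  simp only [emul]
  rw [e1, e2]
  simp only [Category.assoc, e_assoc]

theorem emul_map {Z : V} (F : EnrichedFunctor V C D) {x y z : C} (f : Z ⟶ (x ⟶[V] y))
    (g : Z ⟶ (y ⟶[V] z)) :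
    emul f g ≫ F.map x z = emul (f ≫ F.map x y) (g ≫ F.map y z) := by
  simp [emul]

theorem eone_map {Z : V} (F : EnrichedFunctor V C D) (x : C) :
    eone Z x ≫ F.map x x = eone Z (F.obj x) := by
  simp [eone]

end Enriched

/-! ### Categories enriched in formal coproducts -/

/-- A category enriched in formal coproducts of objects of `V`: the hom-object from `x` to `y` is
the formal coproduct of the family `rep x y`, and the composition is given on generalized points,
naturally in the domain of the points. -/
structure FamCat (V : Type (u + 1)) [Category.{u} V] where
  /-- the objects -/
  Obj : Type u
  /-- the summands of the hom-objects -/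
  Idx : Obj → Obj → Type u
  /-- the objects represented by the summands -/
  rep : ∀ x y, Idx x y → V
  /-- the identity points -/
  one : ∀ (Z : V) (x : Obj), Pt (rep x x) Z
  /-- the composition of points -/
  mul : ∀ {Z : V} {x y z : Obj}, Pt (rep x y) Z → Pt (rep y z) Z → Pt (rep x z) Z
  res_one : ∀ {Z Z' : V} (v : Z' ⟶ Z) (x : Obj), (one Z x).res v = one Z' x
  res_mul : ∀ {Z Z' : V} (v : Z' ⟶ Z) {x y z : Obj} (a : Pt (rep x y) Z) (b : Pt (rep y z) Z),
    (mul a b).res v = mul (a.res v) (b.res v)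
  one_mul : ∀ {Z : V} {x y : Obj} (a : Pt (rep x y) Z), mul (one Z x) a = a
  mul_one : ∀ {Z : V} {x y : Obj} (a : Pt (rep x y) Z), mul a (one Z y) = a
  mul_assoc : ∀ {Z : V} {w x y z : Obj} (a : Pt (rep w x) Z) (b : Pt (rep x y) Z)
    (c : Pt (rep y z) Z), mul (mul a b) c = mul a (mul b c)

namespace FamCat

variable [DistribCoproducts V] (P : FamCat V)

theorem exists_comp (x y z : P.Obj) :
    ∃ g : coprod (P.rep x y) ⊗ coprod (P.rep y z) ⟶ coprod (P.rep x z),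
      ∀ Z (a : Pt (P.rep x y) Z) (b : Pt (P.rep y z) Z),
        lift (val a) (val b) ≫ g = val (P.mul a b) :=
  exists_desc₂ _ _ (fun _ a b => val (P.mul a b)) fun Z Z' v a b => by rw [comp_val, P.res_mul]

/-- The `V`-category obtained from a category enriched in formal coproducts by forming the
coproducts in `V`. -/
noncomputable def realize : VCat V where
  carrier := P.Obj
  str :=
    { Hom := fun x y => coprod (P.rep x y)
      id := fun x => val (P.one _ x)
      comp := fun x y z => (P.exists_comp x y z).choose
      id_comp := fun x y => by
        refine (jointlyEpi_val _).ext ?_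
        rintro Z _ ⟨a, rfl⟩
        have e : val a ≫ (λ_ _).inv ≫ val (P.one (𝟙_ V) x) ▷ _ =
            lift (val (P.one Z x)) (val a) := by
          apply CartesianMonoidalCategory.hom_ext <;> simp [P.res_one]
        rw [reassoc_of% e, (P.exists_comp _ _ _).choose_spec, P.one_mul, Category.comp_id]
      comp_id := fun x y => by
        refine (jointlyEpi_val _).ext ?_
        rintro Z _ ⟨a, rfl⟩
        have e : val a ≫ (ρ_ _).inv ≫ _ ◁ val (P.one (𝟙_ V) y) =
            lift (val a) (val (P.one Z y)) := by
          apply CartesianMonoidalCategory.hom_ext <;> simp [P.res_one]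
        rw [reassoc_of% e, (P.exists_comp _ _ _).choose_spec, P.mul_one, Category.comp_id]
      assoc := fun w x y z => by
        have hres : ∀ (I : Type u) (A : I → V) (Z Z' : V) (v : Z' ⟶ Z) (a : Z ⟶ coprod A),
            (∃ p : Pt A Z, a = val p) → ∃ p : Pt A Z', v ≫ a = val p := by
          rintro I A Z Z' v _ ⟨p, rfl⟩
          exact ⟨_, comp_val v p⟩
        refine ((jointlyEpi_val _).tensor ((jointlyEpi_val _).tensor (jointlyEpi_val _)
          (hres _ _)) (hres _ _)).ext ?_
        rintro Z t ⟨⟨a, ha⟩, ⟨b, hb⟩, ⟨c, hc⟩⟩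
        obtain rfl : t = lift (val a) (lift (val b) (val c)) := by
          apply CartesianMonoidalCategory.hom_ext
          · simpa using ha
          · apply CartesianMonoidalCategory.hom_ext
            · simpa using hb
            · simpa using hc
        have e1 : lift (val a) (lift (val b) (val c)) ≫ (α_ _ _ _).inv ≫
            (P.exists_comp w x y).choose ▷ _ = lift (val (P.mul a b)) (val c) := by
          rw [← (P.exists_comp _ _ _).choose_spec]
          apply CartesianMonoidalCategory.hom_ext <;> simp
        have e2 : lift (val a) (lift (val b) (val c)) ≫ _ ◁ (P.exists_comp x y z).choose =
            lift (val a) (val (P.mul b c)) := by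
          rw [← (P.exists_comp _ _ _).choose_spec]
          apply CartesianMonoidalCategory.hom_ext <;> simp
        rw [reassoc_of% e1, reassoc_of% e2, (P.exists_comp _ _ _).choose_spec,
          (P.exists_comp _ _ _).choose_spec, P.mul_assoc] }

variable {P}

/-- The point of a hom-object of `P.realize` given by a formal point. -/
noncomputable def pt {Z : V} {x y : P.Obj} (a : Pt (P.rep x y) Z) :
    Z ⟶ EnrichedCategory.Hom (V := V) (C := P.realize.carrier) x y :=
  val a

theorem comp_pt {Z Z' : V} (v : Z' ⟶ Z) {x y : P.Obj} (a : Pt (P.rep x y) Z) :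
    v ≫ pt a = pt (a.res v) :=
  comp_val v a

theorem emul_pt {Z : V} {x y z : P.Obj} (a : Pt (P.rep x y) Z) (b : Pt (P.rep y z) Z) :
    emul (V := V) (C := P.realize.carrier) (pt a) (pt b) = pt (P.mul a b) :=
  (P.exists_comp x y z).choose_spec Z a b

theorem eone_pt (Z : V) (x : P.Obj) :
    eone (V := V) (C := P.realize.carrier) Z x = pt (P.one Z x) := by
  refine (comp_val _ _).trans ?_
  rw [P.res_one]
  rfl

end FamCat

end Familial

/-! ### Functors out of a realization -/

namespace Familial

open MonoidalCategory CartesianMonoidalCategory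

variable {V : Type (u + 1)} [Category.{u} V] [CartesianMonoidalCategory V]

/-- The action of a `V`-functor on objects. -/
abbrev vobj {C D : VCat V} (F : C ⟶ D) : C.carrier → D.carrier := EnrichedFunctor.obj F

/-- The action of a `V`-functor on hom-objects. -/
abbrev vmap {C D : VCat V} (F : C ⟶ D) (x y : C.carrier) :
    (x ⟶[V] y) ⟶ (vobj F x ⟶[V] vobj F y) := EnrichedFunctor.map F x y

theorem vmap_congr {C D : VCat V} {F G : C ⟶ D} (h : F = G) {Z : V} {x y : C.carrier}
    (a : Z ⟶ (x ⟶[V] y)) : HEq (a ≫ vmap F x y) (a ≫ vmap G x y) := by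
  subst h; rfl

/-- A point of a hom-object of a product of `V`-categories. -/
def prodPt {C D : VCat V} {Z : V} {x y : C.carrier} {x' y' : D.carrier} (a : Z ⟶ (x ⟶[V] y))
    (b : Z ⟶ (x' ⟶[V] y')) :
    Z ⟶ EnrichedCategory.Hom (V := V) (C := (VCat.prod C D).carrier) (x, x') (y, y') :=
  lift a b

theorem emul_prodPt {C D : VCat V} {Z : V} {x y z : C.carrier} {x' y' z' : D.carrier}
    (a : Z ⟶ (x ⟶[V] y)) (b : Z ⟶ (x' ⟶[V] y')) (c : Z ⟶ (y ⟶[V] z)) (d : Z ⟶ (y' ⟶[V] z')) :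
    emul (V := V) (C := (VCat.prod C D).carrier) (prodPt a b) (prodPt c d) =
      prodPt (emul a c) (emul b d) := by
  refine (comp_lift _ _ _).trans ?_
  refine congrArg₂ lift ?_ ?_ <;> refine (Category.assoc _ _ _).symm.trans ?_
  · exact congrArg (fun t => t ≫ eComp V x y z) ((lift_map _ _ _ _).trans
      (congrArg₂ lift (lift_fst _ _) (lift_fst _ _)))
  · exact congrArg (fun t => t ≫ eComp V x' y' z') ((lift_map _ _ _ _).trans
      (congrArg₂ lift (lift_snd _ _) (lift_snd _ _)))

theorem eone_prodPt {C D : VCat V} (Z : V) (x : C.carrier) (x' : D.carrier) :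
    eone (V := V) (C := (VCat.prod C D).carrier) Z (x, x') =
      prodPt (C := C) (D := D) (eone Z x) (eone Z x') :=
  comp_lift _ _ _

/-- A `V`-functor can be checked on a jointly epimorphic class of points of the hom-objects. -/
def functorOfPoints {C D : Type u} [EnrichedCategory V C] [EnrichedCategory V D] (obj : C → D)
    (g : ∀ x y : C, (x ⟶[V] y) ⟶ (obj x ⟶[V] obj y))
    (Q : ∀ (x y : C) (Z : V), (Z ⟶ (x ⟶[V] y)) → Prop) (hQ : ∀ x y, JointlyEpi _ (Q x y))
    (hres : ∀ (x y : C) (Z Z' : V) (v : Z' ⟶ Z) (a : Z ⟶ (x ⟶[V] y)), Q x y Z a →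
      Q x y Z' (v ≫ a))
    (hone : ∀ x : C, eone (𝟙_ V) x ≫ g x x = eone _ (obj x))
    (hmul : ∀ (x y z : C) (Z : V) (a : Z ⟶ (x ⟶[V] y)) (b : Z ⟶ (y ⟶[V] z)), Q x y Z a →
      Q y z Z b → emul a b ≫ g x z = emul (a ≫ g x y) (b ≫ g y z)) :
    EnrichedFunctor V C D where
  obj := obj
  map := g
  map_id x := by simpa [eone, toUnit_unit] using hone x
  map_comp x y z := by
    refine ((hQ x y).tensor (hQ y z) (hres x y)).ext ?_
    rintro Z t ⟨ha, hb⟩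
    have e : t = lift (t ≫ fst _ _) (t ≫ snd _ _) := by
      apply CartesianMonoidalCategory.hom_ext <;> simp
    rw [e, lift_map_assoc, ← Category.assoc]
    exact hmul _ _ _ _ _ _ ha hb

namespace FamCat

variable [DistribCoproducts V] {P : FamCat V}

/-- A `V`-functor out of the product of a realization with a `V`-category, from its action on
points. -/
theorem exists_prod_functor {D E : VCat V} (obj : P.Obj → D.carrier → E.carrier)
    (φ : ∀ {Z : V} {x y : P.Obj} {d d' : D.carrier}, Pt (P.rep x y) Z → (Z ⟶ (d ⟶[V] d')) →
      (Z ⟶ (obj x d ⟶[V] obj y d')))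
    (hφ : ∀ {Z Z' : V} (v : Z' ⟶ Z) {x y : P.Obj} {d d' : D.carrier} (a : Pt (P.rep x y) Z)
      (b : Z ⟶ (d ⟶[V] d')), v ≫ φ a b = φ (a.res v) (v ≫ b))
    (hone : ∀ (Z : V) (x : P.Obj) (d : D.carrier),
      φ (P.one Z x) (eone Z d) = eone Z (obj x d))
    (hmul : ∀ {Z : V} {x y z : P.Obj} {d d' d'' : D.carrier} (a : Pt (P.rep x y) Z)
      (b : Z ⟶ (d ⟶[V] d')) (a' : Pt (P.rep y z) Z) (b' : Z ⟶ (d' ⟶[V] d'')),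
      φ (P.mul a a') (emul b b') = emul (φ a b) (φ a' b')) :
    ∃ F : VCat.prod P.realize D ⟶ E, (∀ x d, vobj F (x, d) = obj x d) ∧
      ∀ {Z : V} {x y : P.Obj} {d d' : D.carrier} (a : Pt (P.rep x y) Z) (b : Z ⟶ (d ⟶[V] d')),
        HEq (prodPt (C := P.realize) (pt a) b ≫ vmap F (x, d) (y, d')) (φ a b) := by
  have hex : ∀ (x y : P.Obj) (d d' : D.carrier), ∃ g : coprod (P.rep x y) ⊗ (d ⟶[V] d') ⟶
      (obj x d ⟶[V] obj y d'), ∀ Z (a : Pt (P.rep x y) Z) (b : Z ⟶ (d ⟶[V] d')),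
        lift (val a) b ≫ g = φ a b := fun x y d d' =>
    exists_desc _ (fun _ a b => φ a b) fun Z Z' v a b => hφ v a b
  choose g hg using hex
  have hg' : ∀ {Z : V} {x y : P.Obj} {d d' : D.carrier} (a : Pt (P.rep x y) Z)
      (b : Z ⟶ (d ⟶[V] d')), prodPt (C := P.realize) (pt a) b ≫ g x y d d' = φ a b :=
    fun a b => hg _ _ _ _ _ a b
  have hpt : ∀ p q : (VCat.prod P.realize D).carrier,
      JointlyEpi (EnrichedCategory.Hom (V := V) p q)
        fun Z c => ∃ (a : Pt (P.rep p.1 q.1) Z) (b : Z ⟶ (p.2 ⟶[V] q.2)),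
          c = prodPt (C := P.realize) (pt a) b := by
    intro p q B W k k' h
    refine (jointlyEpi_val _).tensor (S' := (p.2 ⟶[V] q.2)) (P' := fun _ _ => True)
      (fun B W g g' h => by simpa using h _ (fst _ _) (snd _ _) trivial) ?_ B W k k' ?_
    · rintro Z Z' v _ ⟨p, rfl⟩
      exact ⟨_, comp_val v p⟩
    · rintro Z c d ⟨⟨a, ha⟩, -⟩
      exact h Z c d ⟨a, c ≫ snd _ _,
        CartesianMonoidalCategory.hom_ext _ _ (ha.trans (lift_fst _ _).symm) (lift_snd _ _).symm⟩
  refine ⟨functorOfPoints (fun p => obj p.1 p.2) (fun p q => g p.1 q.1 p.2 q.2) _ hpt ?_ ?_ ?_,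
    fun _ _ => rfl, fun a b => heq_of_eq (hg' a b)⟩
  · rintro p q Z Z' v _ ⟨a, b, rfl⟩
    exact ⟨a.res v, v ≫ b, (comp_lift _ _ _).trans (congrArg (fun t => lift t _) (comp_pt v a))⟩
  · rintro ⟨x, d⟩
    refine (congrArg (fun t => t ≫ g x x d d) (eone_prodPt _ _ _)).trans ?_
    refine (congrArg (fun t => prodPt (C := P.realize) t _ ≫ g x x d d) (eone_pt _ _)).trans ?_
    exact (hg' _ _).trans (hone _ _ _)
  · rintro ⟨x, d⟩ ⟨y, d'⟩ ⟨z, d''⟩ Z _ _ ⟨a, b, rfl⟩ ⟨a', b', rfl⟩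
    refine (congrArg (fun t => t ≫ g x z d d'') (emul_prodPt _ _ _ _)).trans ?_
    refine (congrArg (fun t => prodPt (C := P.realize) t _ ≫ g x z d d'') (emul_pt _ _)).trans ?_
    exact (hg' _ _).trans ((hmul _ _ _ _).trans (congrArg₂ emul (hg' _ _) (hg' _ _)).symm)

theorem prod_functor_ext {D E : VCat V} {F G : VCat.prod P.realize D ⟶ E}
    (hobj : ∀ x d, vobj F (x, d) = vobj G (x, d))
    (hmap : ∀ {Z : V} {x y : P.Obj} {d d' : D.carrier} (a : Pt (P.rep x y) Z)
      (b : Z ⟶ (d ⟶[V] d')),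
      HEq (prodPt (C := P.realize) (pt a) b ≫ vmap F (x, d) (y, d'))
        (prodPt (C := P.realize) (pt a) b ≫ vmap G (x, d) (y, d'))) : F = G := by
  obtain ⟨Fo, Fm, _, _⟩ := F
  obtain ⟨Go, Gm, _, _⟩ := G
  obtain rfl : Fo = Go := funext fun p => hobj p.1 p.2
  refine VCat.functor_ext rfl fun p q => heq_of_eq (jointlyEpi_val _ _ _ _ _ ?_)
  rintro Z _ b ⟨a, rfl⟩
  exact eq_of_heq (hmap a b)

/-- A `V`-functor out of a realization, from its action on points: the case of the product with the
terminal `V`-category. -/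
theorem exists_functor {E : VCat V} (obj : P.Obj → E.carrier)
    (φ : ∀ {Z : V} {x y : P.Obj}, Pt (P.rep x y) Z → (Z ⟶ (obj x ⟶[V] obj y)))
    (hφ : ∀ {Z Z' : V} (v : Z' ⟶ Z) {x y : P.Obj} (a : Pt (P.rep x y) Z),
      v ≫ φ a = φ (a.res v))
    (hone : ∀ (Z : V) (x : P.Obj), φ (P.one Z x) = eone Z (obj x))
    (hmul : ∀ {Z : V} {x y z : P.Obj} (a : Pt (P.rep x y) Z) (a' : Pt (P.rep y z) Z),
      φ (P.mul a a') = emul (φ a) (φ a')) :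
    ∃ F : P.realize ⟶ E, (∀ x, vobj F x = obj x) ∧
      ∀ {Z : V} {x y : P.Obj} (a : Pt (P.rep x y) Z), HEq (pt a ≫ vmap F x y) (φ a) := by
  obtain ⟨F, h, hF⟩ := exists_prod_functor (P := P) (D := VCat.unit) (E := E)
    (fun x _ => obj x) (fun a _ => φ a) (fun {_ _} v {_ _ _ _} a _ => hφ v a)
    (fun Z x _ => hone Z x) (fun a _ a' _ => hmul a a')
  refine ⟨VCat.prodLift (𝟙 P.realize) (toUnit (P.realize)) ≫ F, fun x => h x _, fun a => ?_⟩
  refine HEq.trans (heq_of_eq ?_) (hF a (toUnit _))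
  refine (Category.assoc _ _ _).symm.trans ?_
  congr 1
  refine (comp_lift _ _ _).trans ?_
  refine congrArg₂ lift (Category.comp_id _) (toUnit_unique _ _)

/-- A variant of `exists_functor` in which the action on objects is the given one by definition. -/
theorem exists_lift {E : VCat V} (obj : P.Obj → E.carrier)
    (φ : ∀ {Z : V} {x y : P.Obj}, Pt (P.rep x y) Z → (Z ⟶ (obj x ⟶[V] obj y)))
    (hφ : ∀ {Z Z' : V} (v : Z' ⟶ Z) {x y : P.Obj} (a : Pt (P.rep x y) Z),
      v ≫ φ a = φ (a.res v))
    (hone : ∀ (Z : V) (x : P.Obj), φ (P.one Z x) = eone Z (obj x))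
    (hmul : ∀ {Z : V} {x y z : P.Obj} (a : Pt (P.rep x y) Z) (a' : Pt (P.rep y z) Z),
      φ (P.mul a a') = emul (φ a) (φ a')) :
    ∃ g : ∀ x y : P.realize.carrier, (x ⟶[V] y) ⟶ (obj x ⟶[V] obj y),
      (∀ x, eId V x ≫ g x x = eId V (obj x)) ∧
      (∀ x y z, eComp V x y z ≫ g x z = (g x y ⊗ₘ g y z) ≫ eComp V (obj x) (obj y) (obj z)) ∧
      ∀ {Z : V} {x y : P.Obj} (a : Pt (P.rep x y) Z), pt a ≫ g x y = φ a := by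
  obtain ⟨⟨Fo, Fm, F1, F2⟩, hF, hF'⟩ := exists_functor obj φ hφ hone hmul
  obtain rfl : Fo = obj := funext hF
  exact ⟨Fm, F1, F2, fun a => eq_of_heq (hF' a)⟩

/-- The `V`-functor out of a realization with given actions on objects and on points. -/
noncomputable def lift {E : VCat V} (obj : P.Obj → E.carrier)
    (φ : ∀ {Z : V} {x y : P.Obj}, Pt (P.rep x y) Z → (Z ⟶ (obj x ⟶[V] obj y)))
    (hφ : ∀ {Z Z' : V} (v : Z' ⟶ Z) {x y : P.Obj} (a : Pt (P.rep x y) Z),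
      v ≫ φ a = φ (a.res v))
    (hone : ∀ (Z : V) (x : P.Obj), φ (P.one Z x) = eone Z (obj x))
    (hmul : ∀ {Z : V} {x y z : P.Obj} (a : Pt (P.rep x y) Z) (a' : Pt (P.rep y z) Z),
      φ (P.mul a a') = emul (φ a) (φ a')) :
    P.realize ⟶ E :=
  show EnrichedFunctor V P.realize.carrier E.carrier from
  { obj := obj
    map := (exists_lift obj φ hφ hone hmul).choose
    map_id := (exists_lift obj φ hφ hone hmul).choose_spec.1
    map_comp := (exists_lift obj φ hφ hone hmul).choose_spec.2.1 }

theorem pt_lift {E : VCat V} (obj : P.Obj → E.carrier)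
    (φ : ∀ {Z : V} {x y : P.Obj}, Pt (P.rep x y) Z → (Z ⟶ (obj x ⟶[V] obj y)))
    (hφ : ∀ {Z Z' : V} (v : Z' ⟶ Z) {x y : P.Obj} (a : Pt (P.rep x y) Z),
      v ≫ φ a = φ (a.res v))
    (hone : ∀ (Z : V) (x : P.Obj), φ (P.one Z x) = eone Z (obj x))
    (hmul : ∀ {Z : V} {x y z : P.Obj} (a : Pt (P.rep x y) Z) (a' : Pt (P.rep y z) Z),
      φ (P.mul a a') = emul (φ a) (φ a')) {Z : V} {x y : P.Obj} (a : Pt (P.rep x y) Z) :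
    pt a ≫ vmap (lift obj φ hφ hone hmul) x y = φ a :=
  (exists_lift obj φ hφ hone hmul).choose_spec.2.2 a

theorem functor_ext {E : VCat V} {F G : P.realize ⟶ E} (hobj : ∀ x, vobj F x = vobj G x)
    (hmap : ∀ {Z : V} {x y : P.Obj} (a : Pt (P.rep x y) Z),
      HEq (pt a ≫ vmap F x y) (pt a ≫ vmap G x y)) : F = G := by
  obtain ⟨Fo, Fm, _, _⟩ := F
  obtain ⟨Go, Gm, _, _⟩ := G
  obtain rfl : Fo = Go := funext hobj
  refine VCat.functor_ext rfl fun p q => heq_of_eq ((jointlyEpi_val _).ext ?_)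
  rintro Z _ ⟨a, rfl⟩
  exact eq_of_heq (hmap a)

end FamCat

end Familial

/-! ### Distributive coproducts of sets and of enriched categories -/

namespace Familial

open MonoidalCategory CartesianMonoidalCategory

instance : DistribCoproducts (Type u) where
  exists_coprod {I} A := by
    refine ⟨Σ i, A i, fun i => TypeCat.ofHom fun a => ⟨i, a⟩,
      fun B W f => ?_, fun hI => ⟨fun x => ?_⟩⟩
    · refine ⟨TypeCat.ofHom fun p => f p.1.1 (p.1.2, p.2), fun i => ?_, fun g hg => ?_⟩
      · rfl
      · ext ⟨⟨i, a⟩, b⟩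
        exact congrArg (fun t => t (a, b)) (hg i)
    · exact hI.false (x PUnit.unit).1

variable {V : Type (u + 1)} [Category.{u} V] [CartesianMonoidalCategory V]

section Sigma

variable {I : Type u} (C : I → VCat V)

/-- The hom-object between objects of two members of a family of `V`-categories whose indices
are equal. -/
def sigmaHom : ∀ {i j : I}, i = j → (C i).carrier → (C j).carrier → V
  | _, _, rfl, a, b => a ⟶[V] b

/-- Composition of points in a disjoint union of `V`-categories. -/
def sigmaMul {Z : V} : ∀ {i j k : I} (h : i = j) (h' : j = k) {a : (C i).carrier}
    {b : (C j).carrier} {c : (C k).carrier}, (Z ⟶ sigmaHom C h a b) →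
    (Z ⟶ sigmaHom C h' b c) → (Z ⟶ sigmaHom C (h.trans h') a c)
  | _, _, _, rfl, rfl, _, _, _, f, g => emul (V := V) f g

/-- The disjoint union of a family of `V`-categories. -/
def sigma : FamCat V where
  Obj := Σ i, (C i).carrier
  Idx p q := ULift (PLift (p.1 = q.1))
  rep p q h := sigmaHom C h.down.down p.2 q.2
  one Z p := ⟨⟨⟨rfl⟩⟩, eone Z p.2⟩
  mul a b := ⟨⟨⟨a.idx.down.down.trans b.idx.down.down⟩⟩, sigmaMul C _ _ a.map b.map⟩
  res_one v p := Pt.ext rfl (heq_of_eq (comp_eone v p.2))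
  res_mul := by
    rintro Z Z' v ⟨i, x⟩ ⟨j, y⟩ ⟨k, z⟩ ⟨⟨⟨h⟩⟩, a⟩ ⟨⟨⟨h'⟩⟩, b⟩
    change i = j at h
    change j = k at h'
    subst h h'
    exact Pt.ext rfl (heq_of_eq (comp_emul v _ _))
  one_mul := by
    rintro Z ⟨i, x⟩ ⟨j, y⟩ ⟨⟨⟨h⟩⟩, a⟩
    change i = j at h
    subst h
    exact Pt.ext rfl (heq_of_eq (eone_emul _))
  mul_one := by
    rintro Z ⟨i, x⟩ ⟨j, y⟩ ⟨⟨⟨h⟩⟩, a⟩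
    change i = j at h
    subst h
    exact Pt.ext rfl (heq_of_eq (emul_eone _))
  mul_assoc := by
    rintro Z ⟨i, x⟩ ⟨j, y⟩ ⟨k, z⟩ ⟨l, w⟩ ⟨⟨⟨h⟩⟩, a⟩ ⟨⟨⟨h'⟩⟩, b⟩ ⟨⟨⟨h''⟩⟩, c⟩
    change i = j at h
    change j = k at h'
    change k = l at h''
    subst h h' h''
    exact Pt.ext rfl (heq_of_eq (emul_assoc _ _ _))

/-- A point of a hom-object of a member of the family, as a point of the disjoint union. -/
def sigmaPt {i : I} {Z : V} {x y : (C i).carrier} (a : Z ⟶ (x ⟶[V] y)) :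
    Pt ((sigma C).rep ⟨i, x⟩ ⟨i, y⟩) Z :=
  ⟨⟨⟨rfl⟩⟩, a⟩

theorem res_sigmaPt {i : I} {Z Z' : V} (v : Z' ⟶ Z) {x y : (C i).carrier} (a : Z ⟶ (x ⟶[V] y)) :
    (sigmaPt C a).res v = sigmaPt C (v ≫ a) :=
  rfl

variable [DistribCoproducts V]

/-- The inclusion of a member of the family into the disjoint union. -/
noncomputable def sigmaι (i : I) : C i ⟶ (sigma C).realize :=
  functorOfPoints (D := (sigma C).realize.carrier) (fun x => ⟨i, x⟩)
    (fun x y => FamCat.pt (P := sigma C) (sigmaPt C (𝟙 (x ⟶[V] y)))) (fun _ _ _ _ => True)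
    (fun _ _ _ _ _ _ h => by simpa using h _ (fst _ _) (snd _ _) trivial)
    (fun _ _ _ _ _ _ _ => trivial)
    (fun x => by
      refine (FamCat.comp_pt (P := sigma C) _ _).trans ?_
      refine Eq.trans ?_ (FamCat.eone_pt (P := sigma C) (𝟙_ V) ⟨i, x⟩).symm
      rw [res_sigmaPt, Category.comp_id]
      rfl)
    (fun x y z Z a b _ _ => by
      have e : ∀ {x y : (C i).carrier} (a : Z ⟶ (x ⟶[V] y)),
          a ≫ FamCat.pt (P := sigma C) (sigmaPt C (𝟙 (x ⟶[V] y))) =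
            FamCat.pt (P := sigma C) (sigmaPt C a) := fun a => by
        refine (FamCat.comp_pt (P := sigma C) _ _).trans ?_
        rw [res_sigmaPt, Category.comp_id]
      refine (e _).trans (Eq.trans ?_ (congrArg₂ emul (e a) (e b)).symm)
      exact (FamCat.emul_pt (P := sigma C) (sigmaPt C a) (sigmaPt C b)).symm)

end Sigma

theorem comp_prodPt {C D : VCat V} {Z Z' : V} (v : Z' ⟶ Z) {x y : C.carrier} {x' y' : D.carrier}
    (a : Z ⟶ (x ⟶[V] y)) (b : Z ⟶ (x' ⟶[V] y')) :
    v ≫ prodPt a b = prodPt (v ≫ a) (v ≫ b) :=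
  comp_lift _ _ _

theorem prod_ext {C D E : VCat V} {G G' : C ⊗ D ⟶ E} (hobj : ∀ p, vobj G p = vobj G' p)
    (hmap : ∀ {Z : V} {x y : C.carrier} {d d' : D.carrier} (a : Z ⟶ (x ⟶[V] y))
      (b : Z ⟶ (d ⟶[V] d')), HEq (prodPt a b ≫ vmap G (x, d) (y, d'))
        (prodPt a b ≫ vmap G' (x, d) (y, d'))) : G = G' := by
  obtain ⟨Go, Gm, _, _⟩ := G
  obtain ⟨Go', Gm', _, _⟩ := G'
  obtain rfl : Go = Go' := funext hobj
  refine VCat.functor_ext rfl ?_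
  rintro ⟨x, d⟩ ⟨y, d'⟩
  have := eq_of_heq (hmap (fst (x ⟶[V] y) (d ⟶[V] d')) (snd _ _))
  have e : prodPt (fst (x ⟶[V] y) (d ⟶[V] d')) (snd _ _) = 𝟙 _ := lift_fst_snd
  refine heq_of_eq ((Category.id_comp _).symm.trans (Eq.trans ?_ (Category.id_comp _)))
  exact (congrArg (fun t => t ≫ Gm (x, d) (y, d')) e).symm.trans
    (this.trans (congrArg (fun t => t ≫ Gm' (x, d) (y, d')) e))

theorem prodPt_whiskerRight {C C' D : VCat V} (F : C ⟶ C') {Z : V} {x y : C.carrier}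
    {x' y' : D.carrier} (a : Z ⟶ (x ⟶[V] y)) (b : Z ⟶ (x' ⟶[V] y')) :
    prodPt a b ≫ vmap (F ▷ D) (x, x') (y, y') = prodPt (a ≫ vmap F x y) b := by
  refine (comp_lift _ _ _).trans ?_
  refine congrArg₂ lift ?_ ?_
  · refine (Category.assoc _ _ _).symm.trans (congrArg (fun t => t ≫ vmap F x y) ?_)
    exact lift_fst _ _
  · refine (congrArg _ (Category.comp_id _)).trans ?_
    exact lift_snd _ _

variable [DistribCoproducts V]

theorem comp_sigmaι {I : Type u} (C : I → VCat V) (i : I) {Z : V} {x y : (C i).carrier}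
    (a : Z ⟶ (x ⟶[V] y)) :
    a ≫ vmap (sigmaι C i) x y =
      FamCat.pt (P := sigma C) (sigmaPt C a) := by
  refine (FamCat.comp_pt (P := sigma C) _ _).trans ?_
  rw [res_sigmaPt, Category.comp_id]

theorem comp_sigmaι_whiskerRight {I : Type u} (C : I → VCat V) (i : I) {D E : VCat V} {Z : V}
    {x y : (C i).carrier} {d d' : D.carrier} (a : Z ⟶ (x ⟶[V] y)) (b : Z ⟶ (d ⟶[V] d'))
    (G : (sigma C).realize ⊗ D ⟶ E) :
    prodPt a b ≫ vmap (sigmaι C i ▷ D ≫ G) (x, d) (y, d') =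
      prodPt (C := (sigma C).realize) (FamCat.pt (P := sigma C) (sigmaPt C a)) b ≫
        vmap G (⟨i, x⟩, d) (⟨i, y⟩, d') := by
  refine (Category.assoc _ _ _).symm.trans ?_
  refine congrArg (fun t => t ≫ vmap G (⟨i, x⟩, d) (⟨i, y⟩, d')) ?_
  refine (prodPt_whiskerRight _ _ _).trans ?_
  rw [comp_sigmaι]
  rfl

/-- The coproduct of `V`-categories is their disjoint union, whose hom-objects between different
members are empty coproducts. -/
instance : DistribCoproducts (VCat V) where
  exists_coprod {I} C := by
    refine ⟨(sigma C).realize, sigmaι C, fun D E f => ?_, fun hI => ⟨fun F => ?_⟩⟩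
    · let φ : ∀ {Z : V} {x y : (sigma C).Obj} {d d' : D.carrier}, Pt ((sigma C).rep x y) Z →
          (Z ⟶ (d ⟶[V] d')) → (Z ⟶ (vobj (f x.1) (x.2, d) ⟶[V] vobj (f y.1) (y.2, d')))
        | Z, ⟨i, x⟩, ⟨_, y⟩, d, d', ⟨⟨⟨rfl⟩⟩, a⟩, b =>
          prodPt (C := C i) a b ≫ vmap (f i) (x, d) (y, d')
      obtain ⟨F, hF, hF'⟩ := FamCat.exists_prod_functor (P := sigma C) (D := D) (E := E)
        (fun x d => vobj (f x.1) (x.2, d)) φ (by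
          rintro Z Z' v ⟨i, x⟩ ⟨j, y⟩ d d' ⟨⟨⟨h⟩⟩, a⟩ b
          change i = j at h
          subst h
          refine (Category.assoc _ _ _).symm.trans ?_
          exact congrArg (fun t => t ≫ vmap (f i) (x, d) (y, d')) (comp_prodPt v a b)) (by
          rintro Z ⟨i, x⟩ d
          refine Eq.trans ?_ (eone_map (f i) (x, d))
          exact congrArg (fun t => t ≫ vmap (f i) (x, d) (x, d)) (eone_prodPt Z x d).symm) (by
          rintro Z ⟨i, x⟩ ⟨j, y⟩ ⟨k, z⟩ d d' d'' ⟨⟨⟨h⟩⟩, a⟩ b ⟨⟨⟨h'⟩⟩, a'⟩ b'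
          change i = j at h
          change j = k at h'
          subst h h'
          refine Eq.trans ?_ (emul_map (f i) (prodPt (C := C i) a b) (prodPt (C := C i) a' b'))
          exact congrArg (fun t => t ≫ vmap (f i) (x, d) (z, d''))
            (emul_prodPt (C := C i) a b a' b').symm)
      refine ⟨F, fun i => prod_ext (fun p => hF _ _) fun {Z x y d d'} a b => ?_, fun G hG => ?_⟩
      · exact (heq_of_eq (comp_sigmaι_whiskerRight C i a b F)).trans (hF' _ _)
      · refine FamCat.prod_functor_ext (P := sigma C) ?_ ?_
        · rintro ⟨i, x⟩ d
          exact (congrArg (fun t => vobj t (x, d)) (hG i)).trans (hF ⟨i, x⟩ d).symm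
        · rintro Z ⟨i, x⟩ ⟨j, y⟩ d d' ⟨⟨⟨h⟩⟩, a⟩ b
          change i = j at h
          subst h
          exact ((heq_of_eq (comp_sigmaι_whiskerRight C i a b G).symm).trans
            (vmap_congr (hG i) (prodPt (C := C i) a b))).trans (hF' (sigmaPt C a) b).symm
    · exact hI.false (vobj F PUnit.unit).1

end Familial

/-! ### Free enriched categories -/

namespace Familial

open MonoidalCategory CartesianMonoidalCategory

variable {V : Type (u + 1)} [Category.{u} V] [CartesianMonoidalCategory V]

/-- The data on `D` obtained by restricting a `V`-functor `K ⟶ D` to the objects of `K` and to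
a family `ε` of points of its hom-objects. -/
def restrict {K D : VCat V} {J : Type w} {s t : J → K.carrier} {W : J → V}
    (ε : ∀ j, W j ⟶ (s j ⟶[V] t j)) (F : K ⟶ D) :
    Σ f : K.carrier → D.carrier, ∀ j, W j ⟶ (f (s j) ⟶[V] f (t j)) :=
  ⟨vobj F, fun j => ε j ≫ vmap F (s j) (t j)⟩

/-- The `V`-category `K` is free on the points `ε` of its hom-objects. -/
def IsFreeOn {K : VCat V} {J : Type w} {s t : J → K.carrier} {W : J → V}
    (ε : ∀ j, W j ⟶ (s j ⟶[V] t j)) : Prop :=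
  ∀ D : VCat V, Function.Bijective (restrict (D := D) ε)

section Path

/-- Paths in the chaotic quiver on a set of vertices. -/
inductive VertexPath (O : Type u) (x : O) : O → Type u
  | nil : VertexPath O x x
  | snoc {y : O} (p : VertexPath O x y) (z : O) : VertexPath O x z

variable {O : Type u} (G : O → O → V)

/-- The product of the members of a `V`-graph along a path. -/
def pathRep {x : O} : ∀ {y : O}, VertexPath O x y → V
  | _, .nil => 𝟙_ V
  | _, .snoc (y := y) p z => pathRep p ⊗ G y z

variable {G}

/-- The point of the empty path. -/
def pathOne (Z : V) (x : O) : Pt (pathRep G (x := x) (y := x)) Z := ⟨.nil, toUnit Z⟩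

/-- Appending an edge to a point of a path. -/
def pathSnoc {Z : V} {x y z : O} (a : Pt (pathRep G (x := x) (y := y)) Z) (g : Z ⟶ G y z) :
    Pt (pathRep G (x := x) (y := z)) Z :=
  ⟨.snoc a.idx z, lift a.map g⟩

theorem res_pathSnoc {Z Z' : V} (v : Z' ⟶ Z) {x y z : O}
    (a : Pt (pathRep G (x := x) (y := y)) Z) (g : Z ⟶ G y z) :
    (pathSnoc a g).res v = pathSnoc (a.res v) (v ≫ g) :=
  Pt.ext rfl (heq_of_eq (comp_lift _ _ _))

theorem res_pathOne {Z Z' : V} (v : Z' ⟶ Z) (x : O) :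
    (pathOne (G := G) Z x).res v = pathOne Z' x :=
  Pt.ext rfl (heq_of_eq (toUnit_unique _ _))

theorem path_induction {Z : V} {x : O} {motive : ∀ y, Pt (pathRep G (x := x) (y := y)) Z → Prop}
    (one : motive x (pathOne Z x))
    (snoc : ∀ y z (a : Pt (pathRep G (x := x) (y := y)) Z) (g : Z ⟶ G y z), motive y a →
      motive z (pathSnoc a g)) :
    ∀ y (a : Pt (pathRep G (x := x) (y := y)) Z), motive y a := by
  rintro y ⟨p, a⟩
  induction p with
  | nil =>
    obtain rfl : a = toUnit Z := toUnit_unique _ _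
    exact one
  | @snoc y p z ih =>
    have e : (⟨.snoc p z, a⟩ : Pt (pathRep G (x := x) (y := z)) Z) =
        pathSnoc ⟨p, a ≫ fst _ _⟩ (a ≫ snd _ _) :=
      Pt.ext rfl (heq_of_eq (CartesianMonoidalCategory.hom_ext _ _ (lift_fst _ _).symm
        (lift_snd _ _).symm))
    rw [e]
    exact snoc _ _ _ _ (ih _)

/-- Concatenation of points of paths. -/
def pathMul {Z : V} {x y : O} (a : Pt (pathRep G (x := x) (y := y)) Z) :
    ∀ {z : O} (q : VertexPath O y z), (Z ⟶ pathRep G q) → Pt (pathRep G (x := x) (y := z)) Z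
  | _, .nil, _ => a
  | _, .snoc q _, b => pathSnoc (pathMul a q (b ≫ fst _ _)) (b ≫ snd _ _)

theorem pathMul_snoc {Z : V} {x y z w : O} (a : Pt (pathRep G (x := x) (y := y)) Z)
    (b : Pt (pathRep G (x := y) (y := z)) Z) (g : Z ⟶ G z w) :
    pathMul a (pathSnoc b g).idx (pathSnoc b g).map = pathSnoc (pathMul a b.idx b.map) g := by
  have h1 : lift b.map g ≫ fst _ _ = b.map := lift_fst _ _
  have h2 : lift b.map g ≫ snd _ _ = g := lift_snd _ _
  change pathSnoc (pathMul a b.idx (lift b.map g ≫ fst _ _)) (lift b.map g ≫ snd _ _) = _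
  rw [h1, h2]

variable (G)

/-- The free category on a `V`-graph, enriched in formal coproducts. -/
def freeFam : FamCat V where
  Obj := O
  Idx x y := VertexPath O x y
  rep _ _ := pathRep G
  one := pathOne
  mul a b := pathMul a b.idx b.map
  res_one v x := res_pathOne v x
  res_mul {Z Z'} v x y z a b := by
    refine path_induction (G := G)
      (motive := fun z b => (pathMul a b.idx b.map).res v =
        pathMul (a.res v) (b.res v).idx (b.res v).map)
      ?_ (fun y z b g ih => ?_) z b
    · rfl
    · rw [pathMul_snoc, res_pathSnoc, ih, res_pathSnoc, pathMul_snoc]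
  one_mul {Z x y} a := by
    refine path_induction (G := G)
      (motive := fun z b => pathMul (pathOne Z x) b.idx b.map = b) rfl (fun y z b g ih => ?_) y a
    rw [pathMul_snoc, ih]
  mul_one _ := rfl
  mul_assoc {Z w x y z} a b c := by
    refine path_induction (G := G)
      (motive := fun z c => pathMul (pathMul a b.idx b.map) c.idx c.map =
        pathMul a (pathMul b c.idx c.map).idx (pathMul b c.idx c.map).map)
      rfl (fun y z c g ih => ?_) z c
    rw [pathMul_snoc, pathMul_snoc, pathMul_snoc, ih]

variable {G}

/-- The composite of a path of points, given the images of the edges. -/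
def pathEval {C : Type u} [EnrichedCategory V C] (f : O → C)
    (g : ∀ x y, G x y ⟶ (f x ⟶[V] f y)) {Z : V} {x : O} :
    ∀ {y : O} (p : VertexPath O x y), (Z ⟶ pathRep G p) → (Z ⟶ (f x ⟶[V] f y))
  | _, .nil, _ => eone Z (f x)
  | _, .snoc (y := y) p z, a => emul (pathEval f g p (a ≫ fst _ _)) (a ≫ snd _ _ ≫ g y z)

theorem pathEval_snoc {C : Type u} [EnrichedCategory V C] (f : O → C)
    (g : ∀ x y, G x y ⟶ (f x ⟶[V] f y)) {Z : V} {x y z : O}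
    (b : Pt (pathRep G (x := x) (y := y)) Z) (h : Z ⟶ G y z) :
    pathEval f g (pathSnoc b h).idx (pathSnoc b h).map =
      emul (pathEval f g b.idx b.map) (h ≫ g y z) := by
  have h1 : lift b.map h ≫ fst _ _ = b.map := lift_fst _ _
  have h2 : lift b.map h ≫ snd _ _ ≫ g y z = h ≫ g y z := lift_snd_assoc _ _ _
  change emul (pathEval f g b.idx (lift b.map h ≫ fst _ _)) (lift b.map h ≫ snd _ _ ≫ g y z) = _
  rw [h1, h2]

theorem comp_pathEval {C : Type u} [EnrichedCategory V C] (f : O → C)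
    (g : ∀ x y, G x y ⟶ (f x ⟶[V] f y)) {Z Z' : V} (v : Z' ⟶ Z) {x y : O}
    (a : Pt (pathRep G (x := x) (y := y)) Z) :
    v ≫ pathEval f g a.idx a.map = pathEval f g (a.res v).idx (a.res v).map := by
  refine path_induction (G := G) (motive := fun y a =>
    v ≫ pathEval f g a.idx a.map = pathEval f g (a.res v).idx (a.res v).map) ?_ ?_ y a
  · exact comp_eone _ _
  · intro y z b h ih
    rw [pathEval_snoc, comp_emul, ih, res_pathSnoc, pathEval_snoc, Category.assoc]

theorem pathEval_mul {C : Type u} [EnrichedCategory V C] (f : O → C)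
    (g : ∀ x y, G x y ⟶ (f x ⟶[V] f y)) {Z : V} {x y z : O}
    (a : Pt (pathRep G (x := x) (y := y)) Z) (b : Pt (pathRep G (x := y) (y := z)) Z) :
    pathEval f g (pathMul a b.idx b.map).idx (pathMul a b.idx b.map).map =
      emul (pathEval f g a.idx a.map) (pathEval f g b.idx b.map) := by
  refine path_induction (G := G) (motive := fun z b =>
    pathEval f g (pathMul a b.idx b.map).idx (pathMul a b.idx b.map).map =
      emul (pathEval f g a.idx a.map) (pathEval f g b.idx b.map)) ?_ ?_ z b
  · exact (emul_eone _).symm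
  · intro y z b h ih
    rw [pathMul_snoc, pathEval_snoc, ih, pathEval_snoc, emul_assoc]

variable [DistribCoproducts V] (G)

/-- The edges of a `V`-graph in the free `V`-category on it. -/
noncomputable def freeGen (e : O × O) :
    G e.1 e.2 ⟶ EnrichedCategory.Hom (V := V) (C := (freeFam G).realize.carrier) e.1 e.2 :=
  FamCat.pt (P := freeFam G) (pathSnoc (pathOne _ e.1) (𝟙 _))

theorem comp_freeGen {Z : V} {x y : O} (h : Z ⟶ G x y) :
    h ≫ freeGen G (x, y) = FamCat.pt (P := freeFam G) (pathSnoc (pathOne Z x) h) := by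
  refine (FamCat.comp_pt (P := freeFam G) _ _).trans (congrArg _ ?_)
  refine (res_pathSnoc _ _ _).trans ?_
  rw [res_pathOne, Category.comp_id]

theorem pt_pathSnoc {Z : V} {x y z : O} (a : Pt (pathRep G (x := x) (y := y)) Z)
    (h : Z ⟶ G y z) :
    FamCat.pt (P := freeFam G) (pathSnoc a h) =
      emul (V := V) (C := (freeFam G).realize.carrier) (FamCat.pt (P := freeFam G) a)
        (h ≫ freeGen G (y, z)) := by
  rw [comp_freeGen]
  refine Eq.trans ?_ (FamCat.emul_pt (P := freeFam G) _ _).symm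
  refine congrArg _ ?_
  exact (pathMul_snoc a (pathOne Z y) h).symm

theorem isFreeOn_freeGen : IsFreeOn (K := (freeFam G).realize) (freeGen G) := by
  intro D
  constructor
  · intro F F' h
    obtain ⟨Fo, Fm, F1, F2⟩ := F
    obtain ⟨Fo', Fm', F1', F2'⟩ := F'
    obtain rfl : Fo = Fo' := congrArg Sigma.fst h
    have h' : ∀ x y, freeGen G (x, y) ≫ Fm x y = freeGen G (x, y) ≫ Fm' x y := fun x y =>
      congrFun (eq_of_heq (Sigma.mk.inj h).2) (x, y)
    refine FamCat.functor_ext (P := freeFam G) (fun _ => rfl) fun {Z x y} a => heq_of_eq ?_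
    refine path_induction (G := G) (motive := fun y a =>
      FamCat.pt (P := freeFam G) a ≫ Fm x y = FamCat.pt (P := freeFam G) a ≫ Fm' x y) ?_ ?_ y a
    · have e := FamCat.eone_pt (P := freeFam G) Z x
      refine (congrArg (fun t => t ≫ Fm x x) e).symm.trans
        (Eq.trans ?_ (congrArg (fun t => t ≫ Fm' x x) e))
      exact (eone_map ⟨Fo, Fm, F1, F2⟩ x).trans (eone_map ⟨Fo, Fm', F1', F2'⟩ x).symm
    · intro y z b g ih
      have e := pt_pathSnoc G b g
      refine (congrArg (fun t => t ≫ Fm x z) e).trans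
        (Eq.trans ?_ (congrArg (fun t => t ≫ Fm' x z) e).symm)
      refine (emul_map ⟨Fo, Fm, F1, F2⟩ _ _).trans
        (Eq.trans ?_ (emul_map ⟨Fo, Fm', F1', F2'⟩ _ _).symm)
      refine congrArg₂ emul ih ?_
      refine (Category.assoc _ _ _).trans (Eq.trans ?_ (Category.assoc _ _ _).symm)
      exact congrArg (fun t => g ≫ t) (h' y z)
  · rintro ⟨f, g⟩
    obtain ⟨F, hF, hF'⟩ := FamCat.exists_functor (P := freeFam G) (E := D) f
      (fun a => pathEval f (fun x y => g (x, y)) a.idx a.map)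
      (fun v _ _ a => comp_pathEval f _ v a)
      (fun _ _ => rfl) (fun a b => pathEval_mul f _ a b)
    refine ⟨F, ?_⟩
    obtain ⟨Fo, Fm, F1, F2⟩ := F
    obtain rfl : Fo = f := funext hF
    refine Sigma.ext rfl (heq_of_eq (funext fun e => ?_))
    refine (eq_of_heq (hF' (pathSnoc (pathOne (G e.1 e.2) e.1) (𝟙 _)))).trans ?_
    refine (pathEval_snoc _ _ _ _).trans ?_
    rw [Category.id_comp]
    exact eone_emul _

end Path

end Familial

/-! ### Universal arrows to the forgetful functors -/

namespace Familial

/-- `η` is a universal arrow from `X` to the functor `U`. -/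
def IsUniversalArrow {𝒞 𝒟 : Type*} [Category 𝒞] [Category 𝒟] (U : 𝒟 ⥤ 𝒞) {X : 𝒞} {Y : 𝒟}
    (η : X ⟶ U.obj Y) : Prop :=
  ∀ Z : 𝒟, Function.Bijective fun g : Y ⟶ Z => η ≫ U.map g

theorem isRightAdjoint_of_universalArrows {𝒞 𝒟 : Type*} [Category 𝒞] [Category 𝒟] (U : 𝒟 ⥤ 𝒞)
    (h : ∀ X : 𝒞, ∃ (Y : 𝒟) (η : X ⟶ U.obj Y), IsUniversalArrow U η) : U.IsRightAdjoint := by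
  choose F η hη using h
  let e : ∀ X Y, (F X ⟶ Y) ≃ (X ⟶ U.obj Y) := fun X Y => Equiv.ofBijective _ (hη X Y)
  exact ⟨_, ⟨Adjunction.adjunctionOfEquivLeft e fun X Y Y' g h => by simp [e]⟩⟩

theorem IsUniversalArrow.nonempty_iso {𝒞 𝒟 : Type*} [Category 𝒞] [Category 𝒟] {U : 𝒟 ⥤ 𝒞}
    {X : 𝒞} {Y Y' : 𝒟} {η : X ⟶ U.obj Y} {η' : X ⟶ U.obj Y'} (h : IsUniversalArrow U η)
    (h' : IsUniversalArrow U η') : Nonempty (Y ≅ Y') := by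
  obtain ⟨f, hf⟩ := (h Y').2 η'
  obtain ⟨g, hg⟩ := (h' Y).2 η
  dsimp only at hf hg
  refine ⟨f, g, (h Y).1 ?_, (h' Y').1 ?_⟩
  · simp [← Category.assoc, hf, hg]
  · simp [← Category.assoc, hf, hg]

theorem isUniversalArrow_unit {𝒞 𝒟 : Type*} [Category 𝒞] [Category 𝒟] {U : 𝒟 ⥤ 𝒞} {F : 𝒞 ⥤ 𝒟}
    (adj : F ⊣ U) (X : 𝒞) : IsUniversalArrow U (adj.unit.app X) := fun Z => by
  have e : ⇑(adj.homEquiv X Z) = fun g => adj.unit.app X ≫ U.map g :=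
    funext fun g => adj.homEquiv_unit _ _ g
  exact e ▸ (adj.homEquiv X Z).bijective

/-- A presentation of an `(n+1)`-graph `X` by a set `O` of vertices and a family of `n`-graphs
`G j` which are attached to the pairs of vertices `(s j, t j)`. -/
structure Suspension {n : ℕ} (X : NGraph.{u} (n + 1)) {O : Type u} {J : Type w} (s t : J → O)
    (G : J → NGraph.{u} n) where
  /-- the vertices -/
  vert : X.cell 0 (Nat.zero_le _) ≃ O
  /-- the higher cells -/
  cell : ∀ k (h : k + 1 ≤ n + 1),
    X.cell (k + 1) h ≃ Σ j, (G j).cell k (Nat.le_of_succ_le_succ h)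
  vert_src : ∀ (h : 0 + 1 ≤ n + 1) (c : X.cell 1 h), vert (X.src 0 h c) = s (cell 0 h c).1
  vert_tgt : ∀ (h : 0 + 1 ≤ n + 1) (c : X.cell 1 h), vert (X.tgt 0 h c) = t (cell 0 h c).1
  cell_src : ∀ k (h : k + 2 ≤ n + 1) (c : X.cell (k + 2) h),
    cell k (Nat.le_of_succ_le h) (X.src (k + 1) h c) =
      ⟨(cell (k + 1) h c).1, (G _).src k (Nat.le_of_succ_le_succ h) (cell (k + 1) h c).2⟩
  cell_tgt : ∀ k (h : k + 2 ≤ n + 1) (c : X.cell (k + 2) h),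
    cell k (Nat.le_of_succ_le h) (X.tgt (k + 1) h c) =
      ⟨(cell (k + 1) h c).1, (G _).tgt k (Nat.le_of_succ_le_succ h) (cell (k + 1) h c).2⟩

namespace Suspension

variable {n : ℕ} {X : NGraph.{u} (n + 1)} {O : Type u} {J : Type w} {s t : J → O}
  {G : J → NGraph.{u} n} (S : Suspension X s t G) {O' : Type u} {H : O' → O' → NGraph.{u} n}

/-- A map of `(n+1)`-graphs out of a suspension. -/
def glue (p : Σ f : O → O', ∀ j, G j ⟶ H (f (s j)) (f (t j))) : X ⟶ NGraph.ofHoms H where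
  app
    | 0, _, x => p.1 (S.vert x)
    | k + 1, h, c => ⟨p.1 (s (S.cell k h c).1), p.1 (t (S.cell k h c).1),
        NGraph.Hom.app (p.2 (S.cell k h c).1) k (Nat.le_of_succ_le_succ h) (S.cell k h c).2⟩
  app_src
    | 0, h, c => congrArg p.1 (S.vert_src h c)
    | k + 1, h, c => by
      dsimp only [NGraph.ofHoms]
      rw [S.cell_src k h c]
      dsimp only
      rw [NGraph.Hom.app_src]
  app_tgt
    | 0, h, c => congrArg p.1 (S.vert_tgt h c)
    | k + 1, h, c => by
      dsimp only [NGraph.ofHoms]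
      rw [S.cell_tgt k h c]
      dsimp only
      rw [NGraph.Hom.app_tgt]

theorem glue_cell (p : Σ f : O → O', ∀ j, G j ⟶ H (f (s j)) (f (t j))) (k : ℕ)
    (h : k + 1 ≤ n + 1) (j : J) (c : (G j).cell k (Nat.le_of_succ_le_succ h)) :
    (S.glue p).app (k + 1) h ((S.cell k h).symm ⟨j, c⟩) =
      ⟨p.1 (s j), p.1 (t j), NGraph.Hom.app (p.2 j) k (Nat.le_of_succ_le_succ h) c⟩ := by
  change (⟨p.1 (s (S.cell k h _).1), p.1 (t (S.cell k h _).1), _⟩ : Σ x y, (H x y).cell k _) = _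
  rw [Equiv.apply_symm_apply]

theorem src_cell_symm (k : ℕ) (h : k + 2 ≤ n + 1) (j : J)
    (c : (G j).cell (k + 1) (Nat.le_of_succ_le_succ h)) :
    X.src (k + 1) h ((S.cell (k + 1) h).symm ⟨j, c⟩) =
      (S.cell k (Nat.le_of_succ_le h)).symm ⟨j, (G j).src k (Nat.le_of_succ_le_succ h) c⟩ := by
  rw [Equiv.eq_symm_apply, S.cell_src, Equiv.apply_symm_apply]

theorem tgt_cell_symm (k : ℕ) (h : k + 2 ≤ n + 1) (j : J)
    (c : (G j).cell (k + 1) (Nat.le_of_succ_le_succ h)) :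
    X.tgt (k + 1) h ((S.cell (k + 1) h).symm ⟨j, c⟩) =
      (S.cell k (Nat.le_of_succ_le h)).symm ⟨j, (G j).tgt k (Nat.le_of_succ_le_succ h) c⟩ := by
  rw [Equiv.eq_symm_apply, S.cell_tgt, Equiv.apply_symm_apply]

/-- A map out of a suspension sends the cells of `G j` to cells between the images of `s j` and
`t j`. -/
theorem exists_cell (F : X ⟶ NGraph.ofHoms H) (k : ℕ) (h : k + 1 ≤ n + 1) (j : J)
    (c : (G j).cell k (Nat.le_of_succ_le_succ h)) :
    ∃ z, F.app (k + 1) h ((S.cell k h).symm ⟨j, c⟩) =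
      (⟨F.app 0 (Nat.zero_le _) (S.vert.symm (s j)), F.app 0 (Nat.zero_le _) (S.vert.symm (t j)),
        z⟩ : Σ x y, (H x y).cell k (Nat.le_of_succ_le_succ h)) := by
  induction k with
  | zero =>
    have h1 : S.vert.symm (s j) = X.src 0 h ((S.cell 0 h).symm ⟨j, c⟩) := by
      rw [Equiv.symm_apply_eq, S.vert_src, Equiv.apply_symm_apply]
    have h2 : S.vert.symm (t j) = X.tgt 0 h ((S.cell 0 h).symm ⟨j, c⟩) := by
      rw [Equiv.symm_apply_eq, S.vert_tgt, Equiv.apply_symm_apply]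
    rw [h1, h2, F.app_src, F.app_tgt]
    exact ⟨_, rfl⟩
  | succ k ih =>
    obtain ⟨z, hz⟩ := ih (Nat.le_of_succ_le h) ((G j).src k (Nat.le_of_succ_le_succ h) c)
    rw [← S.src_cell_symm k h, F.app_src] at hz
    generalize F.app (k + 1 + 1) h ((S.cell (k + 1) h).symm ⟨j, c⟩) = d at hz ⊢
    obtain ⟨x, y, d⟩ := d
    obtain ⟨rfl, hz⟩ := Sigma.mk.inj hz
    obtain ⟨rfl, hz⟩ := Sigma.mk.inj (eq_of_heq hz)
    exact ⟨_, rfl⟩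

/-- The universal property of a suspension with respect to the `(n+1)`-graphs of the form
`NGraph.ofHoms H`. -/
theorem glue_bijective : Function.Bijective (S.glue (H := H)) := by
  constructor
  · rintro ⟨f, g⟩ ⟨f', g'⟩ h
    obtain rfl : f = f' := funext fun x => by
      have : f (S.vert (S.vert.symm x)) = f' (S.vert (S.vert.symm x)) :=
        congrArg (fun F => NGraph.Hom.app F 0 (Nat.zero_le _) (S.vert.symm x)) h
      simpa using this
    refine Sigma.ext rfl (heq_of_eq (funext fun j => NGraph.Hom.ext ?_))
    funext k hk c
    have : (S.glue ⟨f, g⟩).app (k + 1) (Nat.succ_le_succ hk) _ =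
        (S.glue ⟨f, g'⟩).app (k + 1) (Nat.succ_le_succ hk) _ :=
      congrArg (fun F => NGraph.Hom.app F (k + 1) (Nat.succ_le_succ hk)
        ((S.cell k (Nat.succ_le_succ hk)).symm ⟨j, c⟩)) h
    rw [glue_cell, glue_cell] at this
    exact eq_of_heq (Sigma.mk.inj (eq_of_heq (Sigma.mk.inj this).2)).2
  · intro F
    choose g hg using S.exists_cell F
    have inj : ∀ {k : ℕ} {hk : k ≤ n} {x y : O'} {z z' : (H x y).cell k hk},
        (⟨x, y, z⟩ : Σ x y, (H x y).cell k hk) = ⟨x, y, z'⟩ → z = z' := fun h =>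
      eq_of_heq (Sigma.mk.inj (eq_of_heq (Sigma.mk.inj h).2)).2
    refine ⟨⟨fun x => F.app 0 (Nat.zero_le _) (S.vert.symm x), fun j =>
      ⟨fun k hk c => g k (Nat.succ_le_succ hk) j c, fun k hk c => ?_, fun k hk c => ?_⟩⟩, ?_⟩
    · apply inj
      rw [← hg, ← S.src_cell_symm k (Nat.succ_le_succ hk), F.app_src, hg]
      rfl
    · apply inj
      rw [← hg, ← S.tgt_cell_symm k (Nat.succ_le_succ hk), F.app_tgt, hg]
      rfl
    · apply NGraph.Hom.ext
      funext k hk c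
      rcases k with _ | k
      · simp [glue]
      · obtain ⟨⟨j, c⟩, rfl⟩ := (S.cell k hk).symm.surjective c
        rw [glue_cell]
        exact (hg k hk j c).symm

open MonoidalCategory

variable {V : Type (u + 1)} [Category.{u} V] [CartesianMonoidalCategory V]

/-- A free `V`-category on objects which are universal for the `n`-graphs `G j` is
universal for the `(n+1)`-graph presented by the `G j`. -/
theorem isUniversalArrow (U : V ⥤ NGraph.{u} n) {K : VCat V} {J : Type w} {s t : J → K.carrier}
    {G : J → NGraph.{u} n} (S : Suspension X s t G) {W : J → V}
    {ε : ∀ j, W j ⟶ (s j ⟶[V] t j)} (hε : IsFreeOn ε) {η : ∀ j, G j ⟶ U.obj (W j)}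
    (hη : ∀ j, IsUniversalArrow U (η j)) :
    IsUniversalArrow (NCat.forgetSucc U) (X := X) (Y := K)
      (S.glue (H := fun x y : K.carrier => U.obj (x ⟶[V] y)) ⟨id, fun j => η j ≫ U.map (ε j)⟩) := by
  intro D
  have h2 : Function.Bijective (Sigma.map id (fun (f : K.carrier → D.carrier)
      (g : ∀ j, W j ⟶ (f (s j) ⟶[V] f (t j))) (j : J) => η j ≫ U.map (g j)) :
      _ → Σ f : K.carrier → D.carrier, ∀ j, G j ⟶ U.obj (f (s j) ⟶[V] f (t j))) := by
    have h3 : ∀ f : K.carrier → D.carrier, Function.Bijective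
        fun (g : ∀ j, W j ⟶ (f (s j) ⟶[V] f (t j))) (j : J) => η j ≫ U.map (g j) := fun f =>
      Function.Bijective.piMap fun j => hη j _
    exact ⟨Function.injective_id.sigma_map fun f => (h3 f).1,
      Function.surjective_id.sigma_map fun f => (h3 f).2⟩
  have h4 := (S.glue_bijective (H := fun x y : D.carrier => U.obj (x ⟶[V] y))).comp
    (h2.comp (hε D))
  refine cast (congrArg Function.Bijective ?_) h4
  change _ = fun F : K ⟶ D => (_ : X ⟶ NGraph.ofHoms fun x y : D.carrier => U.obj (x ⟶[V] y))
  funext F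
  apply NGraph.Hom.ext
  funext k hk c
  rcases k with _ | k
  · rfl
  · refine Sigma.ext rfl (heq_of_eq (Sigma.ext rfl (heq_of_eq ?_)))
    have e : η (S.cell k hk c).1 ≫ U.map (ε (S.cell k hk c).1 ≫ vmap F _ _) =
        (η (S.cell k hk c).1 ≫ U.map (ε (S.cell k hk c).1)) ≫ U.map (vmap F _ _) := by
      rw [U.map_comp, Category.assoc]
    exact congrArg (fun f => NGraph.Hom.app f k (Nat.le_of_succ_le_succ hk) (S.cell k hk c).2) e

end Suspension

section Fibres

variable {n : ℕ} (X : NGraph.{u} (n + 1))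

/-- The vertex at which a cell starts. -/
def vertSrc : ∀ k (h : k + 1 ≤ n + 1), X.cell (k + 1) h → X.cell 0 (Nat.zero_le _)
  | 0, h, c => X.src 0 h c
  | k + 1, h, c => vertSrc k (Nat.le_of_succ_le h) (X.src (k + 1) h c)

/-- The vertex at which a cell ends; by the globular identities it does not matter that the first
steps use sources. -/
def vertTgt : ∀ k (h : k + 1 ≤ n + 1), X.cell (k + 1) h → X.cell 0 (Nat.zero_le _)
  | 0, h, c => X.tgt 0 h c
  | k + 1, h, c => vertTgt k (Nat.le_of_succ_le h) (X.src (k + 1) h c)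

theorem vertSrc_tgt : ∀ k (h : k + 2 ≤ n + 1) (c : X.cell (k + 2) h),
    vertSrc X k (Nat.le_of_succ_le h) (X.tgt (k + 1) h c) =
      vertSrc X k (Nat.le_of_succ_le h) (X.src (k + 1) h c)
  | 0, h, c => (X.src_src 0 h c).symm
  | k + 1, h, c => congrArg (vertSrc X k _) (X.src_src (k + 1) h c).symm

theorem vertTgt_tgt : ∀ k (h : k + 2 ≤ n + 1) (c : X.cell (k + 2) h),
    vertTgt X k (Nat.le_of_succ_le h) (X.tgt (k + 1) h c) =
      vertTgt X k (Nat.le_of_succ_le h) (X.src (k + 1) h c)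
  | 0, h, c => (X.tgt_src 0 h c).symm
  | k + 1, h, c => congrArg (vertTgt X k _) (X.src_src (k + 1) h c).symm

/-- The `n`-graph of the cells of `X` between two given vertices. -/
def fibre (e : X.cell 0 (Nat.zero_le _) × X.cell 0 (Nat.zero_le _)) : NGraph.{u} n where
  cell k h := {c : X.cell (k + 1) (Nat.succ_le_succ h) // vertSrc X k _ c = e.1 ∧
    vertTgt X k _ c = e.2}
  src k h c := ⟨X.src (k + 1) (Nat.succ_le_succ h) c.1, c.2⟩
  tgt k h c := ⟨X.tgt (k + 1) (Nat.succ_le_succ h) c.1,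
    (vertSrc_tgt X k (Nat.succ_le_succ h) c.1).trans c.2.1,
    (vertTgt_tgt X k (Nat.succ_le_succ h) c.1).trans c.2.2⟩
  src_src k h c := Subtype.ext (X.src_src (k + 1) (Nat.succ_le_succ h) c.1)
  tgt_src k h c := Subtype.ext (X.tgt_src (k + 1) (Nat.succ_le_succ h) c.1)

/-- An `(n+1)`-graph is presented by its fibres over the pairs of vertices. -/
def fibreSuspension : Suspension X Prod.fst Prod.snd (fibre X) where
  vert := Equiv.refl _
  cell k h :=
    { toFun := fun c => ⟨(vertSrc X k h c, vertTgt X k h c), ⟨c, rfl, rfl⟩⟩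
      invFun := fun c => c.2.1
      left_inv := fun _ => rfl
      right_inv := by
        rintro ⟨⟨x, y⟩, ⟨c, hx, hy⟩⟩
        change vertSrc X k h c = x at hx
        change vertTgt X k h c = y at hy
        subst hx hy
        rfl }
  vert_src _ _ := rfl
  vert_tgt _ _ := rfl
  cell_src _ _ _ := rfl
  cell_tgt k h c := by
    have e : ∀ {x x' y y' : X.cell 0 (Nat.zero_le _)} (hx : x = x') (hy : y = y')
        (d : X.cell (k + 1) (Nat.le_of_succ_le h)) (h1 : vertSrc X k _ d = x ∧ vertTgt X k _ d = y)
        (h2 : vertSrc X k _ d = x' ∧ vertTgt X k _ d = y'),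
        (⟨(x, y), ⟨d, h1⟩⟩ : Σ e, (fibre X e).cell k
          (Nat.le_of_succ_le_succ (Nat.le_of_succ_le h))) = ⟨(x', y'), ⟨d, h2⟩⟩ := by
      rintro x _ y _ rfl rfl d h1 h2
      rfl
    exact e (vertSrc_tgt X k h c) (vertTgt_tgt X k h c) _ _ _

end Fibres

open MonoidalCategory

theorem isRightAdjoint_forgetSucc {V : Type (u + 1)} [Category.{u} V]
    [CartesianMonoidalCategory V] [DistribCoproducts V] {n : ℕ} (U : V ⥤ NGraph.{u} n)
    [U.IsRightAdjoint] : (NCat.forgetSucc U).IsRightAdjoint := by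
  refine isRightAdjoint_of_universalArrows _ fun X => ?_
  let adj := Adjunction.ofIsRightAdjoint U
  exact ⟨_, _, (fibreSuspension X).isUniversalArrow U
    (isFreeOn_freeGen fun x y => U.leftAdjoint.obj (fibre X (x, y)))
    fun e => isUniversalArrow_unit adj (fibre X e)⟩

theorem isRightAdjoint_forgetZero : NCat.forgetZero.{u}.IsRightAdjoint := by
  refine isRightAdjoint_of_universalArrows _ fun X => ?_
  refine ⟨X.cell 0 le_rfl, ⟨fun k h x => ?_, ?_, ?_⟩, fun Z => ⟨fun f f' h => ?_, fun F => ?_⟩⟩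
  · obtain rfl : k = 0 := Nat.le_zero.mp h
    exact x
  · exact fun _ h => absurd h (Nat.not_succ_le_zero _)
  · exact fun _ h => absurd h (Nat.not_succ_le_zero _)
  · ext x
    exact congrArg (fun F => NGraph.Hom.app F 0 le_rfl x) h
  · refine ⟨TypeCat.ofHom fun x => F.app 0 le_rfl x, ?_⟩
    apply NGraph.Hom.ext
    funext k h x
    obtain rfl : k = 0 := Nat.le_zero.mp h
    rfl

end Familial

/-! ### Linear enriched categories -/

namespace Familial

open MonoidalCategory CartesianMonoidalCategory

variable {V : Type (u + 1)} [Category.{u} V] [CartesianMonoidalCategory V]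

section Linear

variable {m : ℕ} (B : Fin m → V)

/-- The indices `k` between the vertices `i` and `j`. -/
abbrev Between {m : ℕ} (i j : Fin (m + 1)) : Type := {k : Fin m // i ≤ k.castSucc ∧ k.castSucc < j}

/-- The hom-objects of the linear `V`-category on `B`: the product of the `B k` with `k` between
`i` and `j` if `i ≤ j`, and the empty coproduct otherwise. -/
noncomputable def linRep (i j : ULift.{u} (Fin (m + 1))) (_ : ULift.{u} (PLift (i.down ≤ j.down))) :
    V :=
  ∏ᶜ fun k : Between i.down j.down => B k.1

variable {B}

/-- The components of a point of a hom-object of a linear `V`-category. -/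
noncomputable def linAt {Z : V} {i j : ULift.{u} (Fin (m + 1))} (a : Pt (linRep B i j) Z)
    (k : Between i.down j.down) : Z ⟶ B k.1 :=
  a.map ≫ Limits.Pi.π (fun k : Between i.down j.down => B k.1) k

/-- The point with given components. -/
noncomputable def linPt {Z : V} {i j : ULift.{u} (Fin (m + 1))} (h : i.down ≤ j.down)
    (f : ∀ k : Between i.down j.down, Z ⟶ B k.1) : Pt (linRep B i j) Z :=
  ⟨⟨⟨h⟩⟩, Limits.Pi.lift f⟩

@[simp]
theorem linAt_linPt {Z : V} {i j : ULift.{u} (Fin (m + 1))} (h : i.down ≤ j.down)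
    (f : ∀ k : Between i.down j.down, Z ⟶ B k.1) (k : Between i.down j.down) :
    linAt (linPt h f) k = f k :=
  Limits.Pi.lift_π _ _

theorem linPt_ext {Z : V} {i j : ULift.{u} (Fin (m + 1))} {a b : Pt (linRep B i j) Z}
    (h : ∀ k, linAt a k = linAt b k) : a = b := by
  obtain ⟨⟨⟨ha⟩⟩, a⟩ := a
  obtain ⟨⟨⟨hb⟩⟩, b⟩ := b
  exact Pt.ext rfl (heq_of_eq (Limits.Pi.hom_ext _ _ h))

@[simp]
theorem linAt_res {Z Z' : V} (v : Z' ⟶ Z) {i j : ULift.{u} (Fin (m + 1))}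
    (a : Pt (linRep B i j) Z) (k : Between i.down j.down) :
    linAt (a.res v) k = v ≫ linAt a k :=
  Category.assoc _ _ _

/-- The identity points. -/
noncomputable def linOne (Z : V) (i : ULift.{u} (Fin (m + 1))) : Pt (linRep B i i) Z :=
  linPt le_rfl fun k => absurd k.2.2 (not_lt.mpr k.2.1)

theorem res_linOne {Z Z' : V} (v : Z' ⟶ Z) (i : ULift.{u} (Fin (m + 1))) :
    (linOne (B := B) Z i).res v = linOne Z' i :=
  linPt_ext fun k => absurd k.2.2 (not_lt.mpr k.2.1)

/-- Concatenation of points. -/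
noncomputable def linMul {Z : V} {i j l : ULift.{u} (Fin (m + 1))} (a : Pt (linRep B i j) Z)
    (b : Pt (linRep B j l) Z) : Pt (linRep B i l) Z :=
  linPt (a.idx.down.down.trans b.idx.down.down) fun k =>
    if h : k.1.castSucc < j.down then linAt a ⟨k.1, k.2.1, h⟩
    else linAt b ⟨k.1, not_lt.mp h, k.2.2⟩

theorem linAt_linMul {Z : V} {i j l : ULift.{u} (Fin (m + 1))} (a : Pt (linRep B i j) Z)
    (b : Pt (linRep B j l) Z) (k : Between i.down l.down) :
    linAt (linMul a b) k = if h : k.1.castSucc < j.down then linAt a ⟨k.1, k.2.1, h⟩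
      else linAt b ⟨k.1, not_lt.mp h, k.2.2⟩ :=
  linAt_linPt _ _ _

variable (B)

/-- The linear `V`-category on `B`, enriched in formal coproducts. -/
noncomputable def linFam : FamCat V where
  Obj := ULift.{u} (Fin (m + 1))
  Idx i j := ULift.{u} (PLift (i.down ≤ j.down))
  rep := linRep B
  one := linOne
  mul := linMul
  res_one := res_linOne
  res_mul v i j l a b := linPt_ext fun k => by
    by_cases h : k.1.castSucc < j.down <;> simp [linAt_linMul, h]
  one_mul {Z i j} a := linPt_ext fun k => by
    simp [linAt_linMul, not_lt.mpr k.2.1]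
  mul_one {Z i j} a := linPt_ext fun k => by
    simp [linAt_linMul, k.2.2]
  mul_assoc {Z i j l p} a b c := linPt_ext fun k => by
    by_cases h : k.1.castSucc < j.down
    · have h' : k.1.castSucc < l.down := h.trans_le b.idx.down.down
      simp [linAt_linMul, h, h']
    · by_cases h' : k.1.castSucc < l.down <;> simp [linAt_linMul, h, h']

variable {B}

/-- The point of an elementary edge. -/
noncomputable def linEdge {Z : V} (k : Fin m) (g : Z ⟶ B k) :
    Pt (linRep B ⟨k.castSucc⟩ ⟨k.succ⟩) Z :=
  linPt (Fin.castSucc_le_succ k) fun k' => g ≫ eqToHom (congrArg B (le_antisymm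
    (Fin.castSucc_le_castSucc_iff.mp k'.2.1) (Fin.castSucc_lt_succ_iff.mp k'.2.2)))

@[simp]
theorem linAt_linEdge {Z : V} (k : Fin m) (g : Z ⟶ B k) (h) : linAt (linEdge k g) ⟨k, h⟩ = g := by
  simp [linEdge]

theorem res_linEdge {Z Z' : V} (v : Z' ⟶ Z) (k : Fin m) (g : Z ⟶ B k) :
    (linEdge k g).res v = linEdge k (v ≫ g) :=
  linPt_ext fun k' => by
    rw [linAt_res, linEdge, linEdge, linAt_linPt, linAt_linPt, Category.assoc]

/-- The initial part of a point. -/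
noncomputable def linInit {Z : V} {i : ULift.{u} (Fin (m + 1))} {k : Fin m}
    (h : i.down ≤ k.castSucc) (a : Pt (linRep B i ⟨k.succ⟩) Z) : Pt (linRep B i ⟨k.castSucc⟩) Z :=
  linPt h fun k' => linAt a ⟨k'.1, k'.2.1, k'.2.2.trans Fin.castSucc_lt_succ⟩

theorem linMul_linInit {Z : V} {i : ULift.{u} (Fin (m + 1))} {k : Fin m}
    (h : i.down ≤ k.castSucc) (a : Pt (linRep B i ⟨k.succ⟩) Z) :
    linMul (linInit h a) (linEdge k (linAt a ⟨k, h, Fin.castSucc_lt_succ⟩)) = a := by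
  refine linPt_ext fun k' => ?_
  by_cases hk : k'.1.castSucc < k.castSucc
  · rw [linAt_linMul, dif_pos hk, linInit, linAt_linPt]
  · obtain ⟨k', h1, h2⟩ := k'
    obtain rfl : k' = k := le_antisymm (Fin.castSucc_lt_succ_iff.mp h2)
      (Fin.castSucc_le_castSucc_iff.mp (not_lt.mp hk))
    simp [linAt_linMul]

theorem linInit_linMul {Z : V} {i : ULift.{u} (Fin (m + 1))} {k : Fin m}
    (a : Pt (linRep B i ⟨k.castSucc⟩) Z) (g : Z ⟶ B k) (h : i.down ≤ k.castSucc) :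
    linInit h (linMul a (linEdge k g)) = a :=
  linPt_ext fun k' => by
    rw [linInit, linAt_linPt, linAt_linMul, dif_pos k'.2.2]

theorem linAt_linMul_linEdge {Z : V} {i : ULift.{u} (Fin (m + 1))} {k : Fin m}
    (a : Pt (linRep B i ⟨k.castSucc⟩) Z) (g : Z ⟶ B k) (h) :
    linAt (linMul a (linEdge k g)) ⟨k, h⟩ = g := by
  simp [linAt_linMul]

/-- A point of a linear `V`-category is a composite of elementary edges. -/
theorem lin_induction {Z : V} {i : ULift.{u} (Fin (m + 1))}
    {motive : ∀ j, Pt (linRep B i j) Z → Prop}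
    (one : motive i (linOne Z i))
    (snoc : ∀ (k : Fin m) (a : Pt (linRep B i ⟨k.castSucc⟩) Z) (g : Z ⟶ B k),
      motive ⟨k.castSucc⟩ a → motive ⟨k.succ⟩ (linMul a (linEdge k g))) :
    ∀ j (a : Pt (linRep B i j) Z), motive j a := by
  have triv : ∀ j (_ : i = j) (a : Pt (linRep B i j) Z), motive j a := by
    rintro _ rfl a
    have : a = linOne Z i := linPt_ext fun k => absurd k.2.2 (not_lt.mpr k.2.1)
    exact this ▸ one
  rintro ⟨j⟩
  induction j using Fin.induction with
  | zero =>
    intro a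
    exact triv _ (ULift.ext _ _ (le_antisymm a.idx.down.down (Fin.zero_le _))) a
  | succ k ih =>
    intro a
    by_cases h : i.down ≤ k.castSucc
    · rw [← linMul_linInit h a]
      exact snoc _ _ _ (ih _)
    · refine triv _ (ULift.ext _ _ (le_antisymm a.idx.down.down ?_)) a
      exact Fin.castSucc_lt_iff_succ_le.mp (not_le.mp h)

section Eval

variable {C : Type u} [EnrichedCategory V C] (f : ULift.{u} (Fin (m + 1)) → C)
  (g : ∀ k : Fin m, B k ⟶ (f ⟨k.castSucc⟩ ⟶[V] f ⟨k.succ⟩))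

/-- The identity point between equal objects. -/
def eoneOfEq (Z : V) : ∀ {x y : C}, x = y → (Z ⟶ (x ⟶[V] y))
  | x, _, rfl => eone Z x

/-- The composite of the images of the components of a point, by recursion on its end `j`. -/
noncomputable def linEval {Z : V} (i : ULift.{u} (Fin (m + 1))) (j : Fin (m + 1)) :
    Pt (linRep B i ⟨j⟩) Z → (Z ⟶ (f i ⟶[V] f ⟨j⟩)) :=
  Fin.induction (motive := fun j => Pt (linRep B i ⟨j⟩) Z → (Z ⟶ (f i ⟶[V] f ⟨j⟩)))
    (fun a => eoneOfEq Z (congrArg f (ULift.ext _ _ (le_antisymm a.idx.down.down (Fin.zero_le _)))))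
    (fun k ih a => if h : i.down ≤ k.castSucc then
        emul (ih (linInit h a)) (linAt a ⟨k, h, Fin.castSucc_lt_succ⟩ ≫ g k)
      else eoneOfEq Z (congrArg f (ULift.ext _ _ (le_antisymm a.idx.down.down
        (Fin.castSucc_lt_iff_succ_le.mp (not_le.mp h)))))) j

theorem linEval_one {Z : V} (i : ULift.{u} (Fin (m + 1))) :
    linEval f g i i.down (linOne Z i) = eone Z (f i) := by
  obtain ⟨i⟩ := i
  induction i using Fin.cases with
  | zero => rfl
  | succ k => exact dif_neg (not_le.mpr Fin.castSucc_lt_succ)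

theorem linEval_mul_linEdge {Z : V} (i : ULift.{u} (Fin (m + 1))) (k : Fin m)
    (a : Pt (linRep B i ⟨k.castSucc⟩) Z) (h : Z ⟶ B k) :
    linEval f g i k.succ (linMul a (linEdge k h)) =
      emul (linEval f g i k.castSucc a) (h ≫ g k) := by
  have hi : i.down ≤ k.castSucc := a.idx.down.down
  refine (dif_pos hi).trans ?_
  rw [linInit_linMul, linAt_linMul_linEdge]
  rfl

theorem comp_linEval {Z Z' : V} (v : Z' ⟶ Z) {i j : ULift.{u} (Fin (m + 1))}
    (a : Pt (linRep B i j) Z) :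
    v ≫ linEval f g i j.down a = linEval f g i j.down (a.res v) := by
  refine lin_induction (motive := fun j a =>
    v ≫ linEval f g i j.down a = linEval f g i j.down (a.res v)) ?_ (fun k a h ih => ?_) j a
  · rw [res_linOne, linEval_one]
    exact (comp_eone v (f i)).trans (linEval_one f g i).symm
  · have e : (linMul a (linEdge k h)).res v = linMul (a.res v) (linEdge k (v ≫ h)) :=
      ((linFam B).res_mul v a (linEdge k h)).trans (congrArg _ (res_linEdge v k h))
    rw [e, linEval_mul_linEdge, linEval_mul_linEdge, comp_emul, ih, Category.assoc]

theorem linEval_mul {Z : V} {i j l : ULift.{u} (Fin (m + 1))} (a : Pt (linRep B i j) Z)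
    (b : Pt (linRep B j l) Z) :
    linEval f g i l.down (linMul a b) =
      emul (linEval f g i j.down a) (linEval f g j l.down b) := by
  refine lin_induction (motive := fun l b => linEval f g i l.down (linMul a b) =
      emul (linEval f g i j.down a) (linEval f g j l.down b)) ?_ (fun k b h ih => ?_) l b
  · rw [linEval_one, emul_eone]
    exact congrArg _ ((linFam B).mul_one a)
  · have e : linMul a (linMul b (linEdge k h)) = linMul (linMul a b) (linEdge k h) :=
      ((linFam B).mul_assoc a b (linEdge k h)).symm
    rw [e, linEval_mul_linEdge, ih, linEval_mul_linEdge, emul_assoc]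

end Eval

variable [DistribCoproducts V] (B)

/-- The linear `V`-category on `B`: its objects are `0, …, m`, and it is freely generated by the
objects `B k` of morphisms from `k` to `k + 1`. -/
noncomputable def lin : VCat V := (linFam B).realize

/-- The generators of a linear `V`-category. -/
noncomputable def linGen (k : Fin m) :
    B k ⟶ EnrichedCategory.Hom (V := V) (C := (lin B).carrier) ⟨k.castSucc⟩ ⟨k.succ⟩ :=
  FamCat.pt (P := linFam B) (linEdge k (𝟙 _))

variable {B}

theorem comp_linGen {Z : V} (k : Fin m) (g : Z ⟶ B k) :
    g ≫ linGen B k = FamCat.pt (P := linFam B) (linEdge k g) := by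
  refine (FamCat.comp_pt (P := linFam B) _ _).trans (congrArg _ ?_)
  exact (res_linEdge _ _ _).trans (congrArg _ (Category.comp_id _))

theorem pt_mul_linEdge {Z : V} {i : ULift.{u} (Fin (m + 1))} (k : Fin m)
    (a : Pt (linRep B i ⟨k.castSucc⟩) Z) (g : Z ⟶ B k) :
    FamCat.pt (P := linFam B) (linMul a (linEdge k g)) =
      emul (V := V) (C := (lin B).carrier) (FamCat.pt (P := linFam B) a) (g ≫ linGen B k) := by
  refine (FamCat.emul_pt (P := linFam B) a (linEdge k g)).symm.trans ?_
  exact congrArg (emul (FamCat.pt (P := linFam B) a)) (comp_linGen k g).symm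

/-- A `V`-functor out of a linear `V`-category is determined by its values on the generators. -/
theorem lin_functor_ext {D : VCat V} {F F' : lin B ⟶ D} (hobj : ∀ x, vobj F x = vobj F' x)
    (hgen : ∀ k, HEq (linGen B k ≫ vmap F _ _) (linGen B k ≫ vmap F' _ _)) : F = F' := by
  obtain ⟨Fo, Fm, F1, F2⟩ := F
  obtain ⟨Fo', Fm', F1', F2'⟩ := F'
  obtain rfl : Fo = Fo' := funext hobj
  refine FamCat.functor_ext (P := linFam B) (fun _ => rfl) fun {Z x y} a => heq_of_eq ?_
  refine lin_induction (B := B) (motive := fun y a =>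
    FamCat.pt (P := linFam B) a ≫ Fm x y = FamCat.pt (P := linFam B) a ≫ Fm' x y) ?_ ?_ y a
  · have e := FamCat.eone_pt (P := linFam B) Z x
    refine (congrArg (fun t => t ≫ Fm x x) e).symm.trans
      (Eq.trans ?_ (congrArg (fun t => t ≫ Fm' x x) e))
    exact (eone_map ⟨Fo, Fm, F1, F2⟩ x).trans (eone_map ⟨Fo, Fm', F1', F2'⟩ x).symm
  · intro k b g ih
    have e := pt_mul_linEdge k b g
    refine (congrArg (fun t => t ≫ Fm x ⟨k.succ⟩) e).trans
      (Eq.trans ?_ (congrArg (fun t => t ≫ Fm' x ⟨k.succ⟩) e).symm)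
    refine (emul_map ⟨Fo, Fm, F1, F2⟩ _ _).trans
      (Eq.trans ?_ (emul_map ⟨Fo, Fm', F1', F2'⟩ _ _).symm)
    refine congrArg₂ emul ih ?_
    refine (Category.assoc _ _ _).trans (Eq.trans ?_ (Category.assoc _ _ _).symm)
    exact congrArg (fun t => g ≫ t) (eq_of_heq (hgen k))

/-- The `V`-functor out of a linear `V`-category with given values on the generators. -/
noncomputable def linLift {D : VCat V} (f : ULift.{u} (Fin (m + 1)) → D.carrier)
    (g : ∀ k : Fin m, B k ⟶ (f ⟨k.castSucc⟩ ⟶[V] f ⟨k.succ⟩)) : lin B ⟶ D :=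
  FamCat.lift (P := linFam B) f (fun {_ x y} a => linEval f g x y.down a)
    (fun v _ _ a => comp_linEval f g v a) (fun _ x => linEval_one f g x)
    (fun a b => linEval_mul f g a b)

theorem pt_linLift {D : VCat V} (f : ULift.{u} (Fin (m + 1)) → D.carrier)
    (g : ∀ k : Fin m, B k ⟶ (f ⟨k.castSucc⟩ ⟶[V] f ⟨k.succ⟩)) {Z : V}
    {x y : ULift.{u} (Fin (m + 1))} (a : Pt (linRep B x y) Z) :
    FamCat.pt (P := linFam B) a ≫ vmap (linLift f g) x y = linEval f g x y.down a :=
  FamCat.pt_lift (P := linFam B) f (fun {_ x y} a => linEval f g x y.down a)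
    (fun v _ _ a => comp_linEval f g v a) (fun _ x => linEval_one f g x)
    (fun a b => linEval_mul f g a b) a

theorem linGen_linLift {D : VCat V} (f : ULift.{u} (Fin (m + 1)) → D.carrier)
    (g : ∀ k : Fin m, B k ⟶ (f ⟨k.castSucc⟩ ⟶[V] f ⟨k.succ⟩)) (k : Fin m) :
    linGen B k ≫ vmap (linLift f g) _ _ = g k := by
  refine (pt_linLift f g (linEdge k (𝟙 (B k)))).trans ?_
  have e : linEdge k (𝟙 (B k)) = linMul (linOne _ ⟨k.castSucc⟩) (linEdge k (𝟙 (B k))) :=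
    ((linFam B).one_mul _).symm
  rw [e, linEval_mul_linEdge, Category.id_comp]
  refine Eq.trans ?_ (eone_emul (g k))
  exact congrArg (fun t => emul t (g k)) (linEval_one f g _)

theorem isFreeOn_linGen : IsFreeOn (K := lin B) (linGen B) := by
  refine fun D => ⟨fun F F' h => ?_, fun ⟨f, g⟩ => ⟨linLift f g, ?_⟩⟩
  · have h1 : vobj F = vobj F' := congrArg Sigma.fst h
    refine lin_functor_ext (congrFun h1) fun k => ?_
    have h2 := (Sigma.mk.inj h).2
    obtain ⟨Fo, Fm, F1, F2⟩ := F
    obtain ⟨Fo', Fm', F1', F2'⟩ := F'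
    obtain rfl : Fo = Fo' := h1
    exact heq_of_eq (congrFun (eq_of_heq h2) k)
  · exact Sigma.ext rfl (heq_of_eq (funext fun k => linGen_linLift f g k))

end Linear

end Familial

/-! ### The realization of a wreath product -/

namespace Familial

open MonoidalCategory CartesianMonoidalCategory

variable {V : Type (u + 1)} [Category.{u} V] [CartesianMonoidalCategory V]

/-- The simplicial operator `[1] ⟶ [m]` with given values. -/
def longEdge {m : ℕ} {i j : Fin (m + 1)} (h : i ≤ j) :
    SimplexCategory.mk 1 ⟶ SimplexCategory.mk m :=
  SimplexCategory.mkHom ⟨Fin.cases i fun _ => j, fun a b hab => by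
    induction a using Fin.cases with
    | zero => induction b using Fin.cases with
      | zero => exact le_rfl
      | succ b => exact h
    | succ a => induction b using Fin.cases with
      | zero => exact absurd hab (by simp)
      | succ b => exact le_rfl⟩

/-- An index between two values of a simplicial operator lies in one of its blocks. -/
theorem exists_inBlock {m n : ℕ} (φ : SimplexCategory.mk m ⟶ SimplexCategory.mk n)
    {i j : Fin (m + 1)} (h : i ≤ j) (k : Between (φ.toOrderHom i) (φ.toOrderHom j)) :
    ∃ k' : Between i j, Wreath.InBlock φ k'.1 k.1 := by
  obtain ⟨k', h1, h2⟩ := Wreath.InBlock.exists_mid (φ := longEdge h) (ψ := φ) (i := 0) k.2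
  exact ⟨⟨k', h1⟩, h2⟩

variable {A : Type} [Category.{0} A] (E : A ⥤ V)

section Act

variable {X Y W : Wreath A} (f : X ⟶ Y) (f' : Y ⟶ W)

/-- The action of an operator of the wreath product on vertices. -/
def wreathVert (i : ULift.{u} (Fin (X.len + 1))) : ULift.{u} (Fin (Y.len + 1)) :=
  ⟨(Wreath.Hom.base f).toOrderHom i.down⟩

/-- The action of an operator of the wreath product on the points of linear `V`-categories. -/
noncomputable def wreathAct {Z : V} {i j : ULift.{u} (Fin (X.len + 1))}
    (a : Pt (linRep (fun k => E.obj (X.obj k)) i j) Z) :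
    Pt (linRep (fun k => E.obj (Y.obj k)) (wreathVert f i) (wreathVert f j)) Z :=
  linPt ((Wreath.Hom.base f).toOrderHom.monotone a.idx.down.down) fun k =>
    linAt a (exists_inBlock (Wreath.Hom.base f) a.idx.down.down k).choose ≫
      E.map (Wreath.Hom.comp f _ k.1
        (exists_inBlock (Wreath.Hom.base f) a.idx.down.down k).choose_spec)

theorem linAt_wreathAct {Z : V} {i j : ULift.{u} (Fin (X.len + 1))}
    (a : Pt (linRep (fun k => E.obj (X.obj k)) i j) Z)
    (k : Between (wreathVert f i).down (wreathVert f j).down) (k' : Between i.down j.down)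
    (h : Wreath.InBlock (Wreath.Hom.base f) k'.1 k.1) :
    linAt (wreathAct E f a) k = linAt a k' ≫ E.map (Wreath.Hom.comp f k'.1 k.1 h) := by
  have e : (exists_inBlock (Wreath.Hom.base f) a.idx.down.down k).choose = k' :=
    Subtype.ext
      ((exists_inBlock (Wreath.Hom.base f) a.idx.down.down k).choose_spec.unique h)
  subst e
  exact linAt_linPt _ _ _

theorem res_wreathAct {Z Z' : V} (v : Z' ⟶ Z) {i j : ULift.{u} (Fin (X.len + 1))}
    (a : Pt (linRep (fun k => E.obj (X.obj k)) i j) Z) :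
    (wreathAct E f a).res v = wreathAct E f (a.res v) :=
  linPt_ext fun k => by
    obtain ⟨k', h⟩ := exists_inBlock (Wreath.Hom.base f) a.idx.down.down k
    rw [linAt_res, linAt_wreathAct E f _ k k' h, linAt_wreathAct E f _ k k' h, linAt_res,
      Category.assoc]

theorem wreathAct_one (Z : V) (i : ULift.{u} (Fin (X.len + 1))) :
    wreathAct E f (linOne Z i) = linOne Z (wreathVert f i) :=
  linPt_ext fun k => absurd k.2.2 (not_lt.mpr k.2.1)

theorem wreathAct_mul {Z : V} {i j l : ULift.{u} (Fin (X.len + 1))}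
    (a : Pt (linRep (fun k => E.obj (X.obj k)) i j) Z)
    (b : Pt (linRep (fun k => E.obj (X.obj k)) j l) Z) :
    wreathAct E f (linMul a b) = linMul (wreathAct E f a) (wreathAct E f b) :=
  linPt_ext fun k => by
    rw [linAt_linMul (wreathAct E f a)]
    by_cases hk : k.1.castSucc < (wreathVert f j).down
    · obtain ⟨k', h⟩ := exists_inBlock (Wreath.Hom.base f) a.idx.down.down ⟨k.1, k.2.1, hk⟩
      rw [dif_pos hk, linAt_wreathAct E f a ⟨k.1, k.2.1, hk⟩ k' h,
        linAt_wreathAct E f _ k ⟨k'.1, k'.2.1, k'.2.2.trans_le b.idx.down.down⟩ h,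
        linAt_linMul, dif_pos k'.2.2]
    · obtain ⟨k', h⟩ :=
        exists_inBlock (Wreath.Hom.base f) b.idx.down.down ⟨k.1, not_lt.mp hk, k.2.2⟩
      rw [dif_neg hk, linAt_wreathAct E f b ⟨k.1, not_lt.mp hk, k.2.2⟩ k' h,
        linAt_wreathAct E f _ k ⟨k'.1, le_trans a.idx.down.down k'.2.1, k'.2.2⟩ h,
        linAt_linMul, dif_neg (not_lt.mpr k'.2.1)]

theorem wreathAct_id {Z : V} {i j : ULift.{u} (Fin (X.len + 1))}
    (a : Pt (linRep (fun k => E.obj (X.obj k)) i j) Z) : wreathAct E (𝟙 X) a = a :=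
  linPt_ext fun k => by
    rw [linAt_wreathAct E (𝟙 X) a k k (Wreath.inBlock_id_self k.1)]
    have : Wreath.Hom.comp (𝟙 X) k.1 k.1 (Wreath.inBlock_id_self k.1) = 𝟙 _ := rfl
    rw [this, E.map_id, Category.comp_id]
    rfl

theorem wreathAct_comp {Z : V} {i j : ULift.{u} (Fin (X.len + 1))}
    (a : Pt (linRep (fun k => E.obj (X.obj k)) i j) Z) :
    wreathAct E (f ≫ f') a = wreathAct E f' (wreathAct E f a) :=
  linPt_ext fun k => by
    obtain ⟨k', h'⟩ := exists_inBlock (Wreath.Hom.base f') (wreathAct E f a).idx.down.down k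
    obtain ⟨k'', h⟩ := exists_inBlock (Wreath.Hom.base f) a.idx.down.down k'
    refine (linAt_wreathAct E (f ≫ f') a k k'' (h.comp h')).trans
      (Eq.trans ?_ (linAt_wreathAct E f' (wreathAct E f a) k k' h').symm)
    rw [linAt_wreathAct E f a k' k'' h]
    have e : Wreath.Hom.comp (f ≫ f') k''.1 k.1 (h.comp h') =
        Wreath.Hom.comp f _ _ h ≫ Wreath.Hom.comp f' _ _ h' := Wreath.Hom.trans_comp f f' _ h h'
    rw [e, E.map_comp, Category.assoc]

end Act

variable [DistribCoproducts V]

/-- The linear `V`-category of an object of the wreath product. -/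
noncomputable abbrev wreathLin (X : Wreath A) : VCat V := lin fun k => E.obj (X.obj k)

/-- The `V`-functor between linear `V`-categories given by an operator of the wreath product. -/
noncomputable def wreathMap {X Y : Wreath A} (f : X ⟶ Y) : wreathLin E X ⟶ wreathLin E Y :=
  FamCat.lift (P := linFam fun k => E.obj (X.obj k)) (E := wreathLin E Y) (wreathVert f)
    (fun a => FamCat.pt (P := linFam fun k => E.obj (Y.obj k)) (wreathAct E f a))
    (fun v _ _ a => (FamCat.comp_pt _ _).trans (congrArg _ (res_wreathAct E f v a)))
    (fun Z i => (congrArg _ (wreathAct_one E f Z i)).trans (FamCat.eone_pt _ _).symm)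
    (fun a b => (congrArg _ (wreathAct_mul E f a b)).trans (FamCat.emul_pt _ _).symm)

theorem pt_wreathMap {X Y : Wreath A} (f : X ⟶ Y) {Z : V} {i j : ULift.{u} (Fin (X.len + 1))}
    (a : Pt (linRep (fun k => E.obj (X.obj k)) i j) Z) :
    FamCat.pt (P := linFam fun k => E.obj (X.obj k)) a ≫ vmap (wreathMap E f) i j =
      FamCat.pt (P := linFam fun k => E.obj (Y.obj k)) (wreathAct E f a) :=
  FamCat.pt_lift (P := linFam fun k => E.obj (X.obj k)) (E := wreathLin E Y) (wreathVert f)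
    (fun a => FamCat.pt (P := linFam fun k => E.obj (Y.obj k)) (wreathAct E f a))
    (fun v _ _ a => (FamCat.comp_pt _ _).trans (congrArg _ (res_wreathAct E f v a)))
    (fun Z i => (congrArg _ (wreathAct_one E f Z i)).trans (FamCat.eone_pt _ _).symm)
    (fun a b => (congrArg _ (wreathAct_mul E f a b)).trans (FamCat.emul_pt _ _).symm) a

/-- The functor from the wreath product `Δ ≀ A` to `V`-categories induced by a functor
`A ⥤ V`. -/
noncomputable def wreathFunctor : Wreath A ⥤ VCat V where
  obj := wreathLin E
  map := wreathMap E
  map_id X := by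
    refine FamCat.functor_ext (P := linFam fun k => E.obj (X.obj k)) (fun _ => rfl)
      fun {Z x y} a => heq_of_eq ?_
    refine (pt_wreathMap E (𝟙 X) a).trans ?_
    exact (congrArg _ (wreathAct_id E a)).trans (Category.comp_id _).symm
  map_comp {X Y W} f f' := by
    refine FamCat.functor_ext (P := linFam fun k => E.obj (X.obj k)) (fun _ => rfl)
      fun {Z x y} a => heq_of_eq ?_
    refine (pt_wreathMap E (f ≫ f') a).trans ?_
    refine (congrArg _ (wreathAct_comp E f f' a)).trans ?_
    refine (pt_wreathMap E f' _).symm.trans ?_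
    refine (congrArg (fun t => t ≫ vmap (wreathMap E f') _ _) (pt_wreathMap E f a)).symm.trans ?_
    exact Category.assoc _ _ _

/-- Points of the hom-objects of a linear `V`-category on an object which has a global
point. -/
theorem pt_bijective {m : ℕ} (B : Fin m → V) {Z : V} (z : 𝟙_ V ⟶ Z)
    (i j : ULift.{u} (Fin (m + 1))) :
    Function.Bijective (FamCat.pt (P := linFam B) (Z := Z) (x := i) (y := j)) := by
  have : Subsingleton ((linFam B).Idx i j) :=
    inferInstanceAs (Subsingleton (ULift.{u} (PLift (i.down ≤ j.down))))
  exact val_bijective _ z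

variable {E}

theorem linGen_wreathMap {X Y : Wreath A} (f : X ⟶ Y) (k : Fin X.len) :
    linGen (fun k => E.obj (X.obj k)) k ≫ vmap (wreathMap E f) _ _ =
      FamCat.pt (P := linFam fun k => E.obj (Y.obj k)) (wreathAct E f (linEdge k (𝟙 _))) :=
  pt_wreathMap E f _

theorem wreathFunctor_faithful [E.Faithful] (hE : ∀ X, Nonempty (𝟙_ V ⟶ E.obj X)) :
    (wreathFunctor E).Faithful where
  map_injective {X Y f g} h := by
    have hb : Wreath.Hom.base f = Wreath.Hom.base g := by
      ext i : 3
      have := congrArg (fun F => (vobj F (⟨i⟩ : ULift.{u} (Fin (X.len + 1))))) h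
      exact congrArg ULift.down this
    obtain ⟨fb, fc⟩ := f
    obtain ⟨gb, gc⟩ := g
    obtain rfl : fb = gb := hb
    refine Wreath.Hom.ext_of_base rfl fun k l hk hk' => E.map_injective ?_
    have h1 := eq_of_heq (vmap_congr h (linGen (fun k => E.obj (X.obj k)) k))
    have h2 := (linGen_wreathMap _ k).symm.trans (h1.trans (linGen_wreathMap _ k))
    have h3 := (pt_bijective (fun k => E.obj (Y.obj k)) (hE (X.obj k)).some
      (wreathVert (⟨fb, fc⟩ : Wreath.Hom X Y) ⟨k.castSucc⟩)
      (wreathVert (⟨fb, fc⟩ : Wreath.Hom X Y) ⟨k.succ⟩)).1 h2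
    have h4 := congrArg (fun a => linAt a ⟨l, hk⟩) h3
    dsimp only at h4
    have e : ∀ f : X ⟶ Y, ∀ hf : Wreath.InBlock (Wreath.Hom.base f) k l,
        linAt (wreathAct E f (linEdge k (𝟙 (E.obj (X.obj k))))) ⟨l, hf⟩ =
          E.map (Wreath.Hom.comp f k l hf) := fun f hf => by
      rw [linAt_wreathAct E f _ ⟨l, hf⟩ ⟨k, le_rfl, Fin.castSucc_lt_succ⟩ hf, linAt_linEdge,
        Category.id_comp]
    exact (e ⟨fb, fc⟩ hk).symm.trans (h4.trans (e ⟨fb, gc⟩ hk'))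

/-- The points of a hom-object that are the images of the generators have an index, which says that
the vertices are mapped monotonically, and components, which are the components of an operator. -/
theorem wreathFunctor_full [E.Full] (hE : ∀ X, Nonempty (𝟙_ V ⟶ E.obj X)) :
    (wreathFunctor E).Full where
  map_surjective {X Y} G := by
    choose p hp using fun k : Fin X.len => (pt_bijective (fun k => E.obj (Y.obj k))
      (hE (X.obj k)).some _ _).2 (linGen (fun k => E.obj (X.obj k)) k ≫ vmap G _ _)
    let γ : Fin (X.len + 1) → Fin (Y.len + 1) := fun i =>
      (show ULift.{u} (Fin (Y.len + 1)) from vobj G (⟨i⟩ : ULift.{u} (Fin (X.len + 1)))).down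
    have hγ : Monotone γ := Fin.monotone_iff_le_succ.mpr fun k => (p k).idx.down.down
    let f : X ⟶ Y := (⟨SimplexCategory.mkHom ⟨γ, hγ⟩, fun k l h =>
      E.preimage (linAt (B := fun k => E.obj (Y.obj k)) (i := ⟨γ k.castSucc⟩)
        (j := ⟨γ k.succ⟩) (p k) ⟨l, h⟩)⟩ : Wreath.Hom X Y)
    refine ⟨f, lin_functor_ext (fun _ => rfl) fun k => heq_of_eq ?_⟩
    refine (linGen_wreathMap f k).trans (Eq.trans ?_ (hp k))
    refine congrArg _ (linPt_ext fun l => ?_)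
    refine (linAt_wreathAct E f _ l ⟨k, le_rfl, Fin.castSucc_lt_succ⟩ l.2).trans ?_
    rw [linAt_linEdge, Category.id_comp]
    exact E.map_preimage _

end Familial

/-! ### Density -/

namespace Familial

open MonoidalCategory CartesianMonoidalCategory

/-- Density of a functor `E`, in terms of families of maps: a family of functions
`(E X ⟶ C) → (E X ⟶ D)` which is natural in `X` is induced by a unique morphism `C ⟶ D`. -/
def IsDense {A : Type} [Category.{0} A] {V : Type (u + 1)} [Category.{u} V] (E : A ⥤ V) : Prop :=
  ∀ (C D : V) (a : ∀ X, (E.obj X ⟶ C) → (E.obj X ⟶ D)),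
    (∀ (X Y : A) (f : X ⟶ Y) (h : E.obj Y ⟶ C), a X (E.map f ≫ h) = E.map f ≫ a Y h) →
    ∃! g : C ⟶ D, ∀ X (h : E.obj X ⟶ C), h ≫ g = a X h

namespace IsDense

variable {A : Type} [Category.{0} A] {V : Type (u + 1)} [Category.{u} V] {E : A ⥤ V}

theorem hom_ext (hE : IsDense E) {C D : V} {f g : C ⟶ D}
    (h : ∀ X (a : E.obj X ⟶ C), a ≫ f = a ≫ g) : f = g :=
  (hE C D (fun _ a => a ≫ g) fun _ _ _ _ => Category.assoc _ _ _).unique h fun _ _ => rfl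

theorem nerveAlong_faithful (hE : IsDense E) : (nerveAlong E).Faithful where
  map_injective {C D _ _} h := hE.hom_ext fun X a =>
    congrArg (fun t : (nerveAlong E).obj C ⟶ (nerveAlong E).obj D => t.app (.op X) a) h

theorem nerveAlong_full (hE : IsDense E) : (nerveAlong E).Full where
  map_surjective {C D} α := by
    obtain ⟨g, hg, -⟩ := hE C D (fun X h => α.app (.op X) h) fun X Y f h =>
      congrArg (fun t => t h) (α.naturality f.op)
    refine ⟨g, ?_⟩
    ext X h
    exact hg X.unop h

/-- Density is invariant under isomorphism of functors. -/
theorem of_iso (hE : IsDense E) {E' : A ⥤ V} (e : E' ≅ E) : IsDense E' := by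
  intro C D a ha
  obtain ⟨g, hg, -⟩ := hE C D (fun X h => e.inv.app X ≫ a X (e.hom.app X ≫ h)) (by
    intro X Y f h
    rw [← e.hom.naturality_assoc, ha _ _ f, e.inv.naturality_assoc])
  refine ⟨g, fun X h => ?_, fun g' hg' => hE.hom_ext fun X h => ?_⟩
  · have := hg X (e.inv.app X ≫ h)
    rw [e.hom_inv_id_app_assoc, Category.assoc] at this
    exact (cancel_epi (e.inv.app X)).mp this
  · rw [hg X h, ← hg', ← Category.assoc, ← Category.assoc, e.inv_hom_id_app, Category.id_comp]

/-- Density is invariant under equivalences of the source. -/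
theorem comp_equivalence (hE : IsDense E) {A' : Type} [Category.{0} A'] (K : A' ⥤ A)
    [K.Full] [K.EssSurj] : IsDense (K ⋙ E) := by
  intro C D a ha
  let i := K.objObjPreimageIso
  have ha' : ∀ {X Y : A'} (f : K.obj X ⟶ K.obj Y) (h : E.obj (K.obj Y) ⟶ C),
      a X (E.map f ≫ h) = E.map f ≫ a Y h := by
    intro X Y f h
    obtain ⟨f, rfl⟩ := K.map_surjective f
    exact ha _ _ f h
  have hi : ∀ X {W : V} (h : E.obj X ⟶ W), E.map (i X).inv ≫ E.map (i X).hom ≫ h = h :=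
    fun X W h => by rw [← E.map_comp_assoc, Iso.inv_hom_id, E.map_id, Category.id_comp]
  obtain ⟨g, hg, -⟩ := hE C D (fun X h => E.map (i X).inv ≫ a _ (E.map (i X).hom ≫ h)) (by
    intro X Y f h
    have := ha' ((i X).hom ≫ f ≫ (i Y).inv) (E.map (i Y).hom ≫ h)
    simp only [Functor.map_comp, Category.assoc, hi] at this
    rw [this, hi])
  refine ⟨g, fun X h => ?_, fun g' hg' => hE.hom_ext fun X h => ?_⟩
  · have := hg (K.obj X) h
    rw [ha', hi] at this
    exact this
  · rw [hg X h, ← hg', Category.assoc, hi]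

end IsDense

variable {V : Type (u + 1)} [Category.{u} V] [CartesianMonoidalCategory V]
variable {A : Type} [Category.{0} A] (E : A ⥤ V)

/-- The tuple with entry `a` repeated `m` times. -/
abbrev constTuple (m : ℕ) (a : A) : Wreath A := ⟨m, fun _ => a⟩

/-- The empty tuple. -/
abbrev emptyTuple (A : Type) : Wreath A := ⟨0, fun k => k.elim0⟩

/-- The inclusion of a vertex. -/
def vertexHom (X : Wreath A) (i : Fin (X.len + 1)) : emptyTuple A ⟶ X :=
  (⟨SimplexCategory.mkHom ⟨fun _ => i, fun _ _ _ => le_rfl⟩, fun k => k.elim0⟩ :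
    Wreath.Hom (emptyTuple A) X)

/-- The operator from a tuple of length one with first vertex `i`, last vertex `j` and given
components. -/
def longEdgeHom {a : A} {X : Wreath A} {i j : Fin (X.len + 1)} (h : i ≤ j)
    (c : ∀ k : Between i j, a ⟶ X.obj k.1) : constTuple 1 a ⟶ X :=
  (⟨longEdge h, fun z k hk => c ⟨k, by
    obtain rfl : z = (0 : Fin 1) := Subsingleton.elim (α := Fin 1) _ _
    exact hk⟩⟩ : Wreath.Hom (constTuple 1 a) X)

/-- The inclusion of an elementary edge. -/
def edgeHom {a : A} {X : Wreath A} (k : Fin X.len) (c : a ⟶ X.obj k) : constTuple 1 a ⟶ X :=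
  longEdgeHom (Fin.castSucc_le_succ k) fun k' => c ≫ eqToHom (congrArg X.obj (le_antisymm
    (Fin.castSucc_le_castSucc_iff.mp k'.2.1) (Fin.castSucc_lt_succ_iff.mp k'.2.2)))

variable [DistribCoproducts V]

variable {E}

/-- The restriction of a `V`-functor along an operator of the wreath product. -/
noncomputable def pull {D : VCat V} {X Y : Wreath A} (f : X ⟶ Y) (H : wreathLin E Y ⟶ D) :
    wreathLin E X ⟶ D :=
  wreathMap E f ≫ H

theorem pull_comp {D D' : VCat V} {X Y : Wreath A} (f : X ⟶ Y) (H : wreathLin E Y ⟶ D)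
    (K : D ⟶ D') : pull f H ≫ K = pull f (H ≫ K) :=
  Category.assoc _ _ _

/-- The value of a `V`-functor at a vertex. -/
noncomputable def vert {D : VCat V} {X : Wreath A} (H : wreathLin E X ⟶ D)
    (i : Fin (X.len + 1)) : D.carrier :=
  vobj H (⟨i⟩ : ULift.{u} (Fin (X.len + 1)))

/-- The value of a `V`-functor at a generator. -/
noncomputable def edge {D : VCat V} {X : Wreath A} (H : wreathLin E X ⟶ D) (k : Fin X.len) :
    E.obj (X.obj k) ⟶ (vert H k.castSucc ⟶[V] vert H k.succ) :=
  linGen (fun k => E.obj (X.obj k)) k ≫ vmap H _ _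

theorem wreathLin_ext {D : VCat V} {X : Wreath A} {F G : wreathLin E X ⟶ D}
    (hv : ∀ i, vert F i = vert G i) (he : ∀ k, HEq (edge F k) (edge G k)) : F = G :=
  lin_functor_ext (fun i => hv i.down) he

/-- The `V`-functor which picks an object. -/
noncomputable def pointAt {D : VCat V} (d : D.carrier) : wreathLin E (emptyTuple A) ⟶ D :=
  linLift (fun _ => d) fun k => k.elim0

/-- The vertices of a single arrow. -/
def arrowVert {O : Type u} (d d' : O) : Fin 2 → O
  | 0 => d
  | 1 => d'

/-- The `V`-functor which picks a generalized morphism. -/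
noncomputable def arrow {D : VCat V} {d d' : D.carrier} {a : A}
    (b : E.obj a ⟶ (d ⟶[V] d')) : wreathLin E (constTuple 1 a) ⟶ D :=
  linLift (m := 1) (fun t => arrowVert d d' t.down) fun
    | 0 => b

theorem pointAt_ext {D : VCat V} {F G : wreathLin E (emptyTuple A) ⟶ D}
    (h : vert F (0 : Fin 1) = vert G (0 : Fin 1)) : F = G := by
  refine wreathLin_ext (fun i => ?_) fun k => k.elim0
  obtain rfl : i = (0 : Fin 1) := Subsingleton.elim (α := Fin 1) _ _
  exact h

theorem pull_vertexHom {D : VCat V} {X : Wreath A} (i : Fin (X.len + 1))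
    (H : wreathLin E X ⟶ D) : pull (vertexHom X i) H = pointAt (vert H i) :=
  pointAt_ext rfl

theorem edge_arrow {D : VCat V} {d d' : D.carrier} {a : A} (b : E.obj a ⟶ (d ⟶[V] d')) :
    edge (arrow b) (0 : Fin 1) = b :=
  linGen_linLift (m := 1) (B := fun _ => E.obj a) (D := D) _ _ 0

theorem arrow_ext {D : VCat V} {a : A} {F : wreathLin E (constTuple 1 a) ⟶ D} {d d' : D.carrier}
    {b : E.obj a ⟶ (d ⟶[V] d')} (h0 : vert F (0 : Fin 2) = d) (h1 : vert F (1 : Fin 2) = d')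
    (h : HEq (edge F (0 : Fin 1)) b) : F = arrow b := by
  refine wreathLin_ext (fun i => ?_) fun k => ?_
  · match i with
    | 0 => exact h0
    | 1 => exact h1
  · obtain rfl : k = (0 : Fin 1) := Subsingleton.elim (α := Fin 1) _ _
    exact h.trans (heq_of_eq (edge_arrow b).symm)

/-- Equal `V`-functors have equal edges; the types of the edges depend on the `V`-functor. -/
theorem edge_congr {D : VCat V} {X : Wreath A} {F G : wreathLin E X ⟶ D} (h : F = G)
    (k : Fin X.len) : HEq (edge F k) (edge G k) := by
  subst h
  rfl

theorem arrow_heq {D : VCat V} {d d' e e' : D.carrier} {a : A} {b : E.obj a ⟶ (d ⟶[V] d')}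
    {c : E.obj a ⟶ (e ⟶[V] e')} (h : arrow b = arrow c) : HEq b c :=
  (heq_of_eq (edge_arrow b).symm).trans
    ((edge_congr h (0 : Fin 1)).trans (heq_of_eq (edge_arrow c)))

theorem arrow_comp {C D : VCat V} {d d' : C.carrier} {a : A} (b : E.obj a ⟶ (d ⟶[V] d'))
    (F : C ⟶ D) : arrow b ≫ F = arrow (b ≫ vmap F d d') :=
  arrow_ext rfl rfl (heq_of_eq ((Category.assoc _ _ _).symm.trans
    (congrArg (fun t => t ≫ vmap F d d') (edge_arrow b))))

/-- Restriction along a long edge is evaluation at the point with the given components. -/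
theorem pull_longEdgeHom {D : VCat V} {a : A} {X : Wreath A} {i j : Fin (X.len + 1)} (h : i ≤ j)
    (c : ∀ k : Between i j, a ⟶ X.obj k.1) (H : wreathLin E X ⟶ D) :
    pull (longEdgeHom h c) H =
      arrow (d := vert H i) (d' := vert H j) (FamCat.pt (P := linFam fun k => E.obj (X.obj k))
        (linPt (B := fun k => E.obj (X.obj k)) (Z := E.obj a) (i := ⟨i⟩) (j := ⟨j⟩) h
          fun k => E.map (c k)) ≫ vmap H (⟨i⟩ : ULift.{u} (Fin (X.len + 1)))
            (⟨j⟩ : ULift.{u} (Fin (X.len + 1)))) := by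
  refine arrow_ext rfl rfl (heq_of_eq ?_)
  refine (Category.assoc _ _ _).symm.trans
    (congrArg (fun t => t ≫ vmap H (⟨i⟩ : ULift.{u} (Fin (X.len + 1))) ⟨j⟩) ?_)
  refine (linGen_wreathMap (longEdgeHom h c) (0 : Fin 1)).trans (congrArg _ ?_)
  refine linPt_ext fun k => ?_
  refine (linAt_wreathAct E (longEdgeHom h c) _ k ⟨(0 : Fin 1), le_rfl, Fin.castSucc_lt_succ⟩
    k.2).trans ?_
  rw [linAt_linEdge]
  exact (Category.id_comp _).trans (linAt_linPt (B := fun k => E.obj (X.obj k)) (Z := E.obj a)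
    (i := ⟨i⟩) (j := ⟨j⟩) h (fun k => E.map (c k)) k).symm

theorem pull_edgeHom {D : VCat V} {a : A} {X : Wreath A} (k : Fin X.len) (c : a ⟶ X.obj k)
    (H : wreathLin E X ⟶ D) : pull (edgeHom k c) H = arrow (E.map c ≫ edge H k) := by
  refine (pull_longEdgeHom _ _ H).trans (congrArg arrow ?_)
  refine Eq.trans ?_ (Category.assoc _ _ _)
  refine congrArg (fun t => t ≫ vmap H _ _) ?_
  refine Eq.trans ?_ (comp_linGen (B := fun k => E.obj (X.obj k)) k (E.map c)).symm
  refine congrArg _ (linPt_ext fun k' => ?_)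
  obtain ⟨k', h⟩ := k'
  obtain rfl : k = k' := le_antisymm
    (Fin.castSucc_le_castSucc_iff.mp h.1) (Fin.castSucc_lt_succ_iff.mp h.2)
  rw [linAt_linPt, linAt_linEdge, eqToHom_refl, Category.comp_id]

theorem pull_edgeHom_id {D : VCat V} {X : Wreath A} (k : Fin X.len) (H : wreathLin E X ⟶ D) :
    pull (edgeHom k (𝟙 (X.obj k))) H = arrow (edge H k) := by
  rw [pull_edgeHom, E.map_id, Category.id_comp]

/-- The vertices of a composable pair. -/
def pairVert {O : Type u} (x y z : O) : Fin 3 → O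
  | 0 => x
  | 1 => y
  | 2 => z

/-- The `V`-functor which picks a composable pair of generalized morphisms. -/
noncomputable def composablePair {D : VCat V} {x y z : D.carrier} {a : A}
    (b : E.obj a ⟶ (x ⟶[V] y)) (b' : E.obj a ⟶ (y ⟶[V] z)) :
    wreathLin E (constTuple 2 a) ⟶ D :=
  linLift (m := 2) (fun t => pairVert x y z t.down) fun
    | 0 => b
    | 1 => b'

theorem edge_composablePair_zero {D : VCat V} {x y z : D.carrier} {a : A}
    (b : E.obj a ⟶ (x ⟶[V] y)) (b' : E.obj a ⟶ (y ⟶[V] z)) :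
    edge (composablePair b b') (0 : Fin 2) = b :=
  linGen_linLift (m := 2) (B := fun _ => E.obj a) (D := D) _ _ 0

theorem edge_composablePair_one {D : VCat V} {x y z : D.carrier} {a : A}
    (b : E.obj a ⟶ (x ⟶[V] y)) (b' : E.obj a ⟶ (y ⟶[V] z)) :
    edge (composablePair b b') (1 : Fin 2) = b' :=
  linGen_linLift (m := 2) (B := fun _ => E.obj a) (D := D) _ _ 1

/-- The total edge of the double of an object. -/
def totalEdge (a : A) : constTuple 1 a ⟶ constTuple 2 a :=
  longEdgeHom (X := constTuple 2 a) (i := (0 : Fin 3)) (j := (2 : Fin 3)) (Fin.zero_le _)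
    fun _ => 𝟙 a

/-- Restriction along the total edge is composition. -/
theorem pull_totalEdge {D : VCat V} {a : A} (H : wreathLin E (constTuple 2 a) ⟶ D) :
    pull (totalEdge a) H = arrow (emul (edge H (0 : Fin 2)) (edge H (1 : Fin 2))) := by
  refine (pull_longEdgeHom (X := constTuple 2 a) _ _ H).trans (congrArg arrow ?_)
  refine Eq.trans ?_ (emul_map H (linGen (fun _ : Fin 2 => E.obj a) 0)
    (linGen (fun _ : Fin 2 => E.obj a) 1))
  refine congrArg (fun t => t ≫ vmap H (⟨0⟩ : ULift.{u} (Fin 3)) (⟨2⟩ : ULift.{u} (Fin 3))) ?_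
  refine Eq.trans ?_ (FamCat.emul_pt (P := linFam (m := 2) fun _ => E.obj a)
    (linEdge (B := fun _ : Fin 2 => E.obj a) 0 (𝟙 _))
    (linEdge (B := fun _ : Fin 2 => E.obj a) 1 (𝟙 _))).symm
  refine congrArg _ (linPt_ext fun k => ?_)
  refine (linAt_linPt (B := fun _ : Fin 2 => E.obj a) _ _ k).trans ?_
  refine Eq.trans ?_ (linAt_linMul (linEdge (B := fun _ : Fin 2 => E.obj a) 0 (𝟙 _))
    (linEdge (B := fun _ : Fin 2 => E.obj a) 1 (𝟙 _)) k).symm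
  obtain ⟨k, hk⟩ := k
  rw [E.map_id]
  match k with
  | 0 =>
    exact ((dif_pos (Fin.castSucc_lt_succ (i := (0 : Fin 2)))).trans
      (linAt_linEdge (B := fun _ : Fin 2 => E.obj a) 0 (𝟙 _) _)).symm
  | 1 =>
    exact ((dif_neg (lt_irrefl (1 : Fin 3))).trans
      (linAt_linEdge (B := fun _ : Fin 2 => E.obj a) 1 (𝟙 _) _)).symm

theorem eq_composablePair {D : VCat V} {a : A} {H : wreathLin E (constTuple 2 a) ⟶ D}
    {x y z : D.carrier} {b : E.obj a ⟶ (x ⟶[V] y)} {b' : E.obj a ⟶ (y ⟶[V] z)}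
    (h : arrow (edge H (0 : Fin 2)) = arrow b) (h' : arrow (edge H (1 : Fin 2)) = arrow b') :
    H = composablePair b b' := by
  refine wreathLin_ext (fun i => ?_) fun k => ?_
  · match i with
    | 0 => exact congrArg (fun t => vert t (0 : Fin 2)) h
    | 1 => exact congrArg (fun t => vert t (1 : Fin 2)) h
    | 2 => exact congrArg (fun t => vert t (1 : Fin 2)) h'
  · match k with
    | 0 => exact (arrow_heq h).trans (heq_of_eq (edge_composablePair_zero b b').symm)
    | 1 => exact (arrow_heq h').trans (heq_of_eq (edge_composablePair_one b b').symm)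

theorem pull_totalEdge_composablePair {D : VCat V} {x y z : D.carrier} {a : A}
    (b : E.obj a ⟶ (x ⟶[V] y)) (b' : E.obj a ⟶ (y ⟶[V] z)) :
    pull (totalEdge a) (composablePair b b') = arrow (emul b b') :=
  (pull_totalEdge _).trans (congrArg arrow (congrArg₂ emul (edge_composablePair_zero b b')
    (edge_composablePair_one b b')))

/-- The degenerate edge of the empty tuple. -/
def degenerateEdge (a : A) : constTuple 1 a ⟶ emptyTuple A :=
  longEdgeHom (X := emptyTuple A) (le_refl (0 : Fin 1)) fun k => k.1.elim0

/-- Restriction along the degenerate edge picks identities. -/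
theorem pull_degenerateEdge {D : VCat V} (a : A) (d : D.carrier) :
    pull (degenerateEdge a) (pointAt d) = arrow (eone (E.obj a) d) := by
  refine (pull_longEdgeHom (X := emptyTuple A) _ _ _).trans (congrArg arrow ?_)
  refine Eq.trans ?_ (eone_map (pointAt d) (⟨0⟩ : ULift.{u} (Fin 1)))
  refine congrArg (fun t => t ≫ vmap (pointAt d) (⟨0⟩ : ULift.{u} (Fin 1))
    (⟨0⟩ : ULift.{u} (Fin 1))) ?_
  refine Eq.trans ?_ (FamCat.eone_pt (P := linFam (m := 0) fun k => E.obj k.elim0) _ _).symm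
  exact congrArg _ (linPt_ext fun k => k.1.elim0)

/-- A natural family of functions has an underlying function on objects, and acts on generalized
morphisms. -/
theorem exists_components {C D : VCat V} (α : ∀ X, (wreathLin E X ⟶ C) → (wreathLin E X ⟶ D))
    (hα : ∀ {X Y : Wreath A} (f : X ⟶ Y) (h : wreathLin E Y ⟶ C),
      α X (pull f h) = pull f (α Y h)) :
    ∃ f : C.carrier → D.carrier, (∀ c, α _ (pointAt c) = pointAt (f c)) ∧
      ∀ (a : A) (x y : C.carrier) (b : E.obj a ⟶ (x ⟶[V] y)),
        ∃ b' : E.obj a ⟶ (f x ⟶[V] f y), α _ (arrow b) = arrow b' := by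
  refine ⟨fun c => vert (α _ (pointAt c)) (0 : Fin 1), fun _ => pointAt_ext rfl,
    fun a x y b => ?_⟩
  have hv : ∀ i : Fin 2, vert (α _ (arrow b)) i =
      vert (α _ (pointAt (vert (arrow b) i))) (0 : Fin 1) := fun i => by
    have := hα (vertexHom (constTuple 1 a) i) (arrow b)
    rw [pull_vertexHom, pull_vertexHom] at this
    exact (congrArg (fun t => vert t (0 : Fin 1)) this).symm
  have hx : vert (α _ (arrow b)) (0 : Fin 2) = vert (α _ (pointAt x)) (0 : Fin 1) := hv 0
  have hy : vert (α _ (arrow b)) (1 : Fin 2) = vert (α _ (pointAt y)) (0 : Fin 1) := hv 1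
  dsimp only
  rw [← hx, ← hy]
  exact ⟨_, arrow_ext rfl rfl HEq.rfl⟩

theorem eq_of_arrow_eq {D : VCat V} {a : A} {d d' : D.carrier} {b b' : E.obj a ⟶ (d ⟶[V] d')}
    (h : arrow b = arrow b') : b = b' :=
  eq_of_heq (arrow_heq h)

/-- Uniqueness of the `V`-functor which induces a given family of functions. -/
theorem functor_ext_of_dense (hE : IsDense E) {C D : VCat V} {F F' : C ⟶ D}
    (h0 : ∀ c : C.carrier, pointAt (A := A) (E := E) c ≫ F = pointAt c ≫ F')
    (h1 : ∀ (a : A) (x y : C.carrier) (b : E.obj a ⟶ (x ⟶[V] y)), arrow b ≫ F = arrow b ≫ F') :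
    F = F' := by
  have hobj : vobj F = vobj F' := funext fun c =>
    congrArg (fun t => vert t (0 : Fin 1)) (h0 c)
  have hmap : ∀ (a : A) (x y : C.carrier) (b : E.obj a ⟶ (x ⟶[V] y)),
      HEq (b ≫ vmap F x y) (b ≫ vmap F' x y) := fun a x y b => by
    have := h1 a x y b
    rw [arrow_comp, arrow_comp] at this
    exact arrow_heq this
  obtain ⟨Fo, Fm, F1, F2⟩ := F
  obtain ⟨Fo', Fm', F1', F2'⟩ := F'
  obtain rfl : Fo = Fo' := hobj
  exact VCat.functor_ext rfl fun x y => heq_of_eq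
    (hE.hom_ext fun a b => eq_of_heq (hmap a x y b))

/-- A natural family of functions which acts compatibly on objects and on generalized
morphisms is induced by a `V`-functor: by density the action on generalized morphisms comes from
morphisms of hom-objects, and the operators of lengths two and zero give its functoriality. -/
theorem exists_functor_of_dense (hE : IsDense E) {C D : VCat V}
    (α : ∀ X, (wreathLin E X ⟶ C) → (wreathLin E X ⟶ D))
    (hα : ∀ {X Y : Wreath A} (f : X ⟶ Y) (h : wreathLin E Y ⟶ C),
      α X (pull f h) = pull f (α Y h)) :
    ∃ F : C ⟶ D, (∀ c, pointAt c ≫ F = α _ (pointAt c)) ∧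
      ∀ (a : A) (x y : C.carrier) (b : E.obj a ⟶ (x ⟶[V] y)), arrow b ≫ F = α _ (arrow b) := by
  obtain ⟨f, hf, hg⟩ := exists_components α hα
  choose g hg using hg
  have gnat : ∀ {a a' : A} (u : a' ⟶ a) {x y : C.carrier} (b : E.obj a ⟶ (x ⟶[V] y)),
      g a' x y (E.map u ≫ b) = E.map u ≫ g a x y b := by
    intro a a' u x y b
    have e : ∀ {D : VCat V} {d d' : D.carrier} (b : E.obj a ⟶ (d ⟶[V] d')),
        pull (edgeHom (X := constTuple 1 a) (0 : Fin 1) u) (arrow b) = arrow (E.map u ≫ b) :=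
      fun b => (pull_edgeHom _ _ _).trans (congrArg (fun t => arrow (E.map u ≫ t)) (edge_arrow b))
    apply eq_of_arrow_eq
    rw [← hg, ← e, hα, hg, e]
  have gmul : ∀ {a : A} {x y z : C.carrier} (b : E.obj a ⟶ (x ⟶[V] y))
      (b' : E.obj a ⟶ (y ⟶[V] z)), g a x z (emul b b') = emul (g a x y b) (g a y z b') := by
    intro a x y z b b'
    have e : α _ (composablePair b b') = composablePair (g a x y b) (g a y z b') := by
      apply eq_composablePair
      · rw [← hg, ← pull_edgeHom_id (X := constTuple 2 a), ← hα, pull_edgeHom_id]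
        exact congrArg (fun t => α _ (arrow t)) (edge_composablePair_zero b b')
      · rw [← hg, ← pull_edgeHom_id (X := constTuple 2 a), ← hα, pull_edgeHom_id]
        exact congrArg (fun t => α _ (arrow t)) (edge_composablePair_one b b')
    apply eq_of_arrow_eq
    rw [← hg, ← pull_totalEdge_composablePair, hα, e, pull_totalEdge_composablePair]
  have gone : ∀ (a : A) (x : C.carrier), g a x x (eone _ x) = eone _ (f x) := by
    intro a x
    apply eq_of_arrow_eq
    rw [← hg, ← pull_degenerateEdge, hα, hf, pull_degenerateEdge]
  have hG : ∀ x y : C.carrier, ∃ G : (x ⟶[V] y) ⟶ (f x ⟶[V] f y),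
      ∀ (a : A) (b : E.obj a ⟶ (x ⟶[V] y)), b ≫ G = g a x y b := fun x y =>
    (hE _ _ (fun a b => g a x y b) fun _ _ u b => gnat u b).exists
  choose G hG using hG
  let F : EnrichedFunctor V C.carrier D.carrier :=
    { obj := f
      map := G
      map_id := fun x => by
        refine hE.hom_ext fun a t => ?_
        obtain rfl : t = toUnit _ := toUnit_unique _ _
        rw [← Category.assoc]
        exact (hG x x a (eone _ x)).trans (gone a x)
      map_comp := fun x y z => by
        refine hE.hom_ext fun a t => ?_
        obtain ⟨b, b', rfl⟩ : ∃ b b', t = lift b b' :=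
          ⟨_, _, (lift_comp_fst_snd t).symm⟩
        rw [lift_map_assoc, hG, hG, ← Category.assoc]
        exact (hG x z a (emul b b')).trans (gmul b b') }
  refine ⟨F, fun c => by rw [hf]; exact pointAt_ext rfl, fun a x y b => ?_⟩
  exact (arrow_comp b (F : C ⟶ D)).trans ((congrArg arrow (hG _ _ _ b)).trans (hg a x y b).symm)

/-- The nerve of enriched categories along linear enriched categories is fully faithful if
the objects of `V` from which these are built are dense. -/
theorem isDense_wreathFunctor (hE : IsDense E) : IsDense (wreathFunctor E) := by
  suffices h : ∀ (C D : VCat V) (α : ∀ X, (wreathLin E X ⟶ C) → (wreathLin E X ⟶ D))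
      (_ : ∀ (X Y : Wreath A) (f : X ⟶ Y) (h : wreathLin E Y ⟶ C),
        α X (pull f h) = pull f (α Y h)),
      ∃! F : C ⟶ D, ∀ X (h : wreathLin E X ⟶ C), h ≫ F = α X h from h
  intro C D α hα
  replace hα : ∀ {X Y : Wreath A} (f : X ⟶ Y) (h : wreathLin E Y ⟶ C),
    α X (pull f h) = pull f (α Y h) := fun f h => hα _ _ f h
  obtain ⟨F, hF0, hF1⟩ := exists_functor_of_dense hE α hα
  refine ⟨F, fun X h => ?_, fun F' hF' => ?_⟩
  · refine wreathLin_ext (fun i => ?_) fun k => ?_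
    · have := hF0 (vert h i)
      rw [← pull_vertexHom, pull_comp, hα, pull_vertexHom, pull_vertexHom] at this
      exact congrArg (fun t => vert t (0 : Fin 1)) this
    · have := hF1 _ _ _ (edge h k)
      rw [← pull_edgeHom_id, pull_comp, hα, pull_edgeHom_id, pull_edgeHom_id] at this
      exact arrow_heq this
  · exact functor_ext_of_dense hE (fun c => (hF' _ _).trans (hF0 c).symm)
      fun a x y b => (hF' _ _).trans (hF1 a x y b).symm

end Familial

/-! ### Realizations of level-trees -/

namespace Familial

open MonoidalCategory CartesianMonoidalCategory

/-- The `(n+1)`-graph of a tree with root valence `m` is presented by `m + 1` vertices in a row and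
the `n`-graphs of the trees grafted onto the root edges. -/
def starSuspension (n m : ℕ) (c : Fin m → LevelTree) :
    Suspension (NGraph.star.{u} (n + 1) (.node m c))
      (fun k : Fin m => (⟨k.castSucc⟩ : ULift.{u} (Fin (m + 1)))) (fun k => ⟨k.succ⟩)
      (fun k => NGraph.star n (c k)) where
  vert := Equiv.refl _
  cell _ _ :=
    { toFun := fun x => ⟨x.down.1, ⟨x.down.2⟩⟩
      invFun := fun x => ⟨⟨x.1, x.2.down⟩⟩
      left_inv := fun _ => rfl
      right_inv := fun _ => rfl }
  vert_src _ _ := rfl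
  vert_tgt _ _ := rfl
  cell_src _ _ _ := rfl
  cell_tgt _ _ _ := rfl

/-- The functor `E` is a dense embedding of `A` whose values are free with respect to `U` on the
`n`-graphs of a given family of level-trees. The existence of global points is needed to pass
from `E` to the wreath product. -/
structure IsRealization {V : Type (u + 1)} [Category.{u} V] [CartesianMonoidalCategory V] {n : ℕ}
    (U : V ⥤ NGraph.{u} n) {A : Type} [Category.{0} A] (tree : A → LevelTree) (E : A ⥤ V) :
    Prop where
  full : E.Full
  faithful : E.Faithful
  point : ∀ a, Nonempty (𝟙_ V ⟶ E.obj a)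
  dense : IsDense E
  universal : ∀ a, ∃ η : NGraph.star n (tree a) ⟶ U.obj (E.obj a), IsUniversalArrow U η

namespace IsRealization

variable {V : Type (u + 1)} [Category.{u} V] [CartesianMonoidalCategory V] {n : ℕ}
  {U : V ⥤ NGraph.{u} n} {A : Type} [Category.{0} A] {tree : A → LevelTree} {E : A ⥤ V}

theorem comp_equivalence (h : IsRealization U tree E) {A' : Type} [Category.{0} A'] (K : A' ⥤ A)
    [K.Full] [K.Faithful] [K.EssSurj] : IsRealization U (fun a => tree (K.obj a)) (K ⋙ E) where
  full := by
    have := h.full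
    infer_instance
  faithful := by
    have := h.faithful
    infer_instance
  point a := h.point _
  dense := h.dense.comp_equivalence K
  universal a := h.universal _

/-- Every object of a `V`-category `C` is the value of a `V`-functor from the terminal one. -/
theorem nonempty_point (C : VCat V) (c : C.carrier) : Nonempty (𝟙_ (VCat V) ⟶ C) :=
  ⟨show VCat.unit ⟶ C from show EnrichedFunctor V (VCat.unit (V := V)).carrier C.carrier from
    { obj := fun _ => c
      map := fun _ _ => eId V c
      map_id := fun _ => Category.id_comp _
      map_comp := fun _ _ _ => by
        refine (emul_eone (eone (𝟙_ V ⊗ 𝟙_ V) c)).symm.trans ?_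
        refine congrArg (fun t => t ≫ eComp V c c c) ?_
        apply CartesianMonoidalCategory.hom_ext
        · refine (lift_fst _ _).trans (Eq.trans ?_ (tensorHom_fst _ _).symm)
          exact congrArg (fun t => t ≫ eId V c) (toUnit_unique _ _)
        · refine (lift_snd _ _).trans (Eq.trans ?_ (tensorHom_snd _ _).symm)
          exact congrArg (fun t => t ≫ eId V c) (toUnit_unique _ _) }⟩

theorem wreath [DistribCoproducts V] (h : IsRealization U tree E) :
    IsRealization (NCat.forgetSucc U)
      (fun X : Wreath A => .node X.len fun k => tree (X.obj k)) (wreathFunctor E) where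
  full := by
    have := h.full
    exact wreathFunctor_full h.point
  faithful := by
    have := h.faithful
    exact wreathFunctor_faithful h.point
  point X := nonempty_point _ (⟨0⟩ : ULift.{u} (Fin (X.len + 1)))
  dense := isDense_wreathFunctor h.dense
  universal X := by
    choose η hη using h.universal
    exact ⟨_, (starSuspension n X.len fun k => tree (X.obj k)).isUniversalArrow U
      (isFreeOn_linGen (B := fun k => E.obj (X.obj k))) fun k => hη (X.obj k)⟩

end IsRealization

theorem isRealization_zero : IsRealization NCat.forgetZero.{u}
    (fun _ : Discrete PUnit.{1} => .node 0 Fin.elim0) ((Functor.const _).obj PUnit.{u + 1}) where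
  full := ⟨fun {X Y} f => ⟨eqToHom (Subsingleton.elim X Y), by
    ext
    exact Subsingleton.elim (α := PUnit) _ _⟩⟩
  faithful := ⟨fun _ => Subsingleton.elim _ _⟩
  point _ := ⟨TypeCat.ofHom fun _ => PUnit.unit⟩
  dense C D a _ := by
    refine ⟨TypeCat.ofHom fun c => a ⟨⟨⟩⟩ (TypeCat.ofHom fun _ => c) PUnit.unit,
      fun X h => ?_, fun g hg => ?_⟩
    · ext x
      rfl
    · ext c
      exact congrArg (fun t => t PUnit.unit) (hg ⟨⟨⟩⟩ (TypeCat.ofHom fun _ => c))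
  universal a := by
    refine ⟨⟨fun k h x => PUnit.unit, fun _ _ _ => rfl, fun _ _ _ => rfl⟩, fun Z => ⟨?_, ?_⟩⟩
    · intro f g h
      ext x
      exact congrArg (fun F => NGraph.Hom.app F 0 le_rfl (⟨(0 : Fin 1)⟩ : ULift.{u} (Fin 1))) h
    · intro F
      refine ⟨TypeCat.ofHom fun _ => F.app 0 le_rfl (⟨(0 : Fin 1)⟩ : ULift.{u} (Fin 1)), ?_⟩
      apply NGraph.Hom.ext
      funext k h x
      obtain rfl : k = 0 := Nat.le_zero.mp h
      obtain ⟨x⟩ := x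
      obtain rfl : x = (0 : Fin 1) := Subsingleton.elim (α := Fin 1) _ _
      rfl

/-- The equivalence between the simplex category and its wreath product with the one-point
category. -/
def simplexWreath : SimplexCategory ⥤ Wreath (Discrete PUnit.{1}) where
  obj X := ⟨X.len, fun _ => ⟨⟨⟩⟩⟩
  map f := (⟨f, fun _ _ _ => 𝟙 _⟩ : Wreath.Hom _ _)
  map_id _ := Wreath.Hom.ext_of_base rfl fun _ _ _ _ => Subsingleton.elim _ _
  map_comp _ _ := Wreath.Hom.ext_of_base rfl fun _ _ _ _ => Subsingleton.elim _ _

instance : simplexWreath.Full where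
  map_surjective f :=
    ⟨Wreath.Hom.base f, Wreath.Hom.ext_of_base rfl fun _ _ _ _ => Subsingleton.elim _ _⟩

instance : simplexWreath.Faithful where
  map_injective h := congrArg Wreath.Hom.base h

instance : simplexWreath.EssSurj where
  mem_essImage X := ⟨SimplexCategory.mk X.len, ⟨Iso.refl _⟩⟩

theorem distribCoproducts_nCat : ∀ n, DistribCoproducts (NCat.{u} n)
  | 0 => inferInstanceAs (DistribCoproducts (Type u))
  | n + 1 =>
    have := distribCoproducts_nCat n
    inferInstanceAs (DistribCoproducts (VCat (NCat.{u} n)))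

theorem isRightAdjoint_forget : ∀ n, (NCat.forget.{u} n).IsRightAdjoint
  | 0 => isRightAdjoint_forgetZero
  | n + 1 =>
    have := distribCoproducts_nCat n
    have := isRightAdjoint_forget n
    isRightAdjoint_forgetSucc (NCat.forget n)

theorem exists_isRealization : ∀ n, ∃ E : Theta (n + 1) ⥤ NCat.{u} (n + 1),
    IsRealization (NCat.forget (n + 1)) (Theta.levelTree (n + 1)) E
  | 0 =>
    have := distribCoproducts_nCat.{u} 0
    ⟨_, isRealization_zero.wreath.comp_equivalence simplexWreath⟩
  | n + 1 => by
    have := distribCoproducts_nCat (n + 1)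
    obtain ⟨E, hE⟩ := exists_isRealization n
    exact ⟨_, hE.wreath⟩

end Familial

/-! ### Level-trees and skeletality -/

namespace Familial

theorem height_node_le_succ {m n : ℕ} {c : Fin m → LevelTree} :
    (LevelTree.node m c).height ≤ n + 1 ↔ ∀ i, (c i).height ≤ n := by
  simp [LevelTree.height, Finset.sup_le_iff]

theorem height_le_zero_iff {T : LevelTree} : T.height ≤ 0 ↔ T = .node 0 Fin.elim0 := by
  refine ⟨fun h => ?_, fun h => by simp [h, LevelTree.height]⟩
  obtain ⟨m, c⟩ := T
  rcases m with _ | m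
  · exact congrArg _ (funext fun i => i.elim0)
  · simp only [LevelTree.height, Finset.sup_le_iff] at h
    exact absurd (h 0 (Finset.mem_univ _)) (by simp)

/-- Grafting turns an enumeration of the trees of height at most `n` by `A` into an enumeration
of the trees of height at most `n + 1` by the tuples of elements of `A`. -/
theorem bijOn_graft {A : Type} {tree : A → LevelTree} {n : ℕ}
    (h : Set.BijOn tree Set.univ {T | T.height ≤ n}) :
    Set.BijOn (fun X : Wreath A => LevelTree.node X.len fun i => tree (X.obj i)) Set.univ
      {T | T.height ≤ n + 1} := by
  refine ⟨fun X _ => height_node_le_succ.mpr fun i => h.mapsTo (Set.mem_univ _), ?_, ?_⟩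
  · rintro ⟨m, X⟩ - ⟨m', X'⟩ - hXX'
    obtain ⟨rfl, hc⟩ := LevelTree.node.inj hXX'
    exact congrArg _ (funext fun i =>
      h.injOn (Set.mem_univ _) (Set.mem_univ _) (congrFun (eq_of_heq hc) i))
  · rintro ⟨m, c⟩ hT
    choose X _ hX using fun i => h.surjOn (height_node_le_succ.mp hT i)
    exact ⟨⟨m, X⟩, Set.mem_univ _, congrArg _ (funext hX)⟩

theorem bijOn_levelTree_zero :
    Set.BijOn (fun _ : Discrete PUnit.{1} => LevelTree.node 0 Fin.elim0) Set.univ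
      {T | T.height ≤ 0} :=
  ⟨fun _ _ => height_le_zero_iff.mpr rfl, fun _ _ _ _ _ => Subsingleton.elim _ _,
    fun _ hT => ⟨⟨⟨⟩⟩, Set.mem_univ _, (height_le_zero_iff.mp hT).symm⟩⟩

theorem bijective_simplexWreath_obj : Function.Bijective simplexWreath.obj :=
  ⟨fun _ _ h => SimplexCategory.ext (congrArg Wreath.len h), fun X =>
    ⟨SimplexCategory.mk X.len, rfl⟩⟩

theorem bijOn_levelTree : ∀ n,
    Set.BijOn (Theta.levelTree (n + 1)) Set.univ {T | T.height ≤ n + 1}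
  | 0 => (bijOn_graft bijOn_levelTree_zero).comp
      (Set.bijOn_univ.mpr bijective_simplexWreath_obj)
  | n + 1 => bijOn_graft (bijOn_levelTree n)

/-- A wreath product with a skeletal category is skeletal, as the simplex category has no
automorphisms besides identities. -/
theorem skeletal_wreath {A : Type} [Category.{0} A] (hA : Skeletal A) : Skeletal (Wreath A) := by
  rintro X Y ⟨e⟩
  have h1 : Wreath.Hom.base e.hom ≫ Wreath.Hom.base e.inv = 𝟙 _ :=
    congrArg Wreath.Hom.base e.hom_inv_id
  have h2 : Wreath.Hom.base e.inv ≫ Wreath.Hom.base e.hom = 𝟙 _ :=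
    congrArg Wreath.Hom.base e.inv_hom_id
  have hlen : X.len = Y.len := congrArg SimplexCategory.len
    (SimplexCategory.skeletal ⟨⟨_, _, h1, h2⟩⟩)
  obtain ⟨m, X⟩ := X
  obtain ⟨m', Y⟩ := Y
  obtain rfl : m = m' := hlen
  refine congrArg _ (funext fun i => hA ⟨?_⟩)
  have b1 : Wreath.Hom.base e.hom = 𝟙 _ :=
    have : IsIso (Wreath.Hom.base e.hom) := ⟨_, h1, h2⟩
    SimplexCategory.eq_id_of_isIso _
  have b2 : Wreath.Hom.base e.inv = 𝟙 _ :=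
    have : IsIso (Wreath.Hom.base e.inv) := ⟨_, h2, h1⟩
    SimplexCategory.eq_id_of_isIso _
  have i1 : Wreath.InBlock (Wreath.Hom.base e.hom) i i := b1 ▸ Wreath.inBlock_id_self i
  have i2 : Wreath.InBlock (Wreath.Hom.base e.inv) i i := b2 ▸ Wreath.inBlock_id_self i
  have key : ∀ {Z W : Wreath A} (f : Z ⟶ W) (g : W ⟶ Z) (_ : f ≫ g = 𝟙 Z) (i : Fin Z.len)
      (k : Fin W.len) (h : Wreath.InBlock (Wreath.Hom.base f) i k)
      (h' : Wreath.InBlock (Wreath.Hom.base g) k i),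
      Wreath.Hom.comp f i k h ≫ Wreath.Hom.comp g k i h' = 𝟙 _ := by
    intro Z W f g hfg i k h h'
    refine (Wreath.Hom.trans_comp f g (h.comp h') h h').symm.trans ?_
    have : ∀ (t : Z ⟶ Z) (_ : t = 𝟙 Z) (ht : Wreath.InBlock (Wreath.Hom.base t) i i),
        Wreath.Hom.comp t i i ht = 𝟙 _ := by
      rintro _ rfl _
      rfl
    exact this (f ≫ g) hfg _
  exact ⟨Wreath.Hom.comp e.hom i i i1, Wreath.Hom.comp e.inv i i i2,
    key _ _ e.hom_inv_id i i i1 i2, key _ _ e.inv_hom_id i i i2 i1⟩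

theorem skeletal_theta : ∀ n, Skeletal (Theta (n + 1))
  | 0 => SimplexCategory.skeletal
  | n + 1 => skeletal_wreath (skeletal_theta n)

end Familial

open Familial in
theorem mainTheorem2 (n : ℕ) (hn : 1 ≤ n) :
    (NCat.forget.{u} n).IsRightAdjoint ∧
    Set.BijOn (Theta.levelTree n) Set.univ {T | T.height ≤ n} ∧
    ∀ (F : NGraph.{u} n ⥤ NCat.{u} n) (_ : F ⊣ NCat.forget.{u} n),
      ∃ E : Theta n ⥤ NCat.{u} n,
        E.Full ∧ E.Faithful ∧ Function.Injective E.obj ∧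
        (∀ X : Theta n, E.obj X = F.obj (NGraph.star n (Theta.levelTree n X))) ∧
        Set.range E.obj = {C | ∃ T : LevelTree, T.height ≤ n ∧ C = F.obj (NGraph.star n T)} ∧
        (nerveAlong E).Full ∧ (nerveAlong E).Faithful := by
  obtain ⟨n, rfl⟩ : ∃ k, n = k + 1 := ⟨n - 1, by omega⟩
  have hT := bijOn_levelTree n
  refine ⟨isRightAdjoint_forget _, hT, fun F adj => ?_⟩
  obtain ⟨E, hE⟩ := exists_isRealization.{u} n
  have e : ∀ X, Nonempty (E.obj X ≅ F.obj (NGraph.star _ (Theta.levelTree (n + 1) X))) :=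
    fun X => (hE.universal X).elim fun _ h => h.nonempty_iso (isUniversalArrow_unit adj _)
  have := hE.full
  have := hE.faithful
  -- transport `E` along these isomorphisms, so that its values are those of `F`
  let E' := E.copyObj _ fun X => (e X).some
  let i : E ≅ E' := E.isoCopyObj _ _
  have full : E'.Full := Functor.Full.of_iso i
  have faithful : E'.Faithful := Functor.Faithful.of_iso i
  have dense : IsDense E' := hE.dense.of_iso i.symm
  refine ⟨E', full, faithful, fun X Y h => ?_, fun _ => rfl, ?_, dense.nerveAlong_full,
    dense.nerveAlong_faithful⟩
  · exact skeletal_theta n ⟨E'.preimageIso (eqToIso h)⟩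
  · ext C
    constructor
    · rintro ⟨X, rfl⟩
      exact ⟨_, hT.mapsTo (Set.mem_univ X), rfl⟩
    · rintro ⟨T, h, rfl⟩
      obtain ⟨X, -, rfl⟩ := hT.surjOn h
      exact ⟨X, rfl⟩
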